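/- \textbf{Setting.} Let $M$ be a smooth manifold (possibly with boundary) of dimension $d=n+1\ge 3$ with a conformal structure $[g]$ of Riemannian signature. For a metric $g\in[g]$ let $\nabla$ be its Levi-Civita connection, $P_{ab}$ its Schouten tensor ($\mathrm{Ric}=(d-2)P+Jg$, $J=g^{ab}P_{ab}$), and $\Delta=-g^{ab}\nabla_a\nabla_b$. In the scale $g$ (which also trivialises the density bundles) the standard tractor bundle is $\mathcal T=\mathbb R\oplus T^*M\oplus\mathbb R\ni(\sigma,\mu_b,\rho)$, with tractor metric $h$ given by the quadratic form $g^{-1}(\mu,\mu)+2\sigma\rho$ and tractor connection $$\nabla^{\mathcal T}_a(\sigma,\mu_b,\rho)=(\nabla_a\sigma-\mu_a,\ \nabla_a\mu_b+g_{ab}\rho+P_{ab}\sigma,\ \nabla_a\rho-P_{ab}\mu^b),$$ whose curvature is $\Omega_{ab}V=[\nabla_a,\nabla_b]V$. A (directed) scalar negative almost Einstein structure $(M,[g],I)$ is given by a smooth section $I$ of $\mathcal T$ with $\nabla^{\mathcal T}I=0$ whose first component $\sigma$ satisfies $$S(g,\sigma)=\tfrac2d\,\sigma(J-\Delta)\sigma-|d\sigma|_g^2<0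 .$$ Its scale singularity set is $\Sigma=\{\sigma=0\}$. For a hypersurface $\Sigma$ with unit conormal $\nu$ (in the scale $g$), let $L(u,v)=(\nabla_u\nu)(v)$ for $u,v\in T\Sigma$, let $H=\tfrac1n\operatorname{tr}_{g_\Sigma}L$ be the mean curvature, $N=(0,\nu,-H)$ the normal tractor, and $\mathcal T_\Sigma:=N^\perp\subset\mathcal T|_\Sigma$. If $n\ge3$, then $\mathcal T_\Sigma$ is identified with the standard tractor bundle of the induced conformal manifold $(\Sigma,[g_\Sigma])$ by the isomorphism $(\sigma,\mu,\rho)\mapsto(\sigma,\ \mu-H\sigma\nu,\ \rho+\tfrac12H^2\sigma)$ (splittings by $g$ and by $g_\Sigma=g|_\Sigma$; covectors annihilating the normal are identified with covectors of $\Sigma$), and $\nabla^{\mathcal T_\Sigma}$ is the tractor connection of $(\Sigma,[g_\Sigma])$ transferred to $N^\perp$. If $n=2$, then $\nabla^{\mathcal T_\Sigma}$ is defined to be the orthogonal projection of $\nabla^{\mathcal T}$ to $N^\perp$. Let $\Omega^\Sigma\in\Lambda^2T^*\Sigma\otimes\operatorname{End}\mathcal T_\Sigma$ be the curvature of $\nabla^{\mathcal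 T_\Sigma}$. \textbf{Theorem.} Let $(M^d,[g],I)$, $d\ge3$, be a scalar negative almost Einstein structure with non-empty scale singularity hypersurface $\Sigma$. Then $d\sigma\ne0$ at every point of $\Sigma$, and the following holds for every representative $g\in[g]$ and for $\Sigma$ (more generally, for every immersed hypersurface contained in the zero set of $\sigma$). \begin{enumerate} \item The tractor connection of $(M,[g])$ preserves $\mathcal T_\Sigma$ and restricts to $\nabla^{\mathcal T_\Sigma}$: if $V$ is a smooth section of $\mathcal T_\Sigma=N^\perp$ and $w\in T\Sigma$, then $\nabla^{\mathcal T}_wV\in\mathcal T_\Sigma$ and $\nabla^{\mathcal T_\Sigma}_wV=\nabla^{\mathcal T}_wV$. \item The parallel transport of $\nabla^{\mathcal T_\Sigma}$ is the restriction of that of $\nabla^{\mathcal T}$: for every smooth curve in $\Sigma$ and every $t_0\in\mathcal T_\Sigma$ over its initial point, a tractor $t_1$ over the end point is the $\nabla^{\mathcal T}$-parallel transport of $t_0$ along the curve if and only if $t_1$ lies in $\mathcal T_\Sigma$ and is the $\nabla^{\mathcal T_\Sigma}$-parallel transport of $t_0$. \item $\Omega(u,v)=\Omega^\Sigma(u,v)$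 along $\Sigma$ for all $u,v\in T\Sigma$, where $\Omega^\Sigma(u,v)$ is extended by $0$ on $N$ to an endomorphism of $\mathcal T|_\Sigma$. \item If $d\ne4$, then $\Omega=\Omega^\Sigma$ along $\Sigma$, where $\Omega^\Sigma$ is trivially extended to a section of $\Lambda^2T^*M\otimes\operatorname{End}\mathcal T$ along $\Sigma$: it acts through the orthogonal projections $TM|_\Sigma\to T\Sigma$ and $\mathcal T|_\Sigma\to\mathcal T_\Sigma$. \end{enumerate} -/

import Mathlib

open Set Filter Topology Manifold Bundle
open scoped ContDiff

noncomputable section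

namespace ConformalTractor

/-- The model space `ℝᵈ` of a `d`-dimensional manifold. -/
abbrev Euc (d : ℕ) := EuclideanSpace ℝ (Fin d)

/-! ### Riemannian and tractor calculus in one coordinate chart

`s` is the range of the model with corners (the whole `ℝᵈ`, a half space, ...), in which all
derivatives are taken, and `G` is the matrix of components `g_ij` of a metric as a function of
the coordinates. The conventions are `(∇_a ∇_b - ∇_b ∇_a) V^c = R_ab^c_d V^d`,
`Ric_ab = R_ca^c_b`, `Ric = (d - 2) P + J g`, `J = g^ab P_ab`. -/

section Chart

variable {d : ℕ}

/-- The partial derivative `∂_i f`. -/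
def pd {F : Type*} [NormedAddCommGroup F] [NormedSpace ℝ F] (s : Set (Euc d)) (i : Fin d)
    (f : Euc d → F) (z : Euc d) : F :=
  fderivWithin ℝ f s z (EuclideanSpace.single i 1)

/-- The Christoffel symbol `Γ^c_ab` of the Levi-Civita connection. -/
def christoffel (s : Set (Euc d)) (G : Euc d → Matrix (Fin d) (Fin d) ℝ) (c a b : Fin d)
    (z : Euc d) : ℝ :=
  (1 / 2) * ∑ e, (G z)⁻¹ c e *
    (pd s a (fun y => G y b e) z + pd s b (fun y => G y a e) z - pd s e (fun y => G y a b) z)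

/-- The Riemann curvature `R_ab^c_d`. -/
def riemann (s : Set (Euc d)) (G : Euc d → Matrix (Fin d) (Fin d) ℝ) (a b c e : Fin d)
    (z : Euc d) : ℝ :=
  pd s a (christoffel s G c b e) z - pd s b (christoffel s G c a e) z +
    ∑ f, (christoffel s G c a f z * christoffel s G f b e z -
      christoffel s G c b f z * christoffel s G f a e z)

/-- The Ricci tensor `Ric_ab = R_ca^c_b`. -/
def ricci (s : Set (Euc d)) (G : Euc d → Matrix (Fin d) (Fin d) ℝ) (a b : Fin d)
    (z : Euc d) : ℝ :=
  ∑ c, riemann s G c a c b z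

/-- The metric trace `J` of the Schouten tensor, `J = Sc / (2 (d - 1))`. -/
def schoutenTrace (s : Set (Euc d)) (G : Euc d → Matrix (Fin d) (Fin d) ℝ) (z : Euc d) : ℝ :=
  (∑ a, ∑ b, (G z)⁻¹ a b * ricci s G a b z) / (2 * ((d : ℝ) - 1))

/-- The Schouten tensor `P_ab`, given by `Ric_ab = (d - 2) P_ab + J g_ab`. It is used for
`d ≥ 3` only. -/
def schouten (s : Set (Euc d)) (G : Euc d → Matrix (Fin d) (Fin d) ℝ) (a b : Fin d)
    (z : Euc d) : ℝ :=
  (ricci s G a b z - schoutenTrace s G z * G z a b) / ((d : ℝ) - 2)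

/-- The Laplacian `Δ f = - g^ab ∇_a ∇_b f` (with positive spectrum). -/
def laplacian (s : Set (Euc d)) (G : Euc d → Matrix (Fin d) (Fin d) ℝ) (f : Euc d → ℝ)
    (z : Euc d) : ℝ :=
  -∑ a, ∑ b, (G z)⁻¹ a b *
    (pd s a (pd s b f) z - ∑ c, christoffel s G c a b z * pd s c f z)

/-- The component vectors `(σ, μ_1, …, μ_d, ρ)` of a tractor in a scale and a chart. -/
abbrev TractorCoords (d : ℕ) := ℝ × (Fin d → ℝ) × ℝ

/-- The connection form, in the direction `u`, of the normal conformal tractor connection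
`∇_a (σ, μ_b, ρ) = (∇_a σ - μ_a, ∇_a μ_b + g_ab ρ + P_ab σ, ∇_a ρ - P_ab μ^b)`. -/
def tractorForm (s : Set (Euc d)) (G : Euc d → Matrix (Fin d) (Fin d) ℝ) (z : Euc d)
    (u : Euc d) (t : TractorCoords d) : TractorCoords d :=
  (-∑ a, u a * t.2.1 a,
   fun b => ∑ a, u a * (-(∑ c, christoffel s G c a b z * t.2.1 c) + G z a b * t.2.2
      + schouten s G a b z * t.1),
   -∑ a, ∑ b, ∑ c, u a * schouten s G a b z * (G z)⁻¹ b c * t.2.1 c)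

/-- The tractor covariant derivative `∇_a t` of a tractor field given in a chart. -/
def chartTractorDeriv (s : Set (Euc d)) (G : Euc d → Matrix (Fin d) (Fin d) ℝ) (a : Fin d)
    (t : Euc d → TractorCoords d) (z : Euc d) : TractorCoords d :=
  pd s a t z + tractorForm s G z (EuclideanSpace.single a 1) (t z)

/-- The tractor curvature `Ω_ab t = (∇_a ∇_b - ∇_b ∇_a) t`, where `t` is extended to a field with
constant components. -/
def chartTractorCurv (s : Set (Euc d)) (G : Euc d → Matrix (Fin d) (Fin d) ℝ) (a b : Fin d)
    (t : TractorCoords d) (z : Euc d) : TractorCoords d :=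
  chartTractorDeriv s G a (chartTractorDeriv s G b fun _ => t) z -
    chartTractorDeriv s G b (chartTractorDeriv s G a fun _ => t) z

/-- The tractor metric `h`, the polarisation of `(σ, μ, ρ) ↦ g⁻¹(μ, μ) + 2 σ ρ`. -/
def chartTractorMetric (G : Matrix (Fin d) (Fin d) ℝ) (t t' : TractorCoords d) : ℝ :=
  (∑ a, ∑ b, G⁻¹ a b * t.2.1 a * t'.2.1 b) + t.1 * t'.2.2 + t.2.2 * t'.1

end Chart

/-! ### Manifolds

`M` is a smooth `d`-manifold (possibly with boundary or corners), modelled on `ℝᵈ` through `I`.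
A metric is a family `g` of bilinear forms on the tangent spaces. Around a point `x₀` we use the
chart `extChartAt I x₀`. -/

section Manifold

variable {d : ℕ} {H : Type*} [TopologicalSpace H] (I : ModelWithCorners ℝ (Euc d) H)
  {M : Type*} [TopologicalSpace M] [ChartedSpace H M] [IsManifold I ∞ M]

/-- A family of bilinear forms on the tangent spaces. -/
abbrev MetricField (M : Type*) [TopologicalSpace M] [ChartedSpace H M] :=
  ∀ x : M, TangentSpace I x →L[ℝ] TangentSpace I x →L[ℝ] ℝ

/-- The coordinate vector `∂_i` at the point `y`, for the chart at `x₀`. -/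
def coordVec (x₀ y : M) (i : Fin d) : TangentSpace I y :=
  (trivializationAt (Euc d) (TangentSpace I : M → Type _) x₀).symmL ℝ y (EuclideanSpace.single i 1)

/-- The components `v^i` of a tangent vector `v` at the point `y`, for the chart at `x₀`. -/
def vecCoords (x₀ y : M) : TangentSpace I y →L[ℝ] Euc d :=
  (trivializationAt (Euc d) (TangentSpace I : M → Type _) x₀).continuousLinearMapAt ℝ y

/-- The components `g_ij` of a metric in the chart at `x₀`, as functions of the coordinates. -/
def metricCoords (g : MetricField I M) (x₀ : M) (z : Euc d) : Matrix (Fin d) (Fin d) ℝ :=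
  Matrix.of fun i j => g ((extChartAt I x₀).symm z)
    (coordVec I x₀ ((extChartAt I x₀).symm z) i) (coordVec I x₀ ((extChartAt I x₀).symm z) j)

/-- The components of a metric at the point `x`, in the chart at `x`. -/
def metricAt (g : MetricField I M) (x : M) : Matrix (Fin d) (Fin d) ℝ :=
  metricCoords I g x (extChartAt I x x)

/-- The fibre at `x` of the standard tractor bundle `𝒯` of the conformal structure `[g]`, in the
splitting `𝒯 = ℰ[1] ⊕ T*M[1] ⊕ ℰ[-1]` given by the metric `g`, where the density bundles are
trivialised by `g`: the triples `(σ, μ, ρ)`. -/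
abbrev Tractor (x : M) := ℝ × (TangentSpace I x →L[ℝ] ℝ) × ℝ

/-- The components, in the chart at `x₀`, of a tractor at the point `y`. -/
def tractorCoords (x₀ y : M) (t : Tractor I y) : TractorCoords d :=
  (t.1, fun i => t.2.1 (coordVec I x₀ y i), t.2.2)

/-- The tractor at `x` with given components in the chart at `x`. -/
def tractorOfCoords (x : M) (t : TractorCoords d) : Tractor I x :=
  (t.1, ∑ i, t.2.1 i • (EuclideanSpace.proj i : Euc d →L[ℝ] ℝ).comp (vecCoords I x x), t.2.2)

/-- The tractor metric `h` at the point `x`. -/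
def tractorMetric (g : MetricField I M) (x : M) (t t' : Tractor I x) : ℝ :=
  chartTractorMetric (metricAt I g x) (tractorCoords I x x t) (tractorCoords I x x t')

/-- A tractor field on `M` is parallel for the tractor connection: in each chart all its
covariant derivatives `∇_a t` vanish. -/
def IsParallelTractor (g : MetricField I M) (t : ∀ x : M, Tractor I x) : Prop :=
  ∀ x₀ : M, ∀ z ∈ (extChartAt I x₀).target, ∀ a : Fin d,
    chartTractorDeriv (range I) (metricCoords I g x₀) a
      (fun y => tractorCoords I x₀ ((extChartAt I x₀).symm y) (t ((extChartAt I x₀).symm y))) z = 0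

/-- The curvature `Ω(u, v) t` of the tractor connection at the point `x`. -/
def tractorCurv (g : MetricField I M) (x : M) (u v : TangentSpace I x) (t : Tractor I x) :
    Tractor I x :=
  tractorOfCoords I x (∑ a, ∑ b, (vecCoords I x x u a * vecCoords I x x v b) •
    chartTractorCurv (range I) (metricCoords I g x) a b (tractorCoords I x x t) (extChartAt I x x))

/-- The conformally invariant quantity
`S(g, σ) = (2 / d) σ (J - Δ) σ - |dσ|²` of a function `σ`, at the point `x`. -/
def scalarQuantity (g : MetricField I M) (σ : M → ℝ) (x : M) : ℝ :=
  let G := metricCoords I g x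
  let z := extChartAt I x x
  let f : Euc d → ℝ := fun y => σ ((extChartAt I x).symm y)
  (2 / (d : ℝ)) * f z * (schoutenTrace (range I) G z * f z - laplacian (range I) G f z) -
    ∑ a, ∑ b, (G z)⁻¹ a b * pd (range I) a f z * pd (range I) b f z

/-! #### Tractor fields along a map

For `f : B → M`, a tractor field along `f` is a section `V` of the pullback `f^* 𝒯`, on which the
tractor connection of `M` induces the pullback connection. For `f = id` this is the tractor
connection itself, for an inclusion `f` it is differentiation along a submanifold, and for a curve
`f` it gives parallel transport. The set `T` is the domain of `V`. -/

variable {EB : Type*} [NormedAddCommGroup EB] [NormedSpace ℝ EB]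
  {HB : Type*} [TopologicalSpace HB] (J : ModelWithCorners ℝ EB HB)
  {B : Type*} [TopologicalSpace B] [ChartedSpace HB B]

/-- Smoothness of a tractor field along a map: its components are smooth. -/
def SmoothTractorAlong (f : B → M) (V : ∀ b, Tractor I (f b)) (T : Set B) : Prop :=
  ∀ b ∈ T, ContMDiffWithinAt J 𝓘(ℝ, TractorCoords d) ∞
    (fun b' => tractorCoords I (f b) (f b') (V b')) T b

/-- The covariant derivative `∇_w V` of a tractor field along `f`, in the direction of the tangent
vector `w` at the point `b`, for the (pullback of the) tractor connection of `(M, [g])`. -/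
def tractorDeriv (g : MetricField I M) (f : B → M) (V : ∀ b, Tractor I (f b)) (T : Set B) (b : B)
    (w : TangentSpace J b) : Tractor I (f b) :=
  let D : TractorCoords d :=
    mfderivWithin J 𝓘(ℝ, TractorCoords d) (fun b' => tractorCoords I (f b) (f b') (V b')) T b w
  tractorOfCoords I (f b)
    (D + tractorForm (range I) (metricCoords I g (f b)) (extChartAt I (f b) (f b))
        (vecCoords I (f b) (f b) (mfderivWithin J I f T b w)) (tractorCoords I (f b) (f b) (V b)))

/-- `t₁` is the parallel transport of `t₀` along the curve `γ` on `[a, b]`, for the tractor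
connection. -/
def IsTransport (g : MetricField I M) (γ : ℝ → M) (a b : ℝ) (t₀ : Tractor I (γ a))
    (t₁ : Tractor I (γ b)) : Prop :=
  ∃ V : ∀ r, Tractor I (γ r), SmoothTractorAlong I 𝓘(ℝ, ℝ) γ V (Icc a b) ∧
    (∀ r ∈ Icc a b, ∀ w, tractorDeriv I 𝓘(ℝ, ℝ) g γ V (Icc a b) r w = 0) ∧ V a = t₀ ∧ V b = t₁

end Manifold

/-! ### Hypersurfaces

`ι : S → M` is an immersion of an `n`-manifold into an `(n+1)`-manifold with metric `g`, and `ν` is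
a unit conormal field along it (in the scale `g`). -/

section Hypersurface

variable {n : ℕ} {H : Type*} [TopologicalSpace H] (I : ModelWithCorners ℝ (Euc (n + 1)) H)
  {M : Type*} [TopologicalSpace M] [ChartedSpace H M] [IsManifold I ∞ M]
  {H' : Type*} [TopologicalSpace H'] (J : ModelWithCorners ℝ (Euc n) H')
  {S : Type*} [TopologicalSpace S] [ChartedSpace H' S] [IsManifold J ∞ S]
  (g : MetricField I M) (ι : S → M) (ν : ∀ x : S, TangentSpace I (ι x) →L[ℝ] ℝ)

/-- `ν` is a smooth field of unit conormals of the hypersurface. -/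
def IsUnitConormal : Prop :=
  SmoothTractorAlong I J ι (fun x => ((0, ν x, 0) : Tractor I (ι x))) univ ∧
    ∀ x, tractorMetric I g (ι x) (0, ν x, 0) (0, ν x, 0) = 1 ∧
      ∀ w : TangentSpace J x, ν x (mfderiv J I ι x w) = 0

/-- The metric `ι^* g` induced on the hypersurface. -/
def inducedMetric : MetricField J S := fun x =>
  ContinuousLinearMap.bilinearComp (E := Euc (n + 1)) (F := Euc (n + 1)) (E' := Euc n) (F' := Euc n)
    (g (ι x)) (mfderiv J I ι x) (mfderiv J I ι x)

/-- The second fundamental form `L(w, w') = (∇_w ν)(w')`. The middle component of the tractor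
derivative of `(0, ν, 0)` is the Levi-Civita derivative `∇_w ν`. -/
def secondFundamentalForm (x : S) (w w' : TangentSpace J x) : ℝ :=
  (tractorDeriv I J g ι (fun y => ((0, ν y, 0) : Tractor I (ι y))) univ x w).2.1
    (mfderiv J I ι x w')

/-- The mean curvature `H = (1 / n) g_Σ^{ij} L_ij`. -/
def meanCurvature (x : S) : ℝ :=
  (1 / (n : ℝ)) * ∑ i, ∑ j, (metricAt J (inducedMetric I J g ι) x)⁻¹ i j *
    secondFundamentalForm I J g ι ν x (coordVec J x x i) (coordVec J x x j)

/-- The normal tractor `N = (0, ν, -H)`. -/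
def normalTractor (x : S) : Tractor I (ι x) := (0, ν x, -meanCurvature I J g ι ν x)

/-- Membership in the intrinsic tractor bundle `𝒯_Σ = N^⊥`, as a subbundle of `𝒯` along the
hypersurface. -/
def InSigmaBundle (x : S) (t : Tractor I (ι x)) : Prop :=
  tractorMetric I g (ι x) t (normalTractor I J g ι ν x) = 0

/-- The orthogonal projection of `𝒯` along the hypersurface onto `𝒯_Σ = N^⊥`. -/
def sigmaProj (x : S) (t : Tractor I (ι x)) : Tractor I (ι x) :=
  t - tractorMetric I g (ι x) t (normalTractor I J g ι ν x) • normalTractor I J g ι ν x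

/-- The orthogonal projection `T_{ι x} M → T_x S`, that is `a ↦ g_Σ^{ij} g(∂_j, a) ∂_i`. -/
def tangentProj (x : S) : TangentSpace I (ι x) →L[ℝ] TangentSpace J x :=
  ∑ i, ∑ j, (metricAt J (inducedMetric I J g ι) x)⁻¹ i j •
    (g (ι x) (mfderiv J I ι x (coordVec J x x j))).smulRight (coordVec J x x i)

/-- The canonical isomorphism from `N^⊥` to the standard tractor bundle of the conformal manifold
`(S, [ι^* g])`, with `N^⊥` split by `g` and the latter by `ι^* g`:
`(σ, μ, ρ) ↦ (σ, μ - H ν σ, ρ + (1 / 2) H² σ)`, where a covector that annihilates the normal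
direction is identified with its restriction to the hypersurface. -/
def toIntrinsic (x : S) (t : Tractor I (ι x)) : Tractor J x :=
  (t.1, (t.2.1 - (meanCurvature I J g ι ν x * t.1) • ν x).comp (mfderiv J I ι x),
    t.2.2 + (1 / 2) * meanCurvature I J g ι ν x ^ 2 * t.1)

/-- The inverse of `toIntrinsic`. -/
def ofIntrinsic (x : S) (t : Tractor J x) : Tractor I (ι x) :=
  (t.1, t.2.1.comp (tangentProj I J g ι x) + (meanCurvature I J g ι ν x * t.1) • ν x,
    t.2.2 - (1 / 2) * meanCurvature I J g ι ν x ^ 2 * t.1)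

section Along

variable {EB : Type*} [NormedAddCommGroup EB] [NormedSpace ℝ EB]
  {HB : Type*} [TopologicalSpace HB] (K : ModelWithCorners ℝ EB HB)
  {B : Type*} [TopologicalSpace B] [ChartedSpace HB B]

open Classical in
/-- The intrinsic tractor connection `∇^{𝒯_Σ}` on `𝒯_Σ = N^⊥`, for sections `V` along a map
`f : B → S`. If `n ≥ 3` it is the tractor connection of the conformal manifold `(S, [ι^* g])`;
if `n = 2` it is defined as the orthogonal projection of the ambient tractor connection. -/
def sigmaDeriv (f : B → S) (V : ∀ b, Tractor I (ι (f b))) (T : Set B) (b : B)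
    (w : TangentSpace K b) : Tractor I (ι (f b)) :=
  if n = 2 then
    sigmaProj I J g ι ν (f b) (tractorDeriv I K g (fun b' => ι (f b')) V T b w)
  else
    ofIntrinsic I J g ι ν (f b) (tractorDeriv J K (inducedMetric I J g ι) f
      (fun b' => toIntrinsic I J g ι ν (f b') (V b')) T b w)

end Along

/-- `t₁` is the parallel transport of `t₀` along the curve `γ` on `[a, b]` in the hypersurface, for
the intrinsic tractor connection of `𝒯_Σ`. -/
def IsSigmaTransport (γ : ℝ → S) (a b : ℝ) (t₀ : Tractor I (ι (γ a)))
    (t₁ : Tractor I (ι (γ b))) : Prop :=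
  ∃ V : ∀ r, Tractor I (ι (γ r)),
    SmoothTractorAlong I 𝓘(ℝ, ℝ) (fun r => ι (γ r)) V (Icc a b) ∧
    (∀ r ∈ Icc a b, InSigmaBundle I J g ι ν (γ r) (V r)) ∧
    (∀ r ∈ Icc a b, ∀ w, sigmaDeriv I J g ι ν 𝓘(ℝ, ℝ) γ V (Icc a b) r w = 0) ∧
    V a = t₀ ∧ V b = t₁

/-! The curvature of the projected connection, in the charts at `x` and `ι x`. -/

/-- The projection onto `N^⊥` in components, at the point with coordinates `z`. -/
def chartSigmaProj (x : S) (z : Euc n) (t : TractorCoords (n + 1)) : TractorCoords (n + 1) :=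
  let y := (extChartAt J x).symm z
  let N := tractorCoords I (ι x) (ι y) (normalTractor I J g ι ν y)
  t - chartTractorMetric (metricCoords I g (ι x) (extChartAt I (ι x) (ι y))) t N • N

/-- The projected connection `Proj ∘ ∇_i` in components. -/
def chartSigmaDeriv (x : S) (i : Fin n) (V : Euc n → TractorCoords (n + 1)) (z : Euc n) :
    TractorCoords (n + 1) :=
  let f : Euc n → Euc (n + 1) := fun z' => extChartAt I (ι x) (ι ((extChartAt J x).symm z'))
  chartSigmaProj I J g ι ν x z
    (pd (range J) i V z +
      tractorForm (range I) (metricCoords I g (ι x)) (f z) (pd (range J) i f z) (V z))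

/-- The curvature of the projected connection on `N^⊥`, `(u, v) ↦ Ω_ij u^i v^j` with
`Ω_ij t = (∇_i ∇_j - ∇_j ∇_i) t`, where `t` is extended to a section of `N^⊥` by projecting the
field with constant components. -/
def projectedCurv (x : S) (u v : TangentSpace J x) (t : Tractor I (ι x)) : Tractor I (ι x) :=
  let V : Euc n → TractorCoords (n + 1) := fun z =>
    chartSigmaProj I J g ι ν x z (tractorCoords I (ι x) (ι x) t)
  tractorOfCoords I (ι x) (∑ i, ∑ j, (vecCoords J x x u i * vecCoords J x x v j) •
    (chartSigmaDeriv I J g ι ν x i (chartSigmaDeriv I J g ι ν x j V) (extChartAt J x x) -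
      chartSigmaDeriv I J g ι ν x j (chartSigmaDeriv I J g ι ν x i V) (extChartAt J x x)))

open Classical in
/-- The curvature `Ω^Σ(u, v)` of the intrinsic tractor connection of `𝒯_Σ`, for `u`, `v` tangent to
the hypersurface, acting on sections of `𝒯_Σ = N^⊥`. -/
def sigmaCurv (x : S) (u v : TangentSpace J x) (t : Tractor I (ι x)) : Tractor I (ι x) :=
  if n = 2 then projectedCurv I J g ι ν x u v t
  else ofIntrinsic I J g ι ν x
    (tractorCurv J (inducedMetric I J g ι) x u v (toIntrinsic I J g ι ν x t))

/-- The trivial extension of `Ω^Σ` to a section of `Λ² T*M ⊗ End 𝒯` along the hypersurface: the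
tangent vectors of `M` are projected to the hypersurface and the tractors to `N^⊥`. -/
def sigmaCurvExt (x : S) (u v : TangentSpace I (ι x)) (t : Tractor I (ι x)) : Tractor I (ι x) :=
  sigmaCurv I J g ι ν x (tangentProj I J g ι x u) (tangentProj I J g ι x v)
    (sigmaProj I J g ι ν x t)

end Hypersurface

end ConformalTractor

end

noncomputable section

namespace ConformalTractor

/-! ### Connections on trivial bundles over a relatively open subset of a convex set -/

/-- `U` is a relatively open subset of the convex set `s` with non-empty interior. -/
structure IsChartDomain {E : Type*} [NormedAddCommGroup E] [NormedSpace ℝ E] (s U : Set E) :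
    Prop where
  convex : Convex ℝ s
  nonempty_interior : (interior s).Nonempty
  subset : U ⊆ s
  mem_nhdsWithin : ∀ z ∈ U, U ∈ 𝓝[s] z

section Generic

variable {E : Type*} [NormedAddCommGroup E] [NormedSpace ℝ E]
  {E' : Type*} [NormedAddCommGroup E'] [NormedSpace ℝ E']
  {F : Type*} [NormedAddCommGroup F] [NormedSpace ℝ F]
  {𝔄 : Type*} [NormedRing 𝔄] [NormedAlgebra ℝ 𝔄]
  {T : Type*} [NormedAddCommGroup T] [NormedSpace ℝ T]
  {s U : Set E} {s' U' : Set E'}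

theorem two_le_infty : (2 : ℕ∞ω) ≤ ∞ := by
  exact WithTop.coe_le_coe.2 (le_top : (2 : ℕ∞) ≤ ⊤)

theorem clm_mul_apply (f g : T →L[ℝ] T) (t : T) : (f * g) t = f (g t) := rfl

namespace IsChartDomain

theorem uniqueDiffOn (h : IsChartDomain s U) : UniqueDiffOn ℝ s :=
  uniqueDiffOn_convex h.convex h.nonempty_interior

theorem uniqueDiffWithinAt (h : IsChartDomain s U) {z : E} (hz : z ∈ U) :
    UniqueDiffWithinAt ℝ s z :=
  h.uniqueDiffOn z (h.subset hz)

theorem contDiffWithinAt (h : IsChartDomain s U) {f : E → F} {m : ℕ∞ω} (hf : ContDiffOn ℝ m f U)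
    {z : E} (hz : z ∈ U) : ContDiffWithinAt ℝ m f s z :=
  (hf z hz).mono_of_mem_nhdsWithin (h.mem_nhdsWithin z hz)

theorem differentiableWithinAt (h : IsChartDomain s U) {f : E → F} {m : ℕ∞ω}
    (hf : ContDiffOn ℝ m f U) (hm : m ≠ 0) {z : E} (hz : z ∈ U) :
    DifferentiableWithinAt ℝ f s z :=
  (h.contDiffWithinAt hf hz).differentiableWithinAt hm

theorem contDiffOn_fderivWithin (h : IsChartDomain s U) {f : E → F} {m k : ℕ∞ω}
    (hf : ContDiffOn ℝ m f U) (hk : k + 1 ≤ m) : ContDiffOn ℝ k (fderivWithin ℝ f s) U :=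
  fun _ hz => ((h.contDiffWithinAt hf hz).fderivWithin_right h.uniqueDiffOn hk
    (h.subset hz)).mono h.subset

theorem fderivWithin_comm (h : IsChartDomain s U) {f : E → F} (hf : ContDiffOn ℝ 2 f U)
    {z : E} (hz : z ∈ U) (u v : E) :
    fderivWithin ℝ (fderivWithin ℝ f s) s z u v = fderivWithin ℝ (fderivWithin ℝ f s) s z v u := by
  refine (h.contDiffWithinAt hf hz).isSymmSndFDerivWithinAt (by simp) h.uniqueDiffOn ?_
    (h.subset hz) u v
  rw [h.convex.closure_interior_eq_closure_of_nonempty_interior h.nonempty_interior]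
  exact subset_closure (h.subset hz)

theorem fderivWithin_congr (h : IsChartDomain s U) {f₁ f₂ : E → F} (hf : EqOn f₁ f₂ U) {z : E}
    (hz : z ∈ U) : fderivWithin ℝ f₁ s z = fderivWithin ℝ f₂ s z :=
  Filter.EventuallyEq.fderivWithin_eq (eventually_of_mem (h.mem_nhdsWithin z hz) hf) (hf hz)

/-- The derivative of a composition of a map between chart domains with a function. -/
theorem fderivWithin_comp (h : IsChartDomain s U) (h' : IsChartDomain s' U') {f : E' → E}
    (hf : ContDiffOn ℝ 1 f U') (hfU : MapsTo f U' U) {φ : E → F} (hφ : ContDiffOn ℝ 1 φ U)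
    {z : E'} (hz : z ∈ U') (u : E') :
    fderivWithin ℝ (fun y => φ (f y)) s' z u
      = fderivWithin ℝ φ s (f z) (fderivWithin ℝ f s' z u) := by
  have h1 := (h.differentiableWithinAt hφ one_ne_zero (hfU hz)).hasFDerivWithinAt
  have h2 := ((h'.differentiableWithinAt hf one_ne_zero hz).hasFDerivWithinAt).mono h'.subset
  have h3 := (h1.mono h.subset).comp z h2 hfU
  have h4 := h3.mono_of_mem_nhdsWithin (h'.mem_nhdsWithin z hz)
  have h5 : fderivWithin ℝ (fun y => φ (f y)) s' z = _ :=
    h4.fderivWithin (h'.uniqueDiffWithinAt hz)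
  rw [h5]; rfl

end IsChartDomain

/-- The covariant derivative of a section of a trivial bundle for the connection form `A`. -/
def cderiv (s : Set E) (A : E → E →L[ℝ] T →L[ℝ] T) (u : E) (V : E → T) (z : E) : T :=
  fderivWithin ℝ V s z u + A z u (V z)

theorem IsChartDomain.hasFDerivWithinAt (h : IsChartDomain s U) {f : E → F} {m : ℕ∞ω}
    (hf : ContDiffOn ℝ m f U) (hm : m ≠ 0) {z : E} (hz : z ∈ U) :
    HasFDerivWithinAt f (fderivWithin ℝ f s z) s z :=
  (h.differentiableWithinAt hf hm hz).hasFDerivWithinAt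

theorem IsChartDomain.fderivWithin_eq (h : IsChartDomain s U) {f : E → F} {f' : E →L[ℝ] F}
    {z : E} (hz : z ∈ U) (hf : HasFDerivWithinAt f f' s z) : fderivWithin ℝ f s z = f' :=
  hf.fderivWithin (h.uniqueDiffWithinAt hz)

/-- The derivative of a linear operator with constant argument. -/
theorem IsChartDomain.fderivWithin_apply_const (h : IsChartDomain s U) {f : E → E' →L[ℝ] F}
    {m : ℕ∞ω} (hf : ContDiffOn ℝ m f U) (hm : m ≠ 0) {z : E} (hz : z ∈ U) (v : E') (u : E) :
    fderivWithin ℝ (fun y => f y v) s z u = fderivWithin ℝ f s z u v := by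
  have h1 := (h.hasFDerivWithinAt hf hm hz).clm_apply (hasFDerivWithinAt_const v z s)
  rw [h.fderivWithin_eq hz h1]
  simp

theorem IsChartDomain.fderivWithin_apply (h : IsChartDomain s U) {f : E → E' →L[ℝ] F}
    {V : E → E'} {m k : ℕ∞ω} (hf : ContDiffOn ℝ m f U) (hm : m ≠ 0) (hV : ContDiffOn ℝ k V U)
    (hk : k ≠ 0) {z : E} (hz : z ∈ U) (u : E) :
    fderivWithin ℝ (fun y => f y (V y)) s z u =
      fderivWithin ℝ f s z u (V z) + f z (fderivWithin ℝ V s z u) := by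
  have h1 := (h.hasFDerivWithinAt hf hm hz).clm_apply (h.hasFDerivWithinAt hV hk hz)
  rw [h.fderivWithin_eq hz h1]
  simp [add_comm]

/-- The curvature of the connection form `A`, with values in a Banach algebra of operators. -/
def curv (s : Set E) (A : E → E →L[ℝ] 𝔄) (z : E) (u v : E) : 𝔄 :=
  fderivWithin ℝ A s z u v - fderivWithin ℝ A s z v u + (A z u * A z v - A z v * A z u)

section Algebra

variable {A : E → E →L[ℝ] 𝔄}

theorem curv_swap (z u v : E) : curv s A z u v = -curv s A z v u := by
  simp only [curv]; abel

theorem curv_add_left (z u u' v : E) :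
    curv s A z (u + u') v = curv s A z u v + curv s A z u' v := by
  unfold curv
  rw [map_add, map_add, map_add, _root_.add_apply]
  noncomm_ring

theorem curv_smul_left (z : E) (c : ℝ) (u v : E) : curv s A z (c • u) v = c • curv s A z u v := by
  unfold curv
  rw [map_smul, map_smul, map_smul, _root_.smul_apply, smul_mul_assoc, mul_smul_comm,
    ← smul_sub, ← smul_sub, ← smul_add]

theorem curv_add_right (z u v v' : E) :
    curv s A z u (v + v') = curv s A z u v + curv s A z u v' := by
  rw [curv_swap, curv_add_left, curv_swap z v, curv_swap z v']; abel

theorem curv_smul_right (z : E) (c : ℝ) (u v : E) : curv s A z u (c • v) = c • curv s A z u v := by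
  rw [curv_swap, curv_smul_left, curv_swap z v, smul_neg, neg_neg]

theorem curv_sum_left {κ : Type*} (t : Finset κ) (z : E) (u : κ → E) (v : E) :
    curv s A z (∑ i ∈ t, u i) v = ∑ i ∈ t, curv s A z (u i) v :=
  map_sum (AddMonoidHom.mk' (fun u => curv s A z u v) fun _ _ => curv_add_left ..) _ _

theorem curv_sum_right {κ : Type*} (t : Finset κ) (z : E) (u : E) (v : κ → E) :
    curv s A z u (∑ i ∈ t, v i) = ∑ i ∈ t, curv s A z u (v i) :=
  map_sum (AddMonoidHom.mk' (fun v => curv s A z u v) fun _ _ => curv_add_right ..) _ _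

theorem contDiffOn_curv (h : IsChartDomain s U) (hA : ContDiffOn ℝ ∞ A U) (u v : E) :
    ContDiffOn ℝ ∞ (fun z => curv s A z u v) U := by
  have h1 : ContDiffOn ℝ ∞ (fderivWithin ℝ A s) U := h.contDiffOn_fderivWithin hA (by simp)
  have hm : ∀ u v : E, ContDiffOn ℝ ∞ (fun z => A z u * A z v) U := fun u v =>
    (hA.clm_apply contDiffOn_const).mul (hA.clm_apply contDiffOn_const)
  exact (((h1.clm_apply contDiffOn_const).clm_apply contDiffOn_const).sub
    ((h1.clm_apply contDiffOn_const).clm_apply contDiffOn_const)).add ((hm u v).sub (hm v u))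

/-- The covariant derivative of the curvature in coordinates, without the Christoffel terms for
the two form indices. -/
def curvDeriv (s : Set E) (A : E → E →L[ℝ] 𝔄) (z : E) (e u v : E) : 𝔄 :=
  fderivWithin ℝ (fun y => curv s A y u v) s z e + (A z e * curv s A z u v - curv s A z u v * A z e)

/-- The second Bianchi identity. -/
theorem curvDeriv_cyclic (h : IsChartDomain s U) (hA : ContDiffOn ℝ ∞ A U) {z : E} (hz : z ∈ U)
    (e u v : E) :
    curvDeriv s A z e u v + curvDeriv s A z u v e + curvDeriv s A z v e u = 0 := by
  have hA1 : ContDiffOn ℝ ∞ (fderivWithin ℝ A s) U := h.contDiffOn_fderivWithin hA (by simp)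
  have key : ∀ e u v : E, fderivWithin ℝ (fun y => curv s A y u v) s z e =
      fderivWithin ℝ (fderivWithin ℝ A s) s z e u v - fderivWithin ℝ (fderivWithin ℝ A s) s z e v u
      + ((A z u * fderivWithin ℝ A s z e v + fderivWithin ℝ A s z e u * A z v)
        - (A z v * fderivWithin ℝ A s z e u + fderivWithin ℝ A s z e v * A z u)) := by
    intro e u v
    have hAd : ∀ u : E, HasFDerivWithinAt (fun y => A y u)
        (fderivWithin ℝ (fun y => A y u) s z) s z := fun u =>
      h.hasFDerivWithinAt (hA.clm_apply contDiffOn_const) (by simp) hz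
    have hA2 : ∀ u v : E, HasFDerivWithinAt (fun y => fderivWithin ℝ A s y u v)
        (fderivWithin ℝ (fun y => fderivWithin ℝ A s y u v) s z) s z := fun u v =>
      h.hasFDerivWithinAt ((hA1.clm_apply contDiffOn_const).clm_apply contDiffOn_const)
        (by simp) hz
    have h3 := ((hA2 u v).sub (hA2 v u)).add
      (((hAd u).mul' (hAd v)).sub ((hAd v).mul' (hAd u)))
    have h4 : fderivWithin ℝ (fun y => curv s A y u v) s z = _ := h.fderivWithin_eq hz h3
    have h5 : ∀ u v : E, fderivWithin ℝ (fun y => fderivWithin ℝ A s y u v) s z e =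
        fderivWithin ℝ (fderivWithin ℝ A s) s z e u v := fun u v => by
      rw [h.fderivWithin_apply_const (hA1.clm_apply contDiffOn_const) (by simp) hz,
        h.fderivWithin_apply_const hA1 (by simp) hz]
    have h6 : ∀ u : E, fderivWithin ℝ (fun y => A y u) s z e = fderivWithin ℝ A s z e u :=
      fun u => h.fderivWithin_apply_const hA (by simp) hz u e
    rw [h4]
    simp only [_root_.add_apply, _root_.sub_apply, _root_.smul_apply, smul_eq_mul,
      MulOpposite.smul_eq_mul_unop, MulOpposite.unop_op, h5, h6]
  have hs := fun u v : E => h.fderivWithin_comm (hA.of_le (two_le_infty)) hz u v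
  unfold curvDeriv
  rw [key e u v, key u v e, key v e u, hs u e, hs v e, hs v u]
  unfold curv
  noncomm_ring

end Algebra

variable {A : E → E →L[ℝ] T →L[ℝ] T}

/-- The derivative commutes with a fixed continuous linear map. -/
theorem IsChartDomain.fderivWithin_clm (h : IsChartDomain s U) (L : F →L[ℝ] T) {f : E → F}
    {m : ℕ∞ω} (hf : ContDiffOn ℝ m f U) (hm : m ≠ 0) {z : E} (hz : z ∈ U) (u : E) :
    L (fderivWithin ℝ f s z u) = fderivWithin ℝ (fun y => L (f y)) s z u := by
  have h1 : fderivWithin ℝ (fun y => L (f y)) s z = _ :=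
    h.fderivWithin_eq hz (L.hasFDerivAt.comp_hasFDerivWithinAt z (h.hasFDerivWithinAt hf hm hz))
  rw [h1]
  rfl

theorem contDiffOn_cderiv (h : IsChartDomain s U) (hA : ContDiffOn ℝ ∞ A U) {V : E → T}
    {m k : ℕ∞ω} (hV : ContDiffOn ℝ m V U) (hk : k + 1 ≤ m) (hk' : k ≤ ∞) (u : E) :
    ContDiffOn ℝ k (cderiv s A u V) U :=
  ((h.contDiffOn_fderivWithin hV hk).clm_apply contDiffOn_const).add
    (((hA.of_le hk').clm_apply contDiffOn_const).clm_apply (hV.of_le (le_self_add.trans hk)))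

/-- The Ricci identity. -/
theorem cderiv_cderiv_sub (h : IsChartDomain s U) (hA : ContDiffOn ℝ ∞ A U) {V : E → T}
    (hV : ContDiffOn ℝ 2 V U) {z : E} (hz : z ∈ U) (u v : E) :
    cderiv s A u (cderiv s A v V) z - cderiv s A v (cderiv s A u V) z = curv s A z u v (V z) := by
  have hDV : ContDiffOn ℝ 1 (fderivWithin ℝ V s) U :=
    h.contDiffOn_fderivWithin hV (by norm_num)
  have key : ∀ u v : E, cderiv s A u (cderiv s A v V) z =
      fderivWithin ℝ (fderivWithin ℝ V s) s z u v + fderivWithin ℝ A s z u v (V z)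
        + A z v (fderivWithin ℝ V s z u) + A z u (fderivWithin ℝ V s z v) + A z u (A z v (V z)) := by
    intro u v
    have hAv : ContDiffOn ℝ ∞ (fun y => A y v) U := hA.clm_apply contDiffOn_const
    have h1 : fderivWithin ℝ (cderiv s A v V) s z u = fderivWithin ℝ (fderivWithin ℝ V s) s z u v
        + (fderivWithin ℝ A s z u v (V z) + A z v (fderivWithin ℝ V s z u)) := by
      unfold cderiv
      rw [fderivWithin_fun_add (h.uniqueDiffWithinAt hz)
        (h.differentiableWithinAt (hDV.clm_apply contDiffOn_const) one_ne_zero hz)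
        (h.differentiableWithinAt ((hAv.of_le (m := 1) (by simp)).clm_apply
          (hV.of_le (by norm_num))) one_ne_zero hz), _root_.add_apply,
        h.fderivWithin_apply_const hDV one_ne_zero hz,
        h.fderivWithin_apply hAv (by simp) hV (by simp) hz,
        h.fderivWithin_apply_const hA (by simp) hz]
    conv_lhs => unfold cderiv
    have h2 : (fun z => fderivWithin ℝ V s z v + A z v (V z)) = cderiv s A v V := rfl
    rw [h2, h1, map_add]
    abel
  rw [key u v, key v u, h.fderivWithin_comm hV hz u v]
  simp only [curv, _root_.sub_apply, _root_.add_apply, clm_mul_apply]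
  abel

/-- The Leibniz rule for a field of bilinear forms. -/
theorem IsChartDomain.fderivWithin_bilin (h : IsChartDomain s U) {b : E → T →L[ℝ] T →L[ℝ] ℝ}
    (hb : ContDiffOn ℝ 1 b U) {V W : E → T} (hV : ContDiffOn ℝ 1 V U) (hW : ContDiffOn ℝ 1 W U)
    {z : E} (hz : z ∈ U) (u : E) :
    fderivWithin ℝ (fun y => b y (V y) (W y)) s z u =
      fderivWithin ℝ (fun y => b y (V z) (W z)) s z u + b z (fderivWithin ℝ V s z u) (W z)
        + b z (V z) (fderivWithin ℝ W s z u) := by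
  rw [h.fderivWithin_apply (hb.clm_apply hV) one_ne_zero hW one_ne_zero hz,
    h.fderivWithin_apply hb one_ne_zero hV one_ne_zero hz,
    h.fderivWithin_apply_const (hb.clm_apply contDiffOn_const) one_ne_zero hz,
    h.fderivWithin_apply_const hb one_ne_zero hz, _root_.add_apply]

/-- The connection `A` preserves the field `b` of bilinear forms. -/
def IsMetricConnection (s U : Set E) (A : E → E →L[ℝ] T →L[ℝ] T) (b : E → T →L[ℝ] T →L[ℝ] ℝ) :
    Prop :=
  ∀ z ∈ U, ∀ u t t', fderivWithin ℝ (fun y => b y t t') s z u = b z (A z u t) t' + b z t (A z u t')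

theorem IsMetricConnection.fderivWithin_eq (h : IsChartDomain s U) {b : E → T →L[ℝ] T →L[ℝ] ℝ}
    (hc : IsMetricConnection s U A b) (hb : ContDiffOn ℝ 1 b U) {V W : E → T}
    (hV : ContDiffOn ℝ 1 V U) (hW : ContDiffOn ℝ 1 W U) {z : E} (hz : z ∈ U) (u : E) :
    fderivWithin ℝ (fun y => b y (V y) (W y)) s z u =
      b z (cderiv s A u V z) (W z) + b z (V z) (cderiv s A u W z) := by
  rw [h.fderivWithin_bilin hb hV hW hz, hc z hz, cderiv, cderiv, map_add, map_add,
    _root_.add_apply]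
  ring

/-- The curvature of a metric connection is skew. -/
theorem metric_curv (h : IsChartDomain s U) (hA : ContDiffOn ℝ ∞ A U)
    {b : E → T →L[ℝ] T →L[ℝ] ℝ} (hb : ContDiffOn ℝ ∞ b U) (hc : IsMetricConnection s U A b)
    {z : E} (hz : z ∈ U) (u v : E) (t t' : T) :
    b z (curv s A z u v t) t' + b z t (curv s A z u v t') = 0 := by
  have hφ : ContDiffOn ℝ ∞ (fun y => b y t t') U :=
    (hb.clm_apply contDiffOn_const).clm_apply contDiffOn_const
  have hφ1 : ContDiffOn ℝ ∞ (fderivWithin ℝ (fun y => b y t t') s) U :=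
    h.contDiffOn_fderivWithin hφ (by simp)
  have hb1 : ContDiffOn ℝ 1 b U := hb.of_le (by simp)
  have hA1 : ∀ (v : E) (t : T), ContDiffOn ℝ 1 (fun y => A y v t) U := fun v t =>
    ((hA.clm_apply contDiffOn_const).clm_apply contDiffOn_const).of_le (by simp)
  have hAd : ∀ (u v : E) (t : T),
      fderivWithin ℝ (fun y => A y v t) s z u = fderivWithin ℝ A s z u v t := by
    intro u v t
    rw [h.fderivWithin_apply_const (hA.clm_apply contDiffOn_const) (by simp) hz,
      h.fderivWithin_apply_const hA (by simp) hz]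
  have hcd : ∀ (u v : E) (t : T), cderiv s A u (fun y => A y v t) z =
      fderivWithin ℝ A s z u v t + A z u (A z v t) := fun u v t => by rw [cderiv, hAd]
  have hct : ∀ (u : E) (t : T), cderiv s A u (fun _ => t) z = A z u t := fun u t => by
    simp [cderiv]
  have key : ∀ u v : E, fderivWithin ℝ (fderivWithin ℝ (fun y => b y t t') s) s z u v =
      b z (fderivWithin ℝ A s z u v t + A z u (A z v t)) t' + b z (A z v t) (A z u t')
      + (b z (A z u t) (A z v t') + b z t (fderivWithin ℝ A s z u v t' + A z u (A z v t'))) := by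
    intro u v
    rw [← h.fderivWithin_apply_const hφ1 (by simp) hz,
      h.fderivWithin_congr (fun y hy => hc y hy v t t') hz,
      fderivWithin_fun_add (h.uniqueDiffWithinAt hz)
        (h.differentiableWithinAt ((hb1.clm_apply (hA1 v t)).clm_apply contDiffOn_const)
          one_ne_zero hz)
        (h.differentiableWithinAt ((hb1.clm_apply contDiffOn_const).clm_apply (hA1 v t'))
          one_ne_zero hz), _root_.add_apply,
      hc.fderivWithin_eq h hb1 (hA1 v t) contDiffOn_const hz,
      hc.fderivWithin_eq h hb1 contDiffOn_const (hA1 v t') hz, hcd, hcd, hct, hct]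
  have h2 := key u v
  rw [h.fderivWithin_comm (hφ.of_le two_le_infty) hz u v, key v u] at h2
  simp only [curv, _root_.sub_apply, _root_.add_apply, clm_mul_apply, map_sub, map_add] at h2 ⊢
  linarith

/-- The curvature annihilates parallel sections. -/
theorem curv_apply_eq_zero (h : IsChartDomain s U) (hA : ContDiffOn ℝ ∞ A U) {V : E → T}
    (hV : ContDiffOn ℝ 2 V U) (hp : ∀ z ∈ U, ∀ u, cderiv s A u V z = 0) {z : E} (hz : z ∈ U)
    (u v : E) : curv s A z u v (V z) = 0 := by
  have h1 : ∀ u v : E, cderiv s A u (cderiv s A v V) z = 0 := fun u v => by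
    have h2 := h.fderivWithin_congr (fun y hy => hp y hy v) hz
    rw [cderiv, h2, hp z hz v]
    simp
  rw [← cderiv_cderiv_sub h hA hV hz, h1, h1, sub_zero]

/-- The covariant derivative of the curvature annihilates parallel sections. -/
theorem curvDeriv_apply_eq_zero (h : IsChartDomain s U) (hA : ContDiffOn ℝ ∞ A U) {V : E → T}
    (hV : ContDiffOn ℝ 2 V U) (hp : ∀ z ∈ U, ∀ u, cderiv s A u V z = 0) {z : E} (hz : z ∈ U)
    (e u v : E) : curvDeriv s A z e u v (V z) = 0 := by
  have h1 := h.fderivWithin_apply (contDiffOn_curv h hA u v) (by simp) hV (by simp) hz e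
  have h2 := h.fderivWithin_congr (fun y hy => curv_apply_eq_zero h hA hV hp hy u v) hz
  rw [h2] at h1
  have h3 : fderivWithin ℝ V s z e = -A z e (V z) := eq_neg_of_add_eq_zero_left (hp z hz e)
  rw [h3] at h1
  simp only [curvDeriv, _root_.add_apply, _root_.sub_apply, clm_mul_apply,
    curv_apply_eq_zero h hA hV hp hz, map_zero, zero_sub]
  simpa [eq_comm] using h1

/-- The covariant derivative of the curvature of a metric connection is skew. -/
theorem metric_curvDeriv (h : IsChartDomain s U) (hA : ContDiffOn ℝ ∞ A U)
    {b : E → T →L[ℝ] T →L[ℝ] ℝ} (hb : ContDiffOn ℝ ∞ b U) (hc : IsMetricConnection s U A b)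
    {z : E} (hz : z ∈ U) (e u v : E) (t t' : T) :
    b z (curvDeriv s A z e u v t) t' + b z t (curvDeriv s A z e u v t') = 0 := by
  have hF := contDiffOn_curv h hA u v
  have hFt : ∀ t : T, ContDiffOn ℝ 1 (fun y => curv s A y u v t) U := fun t =>
    (hF.clm_apply contDiffOn_const).of_le (by simp)
  have hb1 : ContDiffOn ℝ 1 b U := hb.of_le (by simp)
  have h1 := h.fderivWithin_congr (fun y hy => metric_curv h hA hb hc hy u v t t') hz
  have h2 : fderivWithin ℝ (fun y => b y (curv s A y u v t) t' + b y t (curv s A y u v t')) s z e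
      = 0 := by rw [h1]; simp
  have hcd : ∀ t : T, cderiv s A e (fun y => curv s A y u v t) z =
      fderivWithin ℝ (fun y => curv s A y u v) s z e t + A z e (curv s A z u v t) := fun t => by
    rw [cderiv, h.fderivWithin_apply_const hF (by simp) hz]
  have hct : ∀ t : T, cderiv s A e (fun _ => t) z = A z e t := fun t => by simp [cderiv]
  rw [fderivWithin_fun_add (h.uniqueDiffWithinAt hz)
        (h.differentiableWithinAt ((hb1.clm_apply (hFt t)).clm_apply contDiffOn_const)
          one_ne_zero hz)
        (h.differentiableWithinAt ((hb1.clm_apply contDiffOn_const).clm_apply (hFt t'))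
          one_ne_zero hz), _root_.add_apply,
      hc.fderivWithin_eq h hb1 (hFt t) contDiffOn_const hz,
      hc.fderivWithin_eq h hb1 contDiffOn_const (hFt t') hz, hcd, hcd, hct, hct] at h2
  have h3 := metric_curv h hA hb hc hz u v (A z e t) t'
  have h4 := metric_curv h hA hb hc hz u v t (A z e t')
  simp only [curvDeriv, _root_.sub_apply, _root_.add_apply, clm_mul_apply, map_sub, map_add] at h2 ⊢
  linarith

/-- The pullback of a connection form. -/
def pullbackForm (s' : Set E') (f : E' → E) (A : E → E →L[ℝ] T →L[ℝ] T) (z : E') :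
    E' →L[ℝ] T →L[ℝ] T :=
  (A (f z)).comp (fderivWithin ℝ f s' z)

theorem contDiffOn_pullbackForm (h' : IsChartDomain s' U') {f : E' → E}
    (hf : ContDiffOn ℝ ∞ f U') (hfU : MapsTo f U' U) (hA : ContDiffOn ℝ ∞ A U) :
    ContDiffOn ℝ ∞ (pullbackForm s' f A) U' :=
  (hA.comp hf hfU).clm_comp (h'.contDiffOn_fderivWithin hf (by simp))

theorem cderiv_pullbackForm (h : IsChartDomain s U) (h' : IsChartDomain s' U') {f : E' → E}
    (hf : ContDiffOn ℝ ∞ f U') (hfU : MapsTo f U' U) {V : E → T} (hV : ContDiffOn ℝ 1 V U)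
    {z : E'} (hz : z ∈ U') (u : E') :
    cderiv s' (pullbackForm s' f A) u (fun y => V (f y)) z =
      cderiv s A (fderivWithin ℝ f s' z u) V (f z) := by
  unfold cderiv
  rw [h.fderivWithin_comp h' (hf.of_le (by simp)) hfU hV hz]
  rfl

theorem curv_pullbackForm (h : IsChartDomain s U) (h' : IsChartDomain s' U') {f : E' → E}
    (hf : ContDiffOn ℝ ∞ f U') (hfU : MapsTo f U' U) (hA : ContDiffOn ℝ ∞ A U)
    {z : E'} (hz : z ∈ U') (u v : E') :
    curv s' (pullbackForm s' f A) z u v =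
      curv s A (f z) (fderivWithin ℝ f s' z u) (fderivWithin ℝ f s' z v) := by
  have hf1 : ContDiffOn ℝ ∞ (fderivWithin ℝ f s') U' := h'.contDiffOn_fderivWithin hf (by simp)
  have key : ∀ u v, fderivWithin ℝ (pullbackForm s' f A) s' z u v =
      fderivWithin ℝ A s (f z) (fderivWithin ℝ f s' z u) (fderivWithin ℝ f s' z v)
      + A (f z) (fderivWithin ℝ (fderivWithin ℝ f s') s' z u v) := by
    intro u v
    have hAf : ContDiffOn ℝ ∞ (fun y => A (f y)) U' := hA.comp hf hfU
    rw [← h'.fderivWithin_apply_const (contDiffOn_pullbackForm h' hf hfU hA) (by simp) hz]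
    have h1 : (fun y => pullbackForm s' f A y v) = fun y => A (f y) (fderivWithin ℝ f s' y v) := rfl
    rw [h1, h'.fderivWithin_apply hAf (by simp) (hf1.clm_apply contDiffOn_const) (by simp) hz,
      h'.fderivWithin_apply_const hf1 (by simp) hz,
      h.fderivWithin_comp h' (hf.of_le (by simp)) hfU (hA.of_le (by simp)) hz]
  unfold curv
  rw [key u v, key v u, h'.fderivWithin_comm (hf.of_le (two_le_infty)) hz u v]
  have h2 : ∀ w, pullbackForm s' f A z w = A (f z) (fderivWithin ℝ f s' z w) := fun _ => rfl
  rw [h2, h2]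
  abel

end Generic

section Components

variable {d : ℕ} {F : Type*} [NormedAddCommGroup F] [NormedSpace ℝ F]
  {F' : Type*} [NormedAddCommGroup F'] [NormedSpace ℝ F']

/-- The coordinate vector `e_a` of `ℝᵈ`. -/
abbrev basisVec (a : Fin d) : Euc d := EuclideanSpace.single a 1

theorem sum_smul_basisVec (x : Euc d) : ∑ a, x a • basisVec a = x := by
  ext i
  simp [basisVec, Pi.single_apply]

theorem clm_eq_sum (L : Euc d →L[ℝ] F) (x : Euc d) : L x = ∑ a, x a • L (basisVec a) := by
  conv_lhs => rw [← sum_smul_basisVec x]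
  simp only [map_sum, map_smul]

/-- The bilinear map with given values on coordinate vectors. -/
def bil (c : Fin d → Fin d → F) : Euc d →L[ℝ] Euc d →L[ℝ] F :=
  ∑ a, ∑ b, (EuclideanSpace.proj a : Euc d →L[ℝ] ℝ).smulRight
    ((EuclideanSpace.proj b : Euc d →L[ℝ] ℝ).smulRight (c a b))

theorem bil_apply (c : Fin d → Fin d → F) (x y : Euc d) :
    bil c x y = ∑ a, ∑ b, x a • y b • c a b := by
  simp [bil]

theorem bil_basisVec (c : Fin d → Fin d → F) (a b : Fin d) :
    bil c (basisVec a) (basisVec b) = c a b := by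
  simp [bil_apply, basisVec]

theorem bil_clm (L : F →L[ℝ] F') (c : Fin d → Fin d → F) (x y : Euc d) :
    bil (fun a b => L (c a b)) x y = L (bil c x y) := by
  simp [bil_apply]

theorem bil_comm {c : Fin d → Fin d → F} (hc : ∀ a b, c a b = c b a) (x y : Euc d) :
    bil c x y = bil c y x := by
  rw [bil_apply, bil_apply, Finset.sum_comm]
  refine Finset.sum_congr rfl fun a _ => Finset.sum_congr rfl fun b _ => ?_
  rw [hc b a, smul_comm]

theorem contDiffOn_bil {E : Type*} [NormedAddCommGroup E] [NormedSpace ℝ E] {U : Set E}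
    {m : ℕ∞ω} {c : E → Fin d → Fin d → F} (hc : ∀ a b, ContDiffOn ℝ m (fun z => c z a b) U) :
    ContDiffOn ℝ m (fun z => bil (c z)) U := by
  rw [contDiffOn_clm_apply]
  intro x
  rw [contDiffOn_clm_apply]
  intro y
  simp only [bil_apply]
  exact ContDiffOn.sum fun a _ => ContDiffOn.sum fun b _ =>
    contDiffOn_const.smul (contDiffOn_const.smul (hc a b))

/-- The pairing of a covector, given by its components, with a vector. -/
def pair : (Fin d → ℝ) →L[ℝ] Euc d →L[ℝ] ℝ :=
  ∑ a, (ContinuousLinearMap.proj a : (Fin d → ℝ) →L[ℝ] ℝ).smulRight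
    (EuclideanSpace.proj a : Euc d →L[ℝ] ℝ)

theorem pair_apply (m : Fin d → ℝ) (y : Euc d) : pair m y = ∑ a, m a * y a := by
  simp [pair]

theorem pair_basisVec (m : Fin d → ℝ) (a : Fin d) : pair m (basisVec a) = m a := by
  simp [pair_apply, basisVec]

theorem pair_clm (L : Euc d →L[ℝ] ℝ) (y : Euc d) : pair (fun b => L (basisVec b)) y = L y := by
  rw [pair_apply, clm_eq_sum L y]
  simp [mul_comm]

theorem pair_ext {m m' : Fin d → ℝ} (h : ∀ y, pair m y = pair m' y) : m = m' := by
  funext a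
  simpa only [pair_basisVec] using h (basisVec a)

/-- The coordinate covector `dx^a`. -/
abbrev basisCovec (a : Fin d) : Fin d → ℝ := Pi.single a 1

theorem pair_basisCovec (a : Fin d) (y : Euc d) : pair (basisCovec a) y = y a := by
  simp [pair_apply, Pi.single_apply]

theorem sum_smul_basisCovec (m : Fin d → ℝ) : ∑ a, m a • basisCovec a = m := by
  funext i
  simp [Pi.single_apply]

/-! ### Metrics at a point -/

/-- The bilinear form of a matrix. -/
abbrev metricBil (M : Matrix (Fin d) (Fin d) ℝ) : Euc d →L[ℝ] Euc d →L[ℝ] ℝ :=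
  bil fun a b => M a b

/-- A symmetric positive definite matrix. -/
structure IsMetricMatrix (M : Matrix (Fin d) (Fin d) ℝ) : Prop where
  symm : ∀ a b, M a b = M b a
  pos : ∀ x : Euc d, x ≠ 0 → 0 < metricBil M x x

/-- The vector dual to a covector. -/
def sharp (M : Matrix (Fin d) (Fin d) ℝ) : (Fin d → ℝ) →L[ℝ] Euc d :=
  LinearMap.toContinuousLinearMap
    ((WithLp.linearEquiv 2 ℝ (Fin d → ℝ)).symm.toLinearMap ∘ₗ Matrix.mulVecLin M⁻¹)

theorem sharp_apply (M : Matrix (Fin d) (Fin d) ℝ) (m : Fin d → ℝ) (a : Fin d) :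
    sharp M m a = ∑ b, M⁻¹ a b * m b := rfl

/-- The covector dual to a vector. -/
def flat (M : Matrix (Fin d) (Fin d) ℝ) : Euc d →L[ℝ] (Fin d → ℝ) :=
  ContinuousLinearMap.pi fun b => (metricBil M).flip (basisVec b)

theorem pair_flat (M : Matrix (Fin d) (Fin d) ℝ) (x y : Euc d) : pair (flat M x) y = metricBil M x y :=
  pair_clm (metricBil M x) y

namespace IsMetricMatrix

variable {M : Matrix (Fin d) (Fin d) ℝ}

theorem bil_comm (hM : IsMetricMatrix M) (x y : Euc d) : metricBil M x y = metricBil M y x :=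
  ConformalTractor.bil_comm hM.symm x y

theorem posDef (hM : IsMetricMatrix M) : M.PosDef := by
  refine Matrix.PosDef.of_dotProduct_mulVec_pos (Matrix.IsHermitian.ext fun i j => ?_) fun x hx => ?_
  · simpa using hM.symm j i
  · have h := hM.pos (WithLp.toLp 2 x) (by simpa using hx)
    rw [bil_apply] at h
    simpa [dotProduct, Matrix.mulVec, Finset.mul_sum, mul_comm, mul_left_comm] using h

theorem isUnit_det (hM : IsMetricMatrix M) : IsUnit M.det :=
  (Matrix.isUnit_iff_isUnit_det M).1 hM.posDef.isUnit

theorem bil_sharp (hM : IsMetricMatrix M) (m : Fin d → ℝ) (y : Euc d) :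
    metricBil M (sharp M m) y = pair m y := by
  have h1 : ∀ b, ∑ a, M b a * sharp M m a = m b := by
    intro b
    have h2 : M.mulVec (M⁻¹.mulVec m) = m := by
      rw [Matrix.mulVec_mulVec, Matrix.mul_nonsing_inv _ hM.isUnit_det, Matrix.one_mulVec]
    exact congrFun h2 b
  rw [bil_apply, pair_apply, Finset.sum_comm]
  refine Finset.sum_congr rfl fun b _ => ?_
  rw [← h1 b, Finset.sum_mul]
  refine Finset.sum_congr rfl fun a _ => ?_
  rw [hM.symm a b]
  simp only [smul_eq_mul]
  ring

theorem bil_sharp' (hM : IsMetricMatrix M) (m : Fin d → ℝ) (y : Euc d) :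
    metricBil M y (sharp M m) = pair m y := by
  rw [hM.bil_comm, hM.bil_sharp]

theorem eq_zero_of_bil (hM : IsMetricMatrix M) {x : Euc d} (h : ∀ y, metricBil M x y = 0) : x = 0 := by
  by_contra hx
  exact (hM.pos x hx).ne' (h x)

theorem ext_bil (hM : IsMetricMatrix M) {x x' : Euc d} (h : ∀ y, metricBil M x y = metricBil M x' y) :
    x = x' := by
  refine sub_eq_zero.1 (hM.eq_zero_of_bil fun y => ?_)
  rw [map_sub, _root_.sub_apply, h, sub_self]

theorem sharp_flat (hM : IsMetricMatrix M) (x : Euc d) : sharp M (flat M x) = x :=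
  hM.ext_bil fun y => by rw [hM.bil_sharp, pair_flat]

theorem flat_sharp (hM : IsMetricMatrix M) (m : Fin d → ℝ) : flat M (sharp M m) = m :=
  pair_ext fun y => by rw [pair_flat, hM.bil_sharp]

theorem pair_sharp_comm (hM : IsMetricMatrix M) (m m' : Fin d → ℝ) :
    pair m (sharp M m') = pair m' (sharp M m) := by
  rw [← hM.bil_sharp, ← hM.bil_sharp, hM.bil_comm]

/-- Expansion of a functional through a basis and its dual basis. -/
theorem sum_bil_dual (hM : IsMetricMatrix M) (x : Euc d) (L : Euc d →L[ℝ] F) :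
    ∑ a, metricBil M x (basisVec a) • L (sharp M (basisCovec a)) = L x := by
  have h1 : ∑ a, metricBil M x (basisVec a) • sharp M (basisCovec a) = x := by
    have h2 : ∑ a, metricBil M x (basisVec a) • basisCovec a = flat M x := sum_smul_basisCovec (flat M x)
    rw [← hM.sharp_flat x]
    conv_rhs => rw [← h2]
    rw [map_sum, hM.sharp_flat]
    simp
  conv_rhs => rw [← h1]
  simp

theorem sum_dual_bil (hM : IsMetricMatrix M) (x : Euc d) (L : Euc d →L[ℝ] F) :
    ∑ a, metricBil M x (sharp M (basisCovec a)) • L (basisVec a) = L x := by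
  rw [clm_eq_sum L x]
  simp only [hM.bil_sharp', pair_basisCovec]

/-- A metric trace may be computed with the two factors exchanged. -/
theorem sum_swap (hM : IsMetricMatrix M) (B : Euc d →L[ℝ] Euc d →L[ℝ] F) :
    ∑ a, B (basisVec a) (sharp M (basisCovec a)) = ∑ a, B (sharp M (basisCovec a)) (basisVec a) := by
  have h1 : ∀ a, B (basisVec a) (sharp M (basisCovec a)) = ∑ b, metricBil M (basisVec a) (basisVec b) •
      B (sharp M (basisCovec b)) (sharp M (basisCovec a)) := fun a => by
    rw [← hM.sum_bil_dual (basisVec a) B]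
    simp
  have h2 : ∀ a, B (sharp M (basisCovec a)) (basisVec a) = ∑ b, metricBil M (basisVec a) (basisVec b) •
      B (sharp M (basisCovec a)) (sharp M (basisCovec b)) := fun a => by
    rw [hM.sum_bil_dual (basisVec a) (B (sharp M (basisCovec a)))]
  simp_rw [h1, h2]
  rw [Finset.sum_comm]
  refine Finset.sum_congr rfl fun a _ => Finset.sum_congr rfl fun b _ => ?_
  rw [hM.bil_comm]

end IsMetricMatrix

/-! ### The tractor metric -/

/-- The tractor metric as a bilinear map. -/
def tractorBil (M : Matrix (Fin d) (Fin d) ℝ) :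
    TractorCoords d →L[ℝ] TractorCoords d →L[ℝ] ℝ :=
  LinearMap.toContinuousLinearMap (LinearMap.toContinuousLinearMap.toLinearMap ∘ₗ
    LinearMap.mk₂ ℝ (fun t t' : TractorCoords d =>
      pair t.2.1 (sharp M t'.2.1) + t.1 * t'.2.2 + t.2.2 * t'.1)
      (fun t₁ t₂ t' => by simp; ring) (fun c t t' => by simp; ring)
      (fun t t₁ t₂ => by simp; ring) (fun c t t' => by simp; ring))

theorem tractorBil_apply (M : Matrix (Fin d) (Fin d) ℝ) (t t' : TractorCoords d) :
    tractorBil M t t' = pair t.2.1 (sharp M t'.2.1) + t.1 * t'.2.2 + t.2.2 * t'.1 := rfl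

theorem tractorBil_eq (M : Matrix (Fin d) (Fin d) ℝ) (t t' : TractorCoords d) :
    tractorBil M t t' = chartTractorMetric M t t' := by
  rw [tractorBil_apply, chartTractorMetric, pair_apply]
  congr 2
  refine Finset.sum_congr rfl fun a _ => ?_
  rw [sharp_apply, Finset.mul_sum]
  exact Finset.sum_congr rfl fun b _ => by ring

theorem IsMetricMatrix.tractorBil_comm {M : Matrix (Fin d) (Fin d) ℝ} (hM : IsMetricMatrix M)
    (t t' : TractorCoords d) : tractorBil M t t' = tractorBil M t' t := by
  rw [tractorBil_apply, tractorBil_apply, hM.pair_sharp_comm]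
  ring

theorem IsMetricMatrix.tractorBil_nondegenerate {M : Matrix (Fin d) (Fin d) ℝ}
    (hM : IsMetricMatrix M) {t : TractorCoords d} (h : ∀ t', tractorBil M t t' = 0) : t = 0 := by
  have h1 := h (0, 0, 1)
  have h2 := h (1, 0, 0)
  have h3 : t.2.1 = 0 := pair_ext fun y => by
    have := h (0, flat M y, 0)
    simpa [tractorBil_apply, hM.sharp_flat] using this
  simp only [tractorBil_apply] at h1 h2
  ext1
  · simpa using h1
  · ext1
    · exact h3
    · simpa using h2

end Components

section LeviCivita

variable {d : ℕ} {s U : Set (Euc d)} {G Q : Euc d → Matrix (Fin d) (Fin d) ℝ}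

/-- `G` is a smooth Riemannian metric on the chart domain `U`. -/
structure IsSmoothMetric (s U : Set (Euc d)) (G : Euc d → Matrix (Fin d) (Fin d) ℝ) : Prop where
  dom : IsChartDomain s U
  smooth : ∀ a b, ContDiffOn ℝ ∞ (fun z => G z a b) U
  metric : ∀ z ∈ U, IsMetricMatrix (G z)

/-- The Christoffel symbols as a bilinear map. -/
def christoffelMap (s : Set (Euc d)) (G : Euc d → Matrix (Fin d) (Fin d) ℝ) (z : Euc d) :
    Euc d →L[ℝ] Euc d →L[ℝ] Euc d :=
  bil fun a b => WithLp.toLp 2 fun c => christoffel s G c a b z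

theorem contDiffOn_toLp {E : Type*} [NormedAddCommGroup E] [NormedSpace ℝ E] {U : Set E}
    {m : ℕ∞ω} {f : E → Fin d → ℝ} (hf : ∀ c, ContDiffOn ℝ m (fun z => f z c) U) :
    ContDiffOn ℝ m (fun z => (WithLp.toLp 2 (f z) : Euc d)) U :=
  contDiffOn_euclidean.2 hf

theorem contDiffOn_det {E : Type*} [NormedAddCommGroup E] [NormedSpace ℝ E] {U : Set E}
    {m : ℕ∞ω} {N : E → Matrix (Fin d) (Fin d) ℝ}
    (hN : ∀ a b, ContDiffOn ℝ m (fun z => N z a b) U) :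
    ContDiffOn ℝ m (fun z => (N z).det) U := by
  simp only [Matrix.det_apply']
  exact ContDiffOn.sum fun σ _ => contDiffOn_const.mul (contDiffOn_prod fun i _ => hN _ _)

theorem contDiffOn_inv_apply {E : Type*} [NormedAddCommGroup E] [NormedSpace ℝ E] {U : Set E}
    {m : ℕ∞ω} {N : E → Matrix (Fin d) (Fin d) ℝ}
    (hN : ∀ a b, ContDiffOn ℝ m (fun z => N z a b) U) (hdet : ∀ z ∈ U, IsUnit (N z).det)
    (a b : Fin d) : ContDiffOn ℝ m (fun z => (N z)⁻¹ a b) U := by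
  have h1 : ContDiffOn ℝ m (fun z => ((N z).det)⁻¹ * ((N z).adjugate a b)) U := by
    refine ((contDiffOn_det hN).inv fun z hz => (hdet z hz).ne_zero).mul ?_
    simp only [Matrix.adjugate_apply]
    refine contDiffOn_det fun i j => ?_
    simp only [Matrix.updateRow_apply]
    split_ifs
    · exact contDiffOn_const
    · exact hN i j
  refine h1.congr fun z hz => ?_
  rw [Matrix.inv_def]
  simp [Ring.inverse_eq_inv']

namespace IsSmoothMetric

theorem contDiffOn_inv (hG : IsSmoothMetric s U G) (a b : Fin d) :
    ContDiffOn ℝ ∞ (fun z => (G z)⁻¹ a b) U :=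
  contDiffOn_inv_apply hG.smooth (fun z hz => (hG.metric z hz).isUnit_det) a b

theorem contDiffOn_metricBil (hG : IsSmoothMetric s U G) :
    ContDiffOn ℝ ∞ (fun z => metricBil (G z)) U :=
  contDiffOn_bil hG.smooth

theorem contDiffOn_pd (hG : IsSmoothMetric s U G) {F : Type*} [NormedAddCommGroup F]
    [NormedSpace ℝ F] {f : Euc d → F} (hf : ContDiffOn ℝ ∞ f U) (i : Fin d) :
    ContDiffOn ℝ ∞ (pd s i f) U :=
  (hG.dom.contDiffOn_fderivWithin hf (by simp)).clm_apply contDiffOn_const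

theorem contDiffOn_christoffel (hG : IsSmoothMetric s U G) (c a b : Fin d) :
    ContDiffOn ℝ ∞ (christoffel s G c a b) U :=
  contDiffOn_const.mul (ContDiffOn.sum fun e _ => (hG.contDiffOn_inv c e).mul
    (((hG.contDiffOn_pd (hG.smooth b e) a).add (hG.contDiffOn_pd (hG.smooth a e) b)).sub
      (hG.contDiffOn_pd (hG.smooth a b) e)))

theorem contDiffOn_christoffelMap (hG : IsSmoothMetric s U G) :
    ContDiffOn ℝ ∞ (christoffelMap s G) U :=
  contDiffOn_bil fun a b => contDiffOn_toLp fun c => hG.contDiffOn_christoffel c a b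

theorem contDiffOn_riemann (hG : IsSmoothMetric s U G) (a b c e : Fin d) :
    ContDiffOn ℝ ∞ (riemann s G a b c e) U :=
  ((hG.contDiffOn_pd (hG.contDiffOn_christoffel c b e) a).sub
    (hG.contDiffOn_pd (hG.contDiffOn_christoffel c a e) b)).add
    (ContDiffOn.sum fun f _ =>
      ((hG.contDiffOn_christoffel c a f).mul (hG.contDiffOn_christoffel f b e)).sub
        ((hG.contDiffOn_christoffel c b f).mul (hG.contDiffOn_christoffel f a e)))

theorem contDiffOn_ricci (hG : IsSmoothMetric s U G) (a b : Fin d) :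
    ContDiffOn ℝ ∞ (ricci s G a b) U :=
  ContDiffOn.sum fun c _ => hG.contDiffOn_riemann c a c b

theorem contDiffOn_schouten (hG : IsSmoothMetric s U G) (a b : Fin d) :
    ContDiffOn ℝ ∞ (schouten s G a b) U := by
  have h1 : ContDiffOn ℝ ∞ (schoutenTrace s G) U :=
    (ContDiffOn.sum fun a _ => ContDiffOn.sum fun b _ =>
      (hG.contDiffOn_inv a b).mul (hG.contDiffOn_ricci a b)).div_const _
  exact ((hG.contDiffOn_ricci a b).sub (h1.mul (hG.smooth a b))).div_const _

theorem contDiffOn_sharp (hG : IsSmoothMetric s U G) (m : Fin d → ℝ) :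
    ContDiffOn ℝ ∞ (fun z => sharp (G z) m) U :=
  contDiffOn_euclidean.2 fun a => by
    simp only [sharp_apply]
    exact ContDiffOn.sum fun b _ => (hG.contDiffOn_inv a b).mul contDiffOn_const

theorem pd_comm_index (hG : IsSmoothMetric s U G) {z : Euc d} (hz : z ∈ U) (i a b : Fin d) :
    pd s i (fun y => G y a b) z = pd s i (fun y => G y b a) z := by
  have h1 := hG.dom.fderivWithin_congr (fun y hy => (hG.metric y hy).symm a b) hz
  rw [pd, pd, h1]

theorem christoffelMap_comm (hG : IsSmoothMetric s U G) {z : Euc d} (hz : z ∈ U) (x y : Euc d) :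
    christoffelMap s G z x y = christoffelMap s G z y x := by
  refine bil_comm (fun a b => ?_) x y
  congr 1
  funext c
  rw [christoffel, christoffel]
  congr 1
  refine Finset.sum_congr rfl fun e _ => ?_
  rw [hG.pd_comm_index hz e a b]
  ring

theorem fderivWithin_metricBil (hG : IsSmoothMetric s U G) {z : Euc d} (hz : z ∈ U)
    (u x y : Euc d) :
    fderivWithin ℝ (fun y' => metricBil (G y') x y) s z u =
      ∑ a, ∑ b, ∑ c, u a * (x b * (y c * pd s a (fun y' => G y' b c) z)) := by
  rw [clm_eq_sum]
  refine Finset.sum_congr rfl fun a _ => ?_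
  have h1 : ∀ b c, HasFDerivWithinAt (fun y' => x b • y c • G y' b c)
      (x b • y c • fderivWithin ℝ (fun y' => G y' b c) s z) s z := fun b c =>
    ((hG.dom.hasFDerivWithinAt (hG.smooth b c) (by simp) hz).const_smul (y c)).const_smul (x b)
  have h2 : HasFDerivWithinAt (fun y' => metricBil (G y') x y)
      (∑ b, ∑ c, x b • y c • fderivWithin ℝ (fun y' => G y' b c) s z) s z := by
    simp only [metricBil, bil_apply]
    exact HasFDerivWithinAt.fun_sum fun b _ => HasFDerivWithinAt.fun_sum fun c _ => h1 b c
  rw [hG.dom.fderivWithin_eq hz h2, smul_eq_mul]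
  simp [Finset.mul_sum, pd]

/-- The Koszul formula in coordinates. -/
theorem metricBil_christoffelMap (hG : IsSmoothMetric s U G) {z : Euc d} (hz : z ∈ U)
    (x y w : Euc d) :
    metricBil (G z) (christoffelMap s G z x y) w =
      (1 / 2) * (fderivWithin ℝ (fun y' => metricBil (G y') y w) s z x
        + fderivWithin ℝ (fun y' => metricBil (G y') x w) s z y
        - fderivWithin ℝ (fun y' => metricBil (G y') x y) s z w) := by
  let κ : Fin d → Fin d → (Fin d → ℝ) := fun a b e => (1 / 2) * (pd s a (fun y => G y b e) z
    + pd s b (fun y => G y a e) z - pd s e (fun y => G y a b) z)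
  have h1 : christoffelMap s G z x y = sharp (G z) (bil κ x y) := by
    rw [← bil_clm, christoffelMap]
    congr 2
    refine congrArg bil ?_
    funext a b
    ext c
    rw [sharp_apply]
    simp only [christoffel, κ, Finset.mul_sum]
    exact Finset.sum_congr rfl fun e _ => by ring
  rw [h1, (hG.metric z hz).bil_sharp, hG.fderivWithin_metricBil hz, hG.fderivWithin_metricBil hz,
    hG.fderivWithin_metricBil hz, pair_apply]
  have h2 : ∀ f : Fin d → Fin d → Fin d → ℝ,
      ∑ a, ∑ b, ∑ c, f a b c = ∑ b, ∑ c, ∑ a, f a b c := fun f => by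
    rw [Finset.sum_comm]
    exact Finset.sum_congr rfl fun b _ => Finset.sum_comm
  have h3 : ∀ f : Fin d → Fin d → Fin d → ℝ,
      ∑ a, ∑ b, ∑ c, f a b c = ∑ b, ∑ a, ∑ c, f a b c := fun f => Finset.sum_comm
  have h4 : ∑ e, bil κ x y e * w e = ∑ a, ∑ b, ∑ e, x a * (y b * (w e * κ a b e)) := by
    rw [← h2 fun e a b => x a * (y b * (w e * κ a b e))]
    refine Finset.sum_congr rfl fun e _ => ?_
    simp only [bil_apply, Finset.sum_apply, Pi.smul_apply, smul_eq_mul, Finset.sum_mul]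
    exact Finset.sum_congr rfl fun a _ => Finset.sum_congr rfl fun b _ => by ring
  rw [h4, h3 (fun a b c => y a * (x b * (w c * pd s a (fun y' => G y' b c) z))),
    h2 (fun a b c => w a * (x b * (y c * pd s a (fun y' => G y' b c) z))),
    ← Finset.sum_add_distrib, ← Finset.sum_sub_distrib, Finset.mul_sum]
  refine Finset.sum_congr rfl fun a _ => ?_
  rw [← Finset.sum_add_distrib, ← Finset.sum_sub_distrib, Finset.mul_sum]
  refine Finset.sum_congr rfl fun b _ => ?_
  rw [← Finset.sum_add_distrib, ← Finset.sum_sub_distrib, Finset.mul_sum]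
  refine Finset.sum_congr rfl fun c _ => ?_
  simp only [κ]
  ring

theorem fderivWithin_metricBil_comm (hG : IsSmoothMetric s U G) {z : Euc d} (hz : z ∈ U)
    (u x y : Euc d) : fderivWithin ℝ (fun y' => metricBil (G y') x y) s z u =
      fderivWithin ℝ (fun y' => metricBil (G y') y x) s z u := by
  rw [hG.dom.fderivWithin_congr (fun y' hy' => (hG.metric y' hy').bil_comm x y) hz]

/-- The Levi-Civita connection is metric. -/
theorem isMetricConnection_christoffelMap (hG : IsSmoothMetric s U G) :
    IsMetricConnection s U (christoffelMap s G) (fun z => metricBil (G z)) := by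
  intro z hz u x y
  rw [(hG.metric z hz).bil_comm x, hG.metricBil_christoffelMap hz, hG.metricBil_christoffelMap hz,
    hG.fderivWithin_metricBil_comm hz u y x, hG.fderivWithin_metricBil_comm hz x u y,
    hG.fderivWithin_metricBil_comm hz y u x]
  ring

theorem fderivWithin_sharp (hG : IsSmoothMetric s U G) {z : Euc d} (hz : z ∈ U) (u : Euc d)
    (m m' : Fin d → ℝ) :
    pair m (fderivWithin ℝ (fun y => sharp (G y) m') s z u) =
      -pair m (christoffelMap s G z u (sharp (G z) m'))
        - pair m' (christoffelMap s G z u (sharp (G z) m)) := by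
  have hM := hG.metric z hz
  have h1 := hG.isMetricConnection_christoffelMap.fderivWithin_eq hG.dom
    (hG.contDiffOn_metricBil.of_le (by simp)) ((hG.contDiffOn_sharp m').of_le (by simp))
    (contDiffOn_const (c := sharp (G z) m)) hz u
  rw [hG.dom.fderivWithin_congr (f₂ := fun _ => pair m' (sharp (G z) m))
    (fun y hy => (hG.metric y hy).bil_sharp m' _) hz] at h1
  simp only [cderiv, fderivWithin_fun_const, Pi.zero_apply, _root_.zero_apply, zero_add, map_add,
    _root_.add_apply, hM.bil_sharp, hM.bil_sharp'] at h1
  linarith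

end IsSmoothMetric

/-! ### The tractor connection -/

/-- The connection form of tractor type defined by the metric `G` and a covariant tensor `Q` in the
place of the Schouten tensor. -/
def tractorConn (s : Set (Euc d)) (G Q : Euc d → Matrix (Fin d) (Fin d) ℝ) (z : Euc d) :
    Euc d →L[ℝ] TractorCoords d →L[ℝ] TractorCoords d :=
  LinearMap.toContinuousLinearMap (LinearMap.toContinuousLinearMap.toLinearMap ∘ₗ
    LinearMap.mk₂ ℝ (fun (u : Euc d) (t : TractorCoords d) =>
      ((-pair t.2.1 u, fun b => -pair t.2.1 (christoffelMap s G z u (basisVec b))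
        + metricBil (G z) u (basisVec b) * t.2.2 + metricBil (Q z) u (basisVec b) * t.1,
        -metricBil (Q z) u (sharp (G z) t.2.1)) : TractorCoords d))
      (fun u₁ u₂ t => by ext <;> simp <;> ring) (fun c u t => by ext <;> simp; ring)
      (fun u t₁ t₂ => by ext <;> simp <;> ring) (fun c u t => by ext <;> simp; ring))

theorem tractorConn_fst (z u : Euc d) (t : TractorCoords d) :
    (tractorConn s G Q z u t).1 = -pair t.2.1 u := rfl

theorem tractorConn_snd_snd (z u : Euc d) (t : TractorCoords d) :
    (tractorConn s G Q z u t).2.2 = -metricBil (Q z) u (sharp (G z) t.2.1) := rfl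

theorem pair_tractorConn (z u : Euc d) (t : TractorCoords d) (y : Euc d) :
    pair (tractorConn s G Q z u t).2.1 y = -pair t.2.1 (christoffelMap s G z u y)
      + metricBil (G z) u y * t.2.2 + metricBil (Q z) u y * t.1 := by
  have h1 := pair_clm (-(pair t.2.1).comp (christoffelMap s G z u) + t.2.2 • metricBil (G z) u
    + t.1 • metricBil (Q z) u) y
  simp only [_root_.add_apply, _root_.neg_apply, _root_.smul_apply, smul_eq_mul,
    ContinuousLinearMap.comp_apply] at h1
  rw [mul_comm _ t.2.2, mul_comm _ t.1, ← h1]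
  congr 2
  funext b
  simp only [mul_comm t.2.2, mul_comm t.1]
  rfl

theorem bil_basisVec_right {F : Type*} [NormedAddCommGroup F] [NormedSpace ℝ F]
    (c : Fin d → Fin d → F) (u : Euc d) (b : Fin d) : bil c u (basisVec b) = ∑ a, u a • c a b := by
  simp [bil_apply]

/-- The Schouten tensor as a matrix-valued function. -/
def schoutenMatrix (s : Set (Euc d)) (G : Euc d → Matrix (Fin d) (Fin d) ℝ) (z : Euc d) :
    Matrix (Fin d) (Fin d) ℝ :=
  Matrix.of fun a b => schouten s G a b z

theorem tractorConn_apply_eq_tractorForm (z u : Euc d) (t : TractorCoords d) :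
    tractorConn s G (schoutenMatrix s G) z u t = tractorForm s G z u t := by
  refine Prod.ext ?_ (Prod.ext (funext fun b => ?_) ?_)
  · rw [tractorConn_fst, pair_apply]
    exact congrArg _ (Finset.sum_congr rfl fun a _ => mul_comm _ _)
  · change -pair t.2.1 (christoffelMap s G z u (basisVec b)) +
      metricBil (G z) u (basisVec b) * t.2.2 + metricBil (schoutenMatrix s G z) u (basisVec b) * t.1
      = ∑ a, u a * (-(∑ c, christoffel s G c a b z * t.2.1 c) + G z a b * t.2.2
        + schouten s G a b z * t.1)
    rw [christoffelMap, metricBil, metricBil, bil_basisVec_right, bil_basisVec_right,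
      bil_basisVec_right, map_sum, Finset.sum_mul, Finset.sum_mul, ← Finset.sum_neg_distrib,
      ← Finset.sum_add_distrib, ← Finset.sum_add_distrib]
    refine Finset.sum_congr rfl fun a _ => ?_
    have h1 : pair t.2.1 (WithLp.toLp 2 fun c => christoffel s G c a b z) =
        ∑ c, christoffel s G c a b z * t.2.1 c := by
      rw [pair_apply]
      exact Finset.sum_congr rfl fun c _ => mul_comm _ _
    rw [map_smul, h1, smul_eq_mul, smul_eq_mul, smul_eq_mul, schoutenMatrix, Matrix.of_apply]
    ring
  · rw [tractorConn_snd_snd, metricBil, bil_apply]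
    change _ = -∑ a, ∑ b, ∑ c, u a * schouten s G a b z * (G z)⁻¹ b c * t.2.1 c
    congr 1
    refine Finset.sum_congr rfl fun a _ => Finset.sum_congr rfl fun b _ => ?_
    rw [sharp_apply, smul_eq_mul, smul_eq_mul, Finset.sum_mul, Finset.mul_sum]
    refine Finset.sum_congr rfl fun c _ => ?_
    rw [schoutenMatrix, Matrix.of_apply]
    ring

namespace IsSmoothMetric

/-- `Q` is a smooth symmetric tensor on `U`. -/
structure _root_.ConformalTractor.IsSmoothSymm (U : Set (Euc d))
    (Q : Euc d → Matrix (Fin d) (Fin d) ℝ) : Prop where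
  smooth : ∀ a b, ContDiffOn ℝ ∞ (fun z => Q z a b) U
  symm : ∀ z ∈ U, ∀ a b, Q z a b = Q z b a

theorem contDiffOn_tractorConn (hG : IsSmoothMetric s U G) (hQ : IsSmoothSymm U Q) :
    ContDiffOn ℝ ∞ (tractorConn s G Q) U := by
  rw [contDiffOn_clm_apply]
  intro u
  rw [contDiffOn_clm_apply]
  intro t
  have hΓ := hG.contDiffOn_christoffelMap
  have hg := hG.contDiffOn_metricBil
  have hq : ContDiffOn ℝ ∞ (fun z => metricBil (Q z)) U := contDiffOn_bil hQ.smooth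
  refine ContDiffOn.prodMk contDiffOn_const (ContDiffOn.prodMk (contDiffOn_pi.2 fun b => ?_) ?_)
  · exact ((contDiffOn_const.clm_apply
      ((hΓ.clm_apply contDiffOn_const).clm_apply contDiffOn_const)).neg.add
      (((hg.clm_apply contDiffOn_const).clm_apply contDiffOn_const).mul contDiffOn_const)).add
      (((hq.clm_apply contDiffOn_const).clm_apply contDiffOn_const).mul contDiffOn_const)
  · exact ((hq.clm_apply contDiffOn_const).clm_apply (hG.contDiffOn_sharp _)).neg

theorem contDiffOn_tractorBil (hG : IsSmoothMetric s U G) :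
    ContDiffOn ℝ ∞ (fun z => tractorBil (G z)) U := by
  rw [contDiffOn_clm_apply]
  intro t
  rw [contDiffOn_clm_apply]
  intro t'
  exact ((contDiffOn_const.clm_apply (hG.contDiffOn_sharp _)).add contDiffOn_const).add
    contDiffOn_const

/-- The tractor metric is parallel. -/
theorem isMetricConnection_tractorConn (hG : IsSmoothMetric s U G) :
    IsMetricConnection s U (tractorConn s G Q) (fun z => tractorBil (G z)) := by
  intro z hz u t t'
  have hM := hG.metric z hz
  have h1 : fderivWithin ℝ (fun y => tractorBil (G y) t t') s z u =
      pair t.2.1 (fderivWithin ℝ (fun y => sharp (G y) t'.2.1) s z u) := by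
    have h2 := (((pair t.2.1).hasFDerivAt.comp_hasFDerivWithinAt z
      (hG.dom.hasFDerivWithinAt (hG.contDiffOn_sharp t'.2.1) (by simp) hz)).add_const
        (t.1 * t'.2.2)).add_const (t.2.2 * t'.1)
    have h3 : fderivWithin ℝ (fun y => tractorBil (G y) t t') s z = _ := hG.dom.fderivWithin_eq hz h2
    rw [h3]
    rfl
  rw [h1, hG.fderivWithin_sharp hz, tractorBil_apply, tractorBil_apply, pair_tractorConn,
    hM.pair_sharp_comm t.2.1 (tractorConn s G Q z u t').2.1, pair_tractorConn, tractorConn_fst,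
    tractorConn_fst, tractorConn_snd_snd, tractorConn_snd_snd, hM.bil_sharp', hM.bil_sharp']
  ring

variable {z : Euc d}

/-- The tractor curvature has no component of lowest weight: the connection is torsion free. -/
theorem curv_tractorConn_fst (hG : IsSmoothMetric s U G) (hQ : IsSmoothSymm U Q) (hz : z ∈ U)
    (u v : Euc d) (t : TractorCoords d) : (curv s (tractorConn s G Q) z u v t).1 = 0 := by
  have hA := hG.contDiffOn_tractorConn hQ
  have h1 : ∀ u v : Euc d, (fderivWithin ℝ (tractorConn s G Q) s z u v t).1 = 0 := by
    intro u v
    rw [← hG.dom.fderivWithin_apply_const hA (by simp) hz,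
      ← hG.dom.fderivWithin_apply_const (hA.clm_apply contDiffOn_const) (by simp) hz]
    refine (hG.dom.fderivWithin_clm (ContinuousLinearMap.fst ℝ ℝ ((Fin d → ℝ) × ℝ))
      ((hA.clm_apply (contDiffOn_const (c := v))).clm_apply (contDiffOn_const (c := t)))
      (by simp) hz u).trans ?_
    have h2 : (fun y => ContinuousLinearMap.fst ℝ ℝ ((Fin d → ℝ) × ℝ) (tractorConn s G Q y v t)) =
      fun _ => -pair t.2.1 v := rfl
    rw [h2]
    simp
  simp only [curv, _root_.add_apply, _root_.sub_apply, clm_mul_apply, Prod.fst_add, Prod.fst_sub, h1,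
    tractorConn_fst, pair_tractorConn]
  rw [hG.christoffelMap_comm hz u v, (hG.metric z hz).bil_comm u v, bil_comm (hQ.symm z hz) u v]
  ring

theorem curv_tractorConn_top (hG : IsSmoothMetric s U G) (hQ : IsSmoothSymm U Q) (hz : z ∈ U)
    (u v : Euc d) : curv s (tractorConn s G Q) z u v (0, 0, 1) = 0 := by
  refine (hG.metric z hz).tractorBil_nondegenerate fun t' => ?_
  have h1 := metric_curv hG.dom (hG.contDiffOn_tractorConn hQ) hG.contDiffOn_tractorBil
    hG.isMetricConnection_tractorConn hz u v (0, 0, 1) t'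
  rw [tractorBil_apply _ (0, 0, 1), hG.curv_tractorConn_fst hQ hz] at h1
  simpa using h1

theorem curv_tractorConn_snd_snd (hG : IsSmoothMetric s U G) (hQ : IsSmoothSymm U Q) (hz : z ∈ U)
    (u v : Euc d) (m : Fin d → ℝ) : (curv s (tractorConn s G Q) z u v (0, m, 0)).2.2 =
      -pair (curv s (tractorConn s G Q) z u v (1, 0, 0)).2.1 (sharp (G z) m) := by
  have h1 := metric_curv hG.dom (hG.contDiffOn_tractorConn hQ) hG.contDiffOn_tractorBil
    hG.isMetricConnection_tractorConn hz u v (0, m, 0) (1, 0, 0)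
  rw [(hG.metric z hz).tractorBil_comm (0, m, 0), tractorBil_apply, tractorBil_apply,
    hG.curv_tractorConn_fst hQ hz] at h1
  simp at h1
  linarith

theorem curv_tractorConn_bot_snd_snd (hG : IsSmoothMetric s U G) (hQ : IsSmoothSymm U Q)
    (hz : z ∈ U) (u v : Euc d) : (curv s (tractorConn s G Q) z u v (1, 0, 0)).2.2 = 0 := by
  have h1 := metric_curv hG.dom (hG.contDiffOn_tractorConn hQ) hG.contDiffOn_tractorBil
    hG.isMetricConnection_tractorConn hz u v (1, 0, 0) (1, 0, 0)
  rw [(hG.metric z hz).tractorBil_comm (1, 0, 0), tractorBil_apply] at h1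
  simp at h1
  linarith

/-- The middle component of the curvature is skew. -/
theorem pair_curv_tractorConn_skew (hG : IsSmoothMetric s U G) (hQ : IsSmoothSymm U Q)
    (hz : z ∈ U) (u v : Euc d) (m m' : Fin d → ℝ) :
    pair (curv s (tractorConn s G Q) z u v (0, m, 0)).2.1 (sharp (G z) m') =
      -pair (curv s (tractorConn s G Q) z u v (0, m', 0)).2.1 (sharp (G z) m) := by
  have h1 := metric_curv hG.dom (hG.contDiffOn_tractorConn hQ) hG.contDiffOn_tractorBil
    hG.isMetricConnection_tractorConn hz u v (0, m, 0) (0, m', 0)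
  rw [(hG.metric z hz).tractorBil_comm (0, m, 0), tractorBil_apply, tractorBil_apply] at h1
  simp at h1
  linarith

/-- The first Bianchi identity. -/
theorem pair_curv_tractorConn_cyclic (hG : IsSmoothMetric s U G) (hQ : IsSmoothSymm U Q)
    (hz : z ∈ U) (u v y : Euc d) (t : TractorCoords d) :
    pair (curv s (tractorConn s G Q) z u v t).2.1 y + pair (curv s (tractorConn s G Q) z v y t).2.1 u
      + pair (curv s (tractorConn s G Q) z y u t).2.1 v = 0 := by
  have hA := hG.contDiffOn_tractorConn hQ
  have h1 : ∀ e u v : Euc d, (curvDeriv s (tractorConn s G Q) z e u v t).1 =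
      -pair (curv s (tractorConn s G Q) z u v t).2.1 e := by
    intro e u v
    have h2 : (fderivWithin ℝ (fun y => curv s (tractorConn s G Q) y u v) s z e t).1 = 0 := by
      rw [← hG.dom.fderivWithin_apply_const (contDiffOn_curv hG.dom hA u v) (by simp) hz]
      refine (hG.dom.fderivWithin_clm (ContinuousLinearMap.fst ℝ ℝ ((Fin d → ℝ) × ℝ))
        ((contDiffOn_curv hG.dom hA u v).clm_apply (contDiffOn_const (c := t))) (by simp) hz
        e).trans ?_
      rw [hG.dom.fderivWithin_congr (f₁ := fun y => ContinuousLinearMap.fst ℝ ℝ ((Fin d → ℝ) × ℝ)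
        (curv s (tractorConn s G Q) y u v t)) (f₂ := fun _ => 0)
        (fun y hy => hG.curv_tractorConn_fst hQ hy u v t) hz]
      simp
    simp only [curvDeriv, _root_.add_apply, _root_.sub_apply, clm_mul_apply, Prod.fst_add,
      Prod.fst_sub, h2, tractorConn_fst, hG.curv_tractorConn_fst hQ hz]
    ring
  have h3 := congrArg (fun L : TractorCoords d →L[ℝ] TractorCoords d => (L t).1)
    (curvDeriv_cyclic hG.dom hA hz y u v)
  simp only [_root_.add_apply, Prod.fst_add, h1, _root_.zero_apply, Prod.fst_zero] at h3
  linarith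

end IsSmoothMetric

end LeviCivita

section Schouten

variable {d : ℕ} {s U : Set (Euc d)} {G Q : Euc d → Matrix (Fin d) (Fin d) ℝ} {z : Euc d}

theorem pair_neg (m : Fin d → ℝ) (y : Euc d) : pair (-m) y = -pair m y := by
  simp only [pair_apply, Pi.neg_apply, neg_mul, Finset.sum_neg_distrib]

/-- The middle block of an endomorphism of the tractor fibre. -/
def middleCov (L : TractorCoords d →L[ℝ] TractorCoords d) :
    (Fin d → ℝ) →L[ℝ] Euc d →L[ℝ] ℝ :=
  pair.comp ((ContinuousLinearMap.fst ℝ (Fin d → ℝ) ℝ).comp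
    ((ContinuousLinearMap.snd ℝ ℝ ((Fin d → ℝ) × ℝ)).comp (L.comp
      ((ContinuousLinearMap.inr ℝ ℝ ((Fin d → ℝ) × ℝ)).comp
        (ContinuousLinearMap.inl ℝ (Fin d → ℝ) ℝ)))))

theorem middleCov_apply (L : TractorCoords d →L[ℝ] TractorCoords d) (m : Fin d → ℝ) (y : Euc d) :
    middleCov L m y = pair (L (0, m, 0)).2.1 y := rfl

/-- The middle block of an endomorphism of the tractor fibre, as a bilinear form. -/
def middle (M : Matrix (Fin d) (Fin d) ℝ) (L : TractorCoords d →L[ℝ] TractorCoords d) :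
    Euc d →L[ℝ] Euc d →L[ℝ] ℝ :=
  (middleCov L).comp (flat M)

theorem middle_apply (M : Matrix (Fin d) (Fin d) ℝ) (L : TractorCoords d →L[ℝ] TractorCoords d)
    (x y : Euc d) : middle M L x y = pair (L (0, flat M x, 0)).2.1 y := rfl

/-- The metric trace of a bilinear form. -/
def metricTrace (M : Matrix (Fin d) (Fin d) ℝ) (B : Euc d →L[ℝ] Euc d →L[ℝ] ℝ) : ℝ :=
  ∑ a, B (basisVec a) (sharp M (basisCovec a))

theorem IsMetricMatrix.metricTrace_skew {M : Matrix (Fin d) (Fin d) ℝ} (hM : IsMetricMatrix M)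
    {B : Euc d →L[ℝ] Euc d →L[ℝ] ℝ} (hB : ∀ x y, B x y = -B y x) : metricTrace M B = 0 := by
  have h1 : metricTrace M B = -metricTrace M B := by
    conv_lhs => rw [metricTrace, hM.sum_swap]
    rw [metricTrace, ← Finset.sum_neg_distrib]
    exact Finset.sum_congr rfl fun a _ => hB _ _
  linarith

theorem IsMetricMatrix.metricTrace_self {M : Matrix (Fin d) (Fin d) ℝ} (hM : IsMetricMatrix M) :
    metricTrace M (metricBil M) = d := by
  simp only [metricTrace, hM.bil_sharp', pair_basisVec, Pi.single_eq_same]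
  simp

theorem IsMetricMatrix.metricTrace_eq {M : Matrix (Fin d) (Fin d) ℝ} (hM : IsMetricMatrix M)
    (N : Matrix (Fin d) (Fin d) ℝ) :
    metricTrace M (metricBil N) = ∑ a, ∑ b, M⁻¹ a b * N a b := by
  rw [metricTrace, hM.sum_swap, Finset.sum_comm]
  refine Finset.sum_congr rfl fun a _ => ?_
  rw [bil_basisVec_right]
  refine Finset.sum_congr rfl fun b _ => ?_
  rw [sharp_apply, smul_eq_mul]
  simp [Pi.single_apply]

/-- The Ricci tensor as a matrix-valued function. -/
def ricciMatrix (s : Set (Euc d)) (G : Euc d → Matrix (Fin d) (Fin d) ℝ) (z : Euc d) :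
    Matrix (Fin d) (Fin d) ℝ :=
  Matrix.of fun a b => ricci s G a b z

namespace IsSmoothMetric

theorem riemann_eq_curv (hG : IsSmoothMetric s U G) (hz : z ∈ U) (a b c e : Fin d) :
    riemann s G a b c e z =
      curv s (christoffelMap s G) z (basisVec a) (basisVec b) (basisVec e) c := by
  have hΓ := hG.contDiffOn_christoffelMap
  have h1 : ∀ a b : Fin d, fderivWithin ℝ (christoffelMap s G) s z (basisVec a) (basisVec b)
      (basisVec e) c = pd s a (christoffel s G c b e) z := by
    intro a b
    rw [← hG.dom.fderivWithin_apply_const hΓ (by simp) hz,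
      ← hG.dom.fderivWithin_apply_const (hΓ.clm_apply contDiffOn_const) (by simp) hz]
    refine (hG.dom.fderivWithin_clm (EuclideanSpace.proj c : Euc d →L[ℝ] ℝ)
      ((hΓ.clm_apply (contDiffOn_const (c := basisVec b))).clm_apply
      (contDiffOn_const (c := basisVec e))) (by simp) hz _).trans ?_
    simp only [christoffelMap, bil_basisVec]
    rfl
  have h2 : ∀ a b : Fin d, christoffelMap s G z (basisVec a) (christoffelMap s G z (basisVec b)
      (basisVec e)) c = ∑ f, christoffel s G c a f z * christoffel s G f b e z := by
    intro a b
    rw [clm_eq_sum]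
    simp [christoffelMap, bil_basisVec, mul_comm]
  simp only [curv, _root_.add_apply, _root_.sub_apply, clm_mul_apply, PiLp.add_apply,
    PiLp.sub_apply, h1, h2, riemann, Finset.sum_sub_distrib]

theorem metricBil_ricciMatrix (hG : IsSmoothMetric s U G) (hz : z ∈ U) (v y : Euc d) :
    metricBil (ricciMatrix s G z) v y =
      ∑ a, curv s (christoffelMap s G) z (basisVec a) v y a := by
  have h1 : ∀ a, curv s (christoffelMap s G) z (basisVec a) v y a =
      ∑ b, ∑ e, v b * (y e * riemann s G a b a e z) := by
    intro a
    have h2 : curv s (christoffelMap s G) z (basisVec a) v =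
        ∑ b, v b • curv s (christoffelMap s G) z (basisVec a) (basisVec b) := by
      conv_lhs => rw [← sum_smul_basisVec v]
      rw [curv_sum_right]
      simp only [curv_smul_right]
    rw [h2]
    simp only [_root_.sum_apply, _root_.smul_apply, WithLp.ofLp_sum, Finset.sum_apply,
      PiLp.smul_apply, smul_eq_mul]
    refine Finset.sum_congr rfl fun b _ => ?_
    rw [clm_eq_sum]
    simp only [WithLp.ofLp_sum, Finset.sum_apply, PiLp.smul_apply, smul_eq_mul, Finset.mul_sum,
      hG.riemann_eq_curv hz]
  simp_rw [h1]
  symm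
  rw [bil_apply, Finset.sum_comm]
  refine Finset.sum_congr rfl fun b _ => ?_
  rw [Finset.sum_comm]
  refine Finset.sum_congr rfl fun e _ => ?_
  simp [ricciMatrix, ricci, Finset.mul_sum]

/-- The middle component of the curvature of a connection of tractor type. -/
theorem pair_curv_tractorConn (hG : IsSmoothMetric s U G) (hQ : IsSmoothSymm U Q) (hz : z ∈ U)
    (u v : Euc d) (m : Fin d → ℝ) (y : Euc d) :
    pair (curv s (tractorConn s G Q) z u v (0, m, 0)).2.1 y =
      -pair m (curv s (christoffelMap s G) z u v y)
        - (pair m v * metricBil (Q z) u y - pair m u * metricBil (Q z) v y)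
        - (metricBil (G z) u y * metricBil (Q z) v (sharp (G z) m)
          - metricBil (G z) v y * metricBil (Q z) u (sharp (G z) m)) := by
  have hA := hG.contDiffOn_tractorConn hQ
  have hΓ := hG.contDiffOn_christoffelMap
  have h1 : ∀ u v : Euc d, pair (fderivWithin ℝ (tractorConn s G Q) s z u v (0, m, 0)).2.1 y =
      -pair m (fderivWithin ℝ (christoffelMap s G) s z u v y) := by
    intro u v
    rw [← hG.dom.fderivWithin_apply_const hA (by simp) hz,
      ← hG.dom.fderivWithin_apply_const (hA.clm_apply contDiffOn_const) (by simp) hz,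
      ← hG.dom.fderivWithin_apply_const hΓ (by simp) hz,
      ← hG.dom.fderivWithin_apply_const (hΓ.clm_apply contDiffOn_const) (by simp) hz]
    refine (hG.dom.fderivWithin_clm (((pair.flip y).comp ((ContinuousLinearMap.fst ℝ (Fin d → ℝ) ℝ).comp
      (ContinuousLinearMap.snd ℝ ℝ ((Fin d → ℝ) × ℝ)))))
      ((hA.clm_apply (contDiffOn_const (c := v))).clm_apply (contDiffOn_const (c := (0, m, 0))))
      (by simp) hz u).trans ?_
    refine Eq.trans ?_ (hG.dom.fderivWithin_clm (-pair m)
      ((hΓ.clm_apply (contDiffOn_const (c := v))).clm_apply (contDiffOn_const (c := y)))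
      (by simp) hz u).symm
    have h2 : (fun x => ((pair.flip y).comp ((ContinuousLinearMap.fst ℝ (Fin d → ℝ) ℝ).comp
      (ContinuousLinearMap.snd ℝ ℝ ((Fin d → ℝ) × ℝ)))) (tractorConn s G Q x v (0, m, 0))) =
        fun x => (-pair m) (christoffelMap s G x v y) := by
      funext x
      refine (ConformalTractor.pair_tractorConn x v (0, m, 0) y).trans ?_
      simp
    rw [h2]
  simp only [curv, _root_.add_apply, _root_.sub_apply, clm_mul_apply, Prod.fst_add, Prod.fst_sub,
    Prod.snd_add, Prod.snd_sub, map_add, map_sub, h1, ConformalTractor.pair_tractorConn,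
    tractorConn_fst, tractorConn_snd_snd]
  ring

/-- The trace of the middle component of the curvature of a connection of tractor type. -/
theorem sum_pair_curv_tractorConn (hG : IsSmoothMetric s U G) (hQ : IsSmoothSymm U Q) (hz : z ∈ U)
    (v y : Euc d) :
    ∑ a, pair (curv s (tractorConn s G Q) z (basisVec a) v (0, basisCovec a, 0)).2.1 y =
      -metricBil (ricciMatrix s G z) v y + ((d : ℝ) - 2) * metricBil (Q z) v y
        + metricTrace (G z) (metricBil (Q z)) * metricBil (G z) v y := by
  have hM := hG.metric z hz
  have h1 : ∑ a, v a * metricBil (Q z) (basisVec a) y = metricBil (Q z) v y := by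
    have h2 := clm_eq_sum ((metricBil (Q z)).flip y) v
    simpa using h2.symm
  have h2 : ∑ a, metricBil (G z) (basisVec a) y * metricBil (Q z) v (sharp (G z) (basisCovec a)) =
      metricBil (Q z) v y := by
    rw [← hM.sum_bil_dual y (metricBil (Q z) v)]
    exact Finset.sum_congr rfl fun a _ => by rw [hM.bil_comm, smul_eq_mul]
  simp_rw [hG.pair_curv_tractorConn hQ hz, Finset.sum_sub_distrib, pair_basisCovec, h1, h2]
  rw [← Finset.mul_sum, ← Finset.sum_mul, hG.metricBil_ricciMatrix hz, Finset.sum_neg_distrib,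
    metricTrace]
  simp
  ring

end IsSmoothMetric

theorem metricBil_schoutenMatrix (v y : Euc d) :
    metricBil (schoutenMatrix s G z) v y =
      (metricBil (ricciMatrix s G z) v y - schoutenTrace s G z * metricBil (G z) v y)
        / ((d : ℝ) - 2) := by
  simp only [bil_apply, schoutenMatrix, ricciMatrix, Matrix.of_apply, schouten, smul_eq_mul,
    Finset.mul_sum, ← Finset.sum_sub_distrib, Finset.sum_div]
  exact Finset.sum_congr rfl fun a _ => Finset.sum_congr rfl fun b _ => by ring

theorem isSmoothSymm_zero (U : Set (Euc d)) : IsSmoothSymm U (fun _ => 0) :=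
  ⟨fun _ _ => contDiffOn_const, fun _ _ _ _ => rfl⟩

namespace IsSmoothMetric

theorem middle_curv_skew (hG : IsSmoothMetric s U G) (hQ : IsSmoothSymm U Q) (hz : z ∈ U)
    (u v x y : Euc d) : middle (G z) (curv s (tractorConn s G Q) z u v) x y =
      -middle (G z) (curv s (tractorConn s G Q) z u v) y x := by
  have h1 := hG.pair_curv_tractorConn_skew hQ hz u v (flat (G z) x) (flat (G z) y)
  rwa [(hG.metric z hz).sharp_flat, (hG.metric z hz).sharp_flat] at h1

theorem ricciMatrix_comm (hG : IsSmoothMetric s U G) (hz : z ∈ U) (v y : Euc d) :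
    metricBil (ricciMatrix s G z) v y = metricBil (ricciMatrix s G z) y v := by
  have hM := hG.metric z hz
  have hQ := isSmoothSymm_zero U
  have h1 : ∀ v y : Euc d, ∑ a, pair (curv s (tractorConn s G fun _ => 0) z (basisVec a) v
      (0, basisCovec a, 0)).2.1 y = -metricBil (ricciMatrix s G z) v y := by
    intro v y
    rw [hG.sum_pair_curv_tractorConn hQ hz]
    have h0 : metricBil (0 : Matrix (Fin d) (Fin d) ℝ) = 0 := by
      ext x y
      simp [bil_apply]
    simp [h0, metricTrace]
  have h2 : ∑ a, pair (curv s (tractorConn s G fun _ => 0) z v y (0, basisCovec a, 0)).2.1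
      (basisVec a) = 0 := by
    have h3 := hM.metricTrace_skew (hG.middle_curv_skew hQ hz v y)
    rw [metricTrace, hM.sum_swap] at h3
    simpa only [middle_apply, hM.flat_sharp] using h3
  have h4 := Finset.sum_congr rfl fun (a : Fin d) (_ : a ∈ Finset.univ) =>
    hG.pair_curv_tractorConn_cyclic hQ hz (basisVec a) v y (0, basisCovec a, 0)
  have h5 : ∑ a, pair (curv s (tractorConn s G fun _ => 0) z y (basisVec a)
      (0, basisCovec a, 0)).2.1 v = metricBil (ricciMatrix s G z) y v := by
    rw [← neg_neg (metricBil (ricciMatrix s G z) y v), ← h1, ← Finset.sum_neg_distrib]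
    refine Finset.sum_congr rfl fun a _ => ?_
    rw [curv_swap]
    simp
  rw [Finset.sum_add_distrib, Finset.sum_add_distrib, h1, h2, h5] at h4
  simp at h4
  linarith

theorem isSmoothSymm_schoutenMatrix (hG : IsSmoothMetric s U G) :
    IsSmoothSymm U (schoutenMatrix s G) := by
  refine ⟨fun a b => hG.contDiffOn_schouten a b, fun z hz a b => ?_⟩
  have h1 := hG.ricciMatrix_comm hz (basisVec a) (basisVec b)
  simp only [bil_basisVec, ricciMatrix, Matrix.of_apply] at h1
  simp only [schoutenMatrix, Matrix.of_apply, schouten, h1, (hG.metric z hz).symm a b]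

theorem schoutenTrace_eq (hG : IsSmoothMetric s U G) (hz : z ∈ U) :
    schoutenTrace s G z = metricTrace (G z) (metricBil (ricciMatrix s G z)) / (2 * ((d : ℝ) - 1)) := by
  rw [(hG.metric z hz).metricTrace_eq]
  rfl

/-- The curvature of the tractor connection is trace free. -/
theorem sum_pair_curv_schouten (hG : IsSmoothMetric s U G) (hd : 3 ≤ d) (hz : z ∈ U)
    (v y : Euc d) :
    ∑ a, pair (curv s (tractorConn s G (schoutenMatrix s G)) z (basisVec a) v
      (0, basisCovec a, 0)).2.1 y = 0 := by
  have hd' : (3 : ℝ) ≤ d := by exact_mod_cast hd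
  have h1 : metricTrace (G z) (metricBil (schoutenMatrix s G z)) = schoutenTrace s G z := by
    have h2 : metricTrace (G z) (metricBil (schoutenMatrix s G z)) =
        (metricTrace (G z) (metricBil (ricciMatrix s G z)) - schoutenTrace s G z *
          metricTrace (G z) (metricBil (G z))) / ((d : ℝ) - 2) := by
      simp only [metricTrace, metricBil_schoutenMatrix, Finset.mul_sum, Finset.sum_div,
        ← Finset.sum_sub_distrib]
    rw [h2, (hG.metric z hz).metricTrace_self, hG.schoutenTrace_eq hz]
    have h3 : (d : ℝ) - 2 ≠ 0 := by linarith
    have h4 : (d : ℝ) - 1 ≠ 0 := by linarith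
    field_simp
    ring
  rw [hG.sum_pair_curv_tractorConn hG.isSmoothSymm_schoutenMatrix hz, h1,
    metricBil_schoutenMatrix]
  have h3 : (d : ℝ) - 2 ≠ 0 := by linarith
  field_simp
  ring

/-- A connection of tractor type with trace-free curvature is the tractor connection. -/
theorem eq_schoutenMatrix (hG : IsSmoothMetric s U G) (hQ : IsSmoothSymm U Q) (hd : 3 ≤ d)
    (hz : z ∈ U) (h : ∀ v y : Euc d, ∑ a, pair (curv s (tractorConn s G Q) z (basisVec a) v
      (0, basisCovec a, 0)).2.1 y = 0) : Q z = schoutenMatrix s G z := by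
  have hd' : (3 : ℝ) ≤ d := by exact_mod_cast hd
  have h0 : (d : ℝ) - 2 ≠ 0 := by linarith
  have h0' : (d : ℝ) - 1 ≠ 0 := by linarith
  have h1 : ∀ v y, metricBil (ricciMatrix s G z) v y = ((d : ℝ) - 2) * metricBil (Q z) v y
      + metricTrace (G z) (metricBil (Q z)) * metricBil (G z) v y := fun v y => by
    have h2 := h v y
    rw [hG.sum_pair_curv_tractorConn hQ hz] at h2
    linarith
  have h3 : metricTrace (G z) (metricBil (ricciMatrix s G z)) =
      2 * ((d : ℝ) - 1) * metricTrace (G z) (metricBil (Q z)) := by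
    have h4 : metricTrace (G z) (metricBil (ricciMatrix s G z)) =
        ((d : ℝ) - 2) * metricTrace (G z) (metricBil (Q z))
          + metricTrace (G z) (metricBil (Q z)) * metricTrace (G z) (metricBil (G z)) := by
      conv_lhs => rw [metricTrace]
      simp only [h1]
      rw [Finset.sum_add_distrib, ← Finset.mul_sum, ← Finset.mul_sum]
      rfl
    rw [h4, (hG.metric z hz).metricTrace_self]
    ring
  have h5 : schoutenTrace s G z = metricTrace (G z) (metricBil (Q z)) := by
    rw [hG.schoutenTrace_eq hz, h3]
    field_simp
  ext a b
  have h6 := metricBil_schoutenMatrix (s := s) (G := G) (z := z) (basisVec a) (basisVec b)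
  rw [h1, h5, bil_basisVec, bil_basisVec, bil_basisVec] at h6
  rw [h6]
  field_simp
  ring

end IsSmoothMetric

end Schouten

section Cotton

variable {d : ℕ}

/-- The pair symmetry of algebraic curvature tensors. -/
theorem pair_symm_of_cyclic {α : Type*} {R : α → α → α → α → ℝ}
    (h1 : ∀ u v x y, R u v x y = -R v u x y) (h2 : ∀ u v x y, R u v x y = -R u v y x)
    (h3 : ∀ u v x y, R u v x y + R v y x u + R y u x v = 0) (u v x y : α) :
    R u v x y = R x y u v := by
  have a1 := h3 u v x y
  have a2 := h3 v x y u
  have a3 := h3 x y u v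
  have a4 := h3 y u v x
  have b1 := h2 v x y u
  have b2 := h1 v x u y
  linarith [h1 u v x y, h2 u v x y, h1 v y x u, h2 v y x u, h1 y u x v, h2 y u x v,
    h1 v x y u, h2 v x y u, h1 x u y v, h2 x u y v, h1 u v y x, h1 x y u v, h2 x y u v,
    h1 y v u x, h2 y v u x, h1 v x u y, h2 v x u y, h1 y u v x, h2 y u v x, h1 u x v y,
    h2 u x v y, h1 x y v u, h2 x y v u]

namespace IsMetricMatrix

variable {M : Matrix (Fin d) (Fin d) ℝ}

theorem sum_bil_mul (hM : IsMetricMatrix M) (x : Euc d) {f : Euc d → ℝ} (hf : IsLinearMap ℝ f) :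
    ∑ a, metricBil M x (basisVec a) * f (sharp M (basisCovec a)) = f x :=
  hM.sum_bil_dual x (LinearMap.toContinuousLinearMap hf.mk')

theorem sum_sharp_mul (hM : IsMetricMatrix M) (x : Euc d) {f : Euc d → ℝ} (hf : IsLinearMap ℝ f) :
    ∑ a, metricBil M x (sharp M (basisCovec a)) * f (basisVec a) = f x :=
  hM.sum_dual_bil x (LinearMap.toContinuousLinearMap hf.mk')

/-- The algebraic core of the vanishing of the Cotton tensor in the normal direction. The tensors
`C` and `N` play the role of the Cotton tensor and of the covariant derivative of the middle
component of the tractor curvature. -/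
theorem cotton_normal_eq_zero (hM : IsMetricMatrix M) (hd : 3 ≤ d) (hd4 : d ≠ 4)
    {C : Euc d → Euc d → Euc d → ℝ} {N : Euc d → Euc d → Euc d → Euc d → Euc d → ℝ}
    {W : Euc d → Euc d → Euc d → Euc d → ℝ} {m : Euc d} {ρ : ℝ}
    (hC1 : ∀ v y, IsLinearMap ℝ fun u => C u v y) (hC3 : ∀ u v, IsLinearMap ℝ fun y => C u v y)
    (hCs : ∀ u v y, C u v y = -C v u y) (hCc : ∀ u v y, C u v y + C v y u + C y u v = 0)
    (hNs : ∀ e u v x y, N e u v x y = -N e v u x y)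
    (hNs' : ∀ e u v x y, N e u v x y = -N e u v y x)
    (hNb : ∀ e u v x y, N e u v x y + N u v e x y + N v e u x y = 0)
    (hNc : ∀ e u v x y, N e u v x y + N e v y x u + N e y u x v =
      -(metricBil M e y * C u v x + metricBil M e u * C v y x + metricBil M e v * C y u x))
    (hNt : ∀ e v y, ∑ a, N e (basisVec a) v (sharp M (basisCovec a)) y =
      C e v y - metricBil M e y * ∑ b, C (basisVec b) v (sharp M (basisCovec b)))
    (hWt : ∀ v y, ∑ a, W (sharp M (basisCovec a)) v (basisVec a) y = 0)
    (hR : ∀ e u v y, N e u v m y = ρ * W u v e y) (hCm : ∀ u v, C u v m = 0) (v y : Euc d) :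
    C m v y = 0 := by
  let S : Euc d → Euc d → Euc d → Euc d → Euc d → ℝ := fun e u v x y =>
    N e u v x y - C u v y * metricBil M e x + C u v x * metricBil M e y
  let τ : Euc d → ℝ := fun v => ∑ b, C (basisVec b) v (sharp M (basisCovec b))
  have hC2 : ∀ u y, IsLinearMap ℝ fun v => C u v y := fun u y =>
    ⟨fun v v' => by
      rw [hCs, (hC1 u y).map_add, hCs u v, hCs u v']; ring,
      fun c v => by rw [hCs, (hC1 u y).map_smul, hCs u v]; simp⟩
  have hτl : IsLinearMap ℝ τ :=
    ⟨fun v v' => by simp only [τ, (hC2 _ _).map_add, Finset.sum_add_distrib],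
      fun c v => by simp only [τ, (hC2 _ _).map_smul, Finset.smul_sum]⟩
  have hS1 : ∀ e u v x y, S e u v x y = -S e v u x y := fun e u v x y => by
    simp only [S, hNs e u v, hCs u v]; ring
  have hS2 : ∀ e u v x y, S e u v x y = -S e u v y x := fun e u v x y => by
    simp only [S, hNs' e u v x y]; ring
  have hS3 : ∀ e u v x y, S e u v x y + S e v y x u + S e y u x v = 0 := fun e u v x y => by
    simp only [S]
    linear_combination hNc e u v x y - metricBil M e x * hCc u v y
  have hSp : ∀ e u v x y, S e u v x y = S e x y u v := fun e =>
    pair_symm_of_cyclic (hS1 e) (hS2 e) (hS3 e)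
  have hSt : ∀ e v y, ∑ a, S e (basisVec a) v (sharp M (basisCovec a)) y = 0 := by
    intro e v y
    simp only [S, Finset.sum_add_distrib, Finset.sum_sub_distrib, hNt]
    have h1 := hM.sum_sharp_mul e (hC1 v y)
    simp only [mul_comm] at h1 ⊢
    rw [h1, ← Finset.sum_mul]
    ring
  have hdiv : ∀ u v y, ∑ a, S (basisVec a) u v (sharp M (basisCovec a)) y =
      -((d : ℝ) - 3) * C u v y - τ v * metricBil M u y + τ u * metricBil M v y := by
    intro u v y
    have h0 := Finset.sum_congr rfl fun (a : Fin d) (_ : a ∈ Finset.univ) =>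
      hNb (basisVec a) u v (sharp M (basisCovec a)) y
    have hN : ∀ e u v x y, N e u v x y =
        S e u v x y + metricBil M e x * C u v y - metricBil M e y * C u v x :=
      fun e u v x y => by simp only [S]; ring
    simp only [hN, Finset.sum_add_distrib, Finset.sum_sub_distrib] at h0
    have h1 : ∑ a, metricBil M (basisVec a) (sharp M (basisCovec a)) * C u v y = d * C u v y := by
      rw [← Finset.sum_mul]
      exact congrArg (· * _) hM.metricTrace_self
    have h2 : ∑ a, metricBil M (basisVec a) y * C u v (sharp M (basisCovec a)) = C u v y := by
      rw [← hM.sum_bil_mul y (hC3 u v)]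
      exact Finset.sum_congr rfl fun a _ => by rw [hM.bil_comm]
    have h3 : ∑ a, S u v (basisVec a) (sharp M (basisCovec a)) y = 0 := by
      rw [← neg_zero, ← hSt u v y, ← Finset.sum_neg_distrib]
      exact Finset.sum_congr rfl fun a _ => hS1 _ _ _ _ _
    have h4 := hM.sum_sharp_mul u (hC2 v y)
    have h5 : ∑ a, metricBil M u y * C v (basisVec a) (sharp M (basisCovec a)) =
        -(metricBil M u y * τ v) := by
      rw [← Finset.mul_sum, ← mul_neg, ← Finset.sum_neg_distrib]
      exact congrArg _ (Finset.sum_congr rfl fun a _ => hCs _ _ _)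
    have h6 := hSt v u y
    have h7 := hM.sum_sharp_mul v (hC1 u y)
    have h8 : ∑ a, metricBil M v y * C (basisVec a) u (sharp M (basisCovec a)) =
        metricBil M v y * τ u := by rw [← Finset.mul_sum]
    rw [h1, h2, h3, h4, h5, h6, h7, h8] at h0
    simp only [Finset.sum_const_zero] at h0
    have h9 := hCs v u y
    linear_combination h0 - 2 * h9
  have hτ : ∀ u, τ u = 0 := by
    intro u
    have h1 := Finset.sum_congr rfl fun (b : Fin d) (_ : b ∈ Finset.univ) =>
      hdiv u (basisVec b) (sharp M (basisCovec b))
    rw [Finset.sum_comm] at h1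
    have h2 : ∀ a, ∑ b, S (basisVec a) u (basisVec b) (sharp M (basisCovec a))
        (sharp M (basisCovec b)) = 0 := by
      intro a
      rw [← hSt (basisVec a) u (sharp M (basisCovec a))]
      exact Finset.sum_congr rfl fun b _ => by rw [hS1, hS2, neg_neg]
    simp only [h2, Finset.sum_const_zero, Finset.sum_add_distrib, Finset.sum_sub_distrib,
      ← Finset.mul_sum] at h1
    have h3 : ∑ b, C u (basisVec b) (sharp M (basisCovec b)) = -τ u := by
      rw [← Finset.sum_neg_distrib]
      exact Finset.sum_congr rfl fun a _ => hCs _ _ _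
    have h4 : ∑ b, τ (basisVec b) * metricBil M u (sharp M (basisCovec b)) = τ u := by
      rw [← hM.sum_sharp_mul u hτl]
      exact Finset.sum_congr rfl fun a _ => mul_comm _ _
    have h5 : ∑ b, metricBil M (basisVec b) (sharp M (basisCovec b)) = d := hM.metricTrace_self
    rw [h3, h4, h5] at h1
    have h6 : (3 : ℝ) ≤ d := by exact_mod_cast hd
    have h7 : ((d : ℝ) - 2) * τ u = 0 := by linarith
    rcases mul_eq_zero.1 h7 with h8 | h8
    · linarith
    · exact h8
  have key : ∀ v y, C m v y = ((d : ℝ) - 3) * C m y v := by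
    intro v y
    have hswap : ∑ a, S (basisVec a) (sharp M (basisCovec a)) v m y = -C m v y := by
      have h1 : ∀ a, S (basisVec a) (sharp M (basisCovec a)) v m y =
          ρ * W (sharp M (basisCovec a)) v (basisVec a) y
            - metricBil M m (basisVec a) * C (sharp M (basisCovec a)) v y := by
        intro a
        simp only [S, hR, hCm, hM.bil_comm m]
        ring
      simp only [h1, Finset.sum_sub_distrib, ← Finset.mul_sum, hWt, hM.sum_bil_mul m (hC1 v y)]
      ring
    have h2 := hdiv m y v
    rw [hτ, hτ] at h2
    have h3 : ∑ a, S (basisVec a) (sharp M (basisCovec a)) v m y =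
        ∑ a, S (basisVec a) m y (sharp M (basisCovec a)) v :=
      Finset.sum_congr rfl fun a _ => hSp _ _ _ _ _
    rw [hswap, h2] at h3
    linarith
  have h1 := key v y
  rw [key y v] at h1
  have h3 : ((d : ℝ) - 2) * ((d : ℝ) - 4) * C m v y = 0 := by linear_combination -h1
  rcases mul_eq_zero.1 h3 with h4 | h4
  · exfalso
    rcases mul_eq_zero.1 h4 with h5 | h5
    · have : (3 : ℝ) ≤ d := by exact_mod_cast hd
      linarith
    · exact hd4 (by exact_mod_cast (by linarith : (d : ℝ) = 4))
  · exact h4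

end IsMetricMatrix

variable {s U : Set (Euc d)} {G Q : Euc d → Matrix (Fin d) (Fin d) ℝ} {z : Euc d}

/-- The Levi-Civita coupled covariant derivative of the curvature of a connection. -/
def coupledCurvDeriv (s : Set (Euc d)) (G Q : Euc d → Matrix (Fin d) (Fin d) ℝ) (z e u v : Euc d) :
    TractorCoords d →L[ℝ] TractorCoords d :=
  curvDeriv s (tractorConn s G Q) z e u v
    - curv s (tractorConn s G Q) z (christoffelMap s G z e u) v
    - curv s (tractorConn s G Q) z u (christoffelMap s G z e v)

theorem tractorCoords_decomp (t : TractorCoords d) :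
    t = t.1 • ((1, 0, 0) : TractorCoords d) + (0, t.2.1, 0) + t.2.2 • (0, 0, 1) := by
  ext <;> simp

theorem curvDeriv_swap {E 𝔄 : Type*} [NormedAddCommGroup E] [NormedSpace ℝ E] [NormedRing 𝔄]
    [NormedAlgebra ℝ 𝔄] {s : Set E} {A : E → E →L[ℝ] 𝔄} {z : E}
    (hz : UniqueDiffWithinAt ℝ s z) (e u v : E) : curvDeriv s A z e u v = -curvDeriv s A z e v u := by
  have h1 : (fun y => curv s A y u v) = fun y => -curv s A y v u := by
    funext y
    exact curv_swap y u v
  have h2 : fderivWithin ℝ (fun y => curv s A y u v) s z =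
      -fderivWithin ℝ (fun y => curv s A y v u) s z := by
    rw [h1]
    exact fderivWithin_fun_neg hz
  rw [curvDeriv, h2, curv_swap z u v, curvDeriv, _root_.neg_apply]
  noncomm_ring

namespace IsSmoothMetric

theorem coupledCurvDeriv_swap (hG : IsSmoothMetric s U G) (hz : z ∈ U) (e u v : Euc d) :
    coupledCurvDeriv s G Q z e u v = -coupledCurvDeriv s G Q z e v u := by
  rw [coupledCurvDeriv, coupledCurvDeriv, curvDeriv_swap (hG.dom.uniqueDiffWithinAt hz), curv_swap z _ v, curv_swap z u]
  abel

theorem coupledCurvDeriv_cyclic (hG : IsSmoothMetric s U G) (hQ : IsSmoothSymm U Q) (hz : z ∈ U)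
    (e u v : Euc d) : coupledCurvDeriv s G Q z e u v + coupledCurvDeriv s G Q z u v e
      + coupledCurvDeriv s G Q z v e u = 0 := by
  have h1 := curvDeriv_cyclic hG.dom (hG.contDiffOn_tractorConn hQ) hz e u v
  unfold coupledCurvDeriv
  rw [hG.christoffelMap_comm hz u e, hG.christoffelMap_comm hz v e, hG.christoffelMap_comm hz v u,
    curv_swap z v (christoffelMap s G z e u), curv_swap z (christoffelMap s G z u v) e,
    curv_swap z u (christoffelMap s G z e v)]
  rw [← h1]
  abel

theorem middle_coupledCurvDeriv_skew (hG : IsSmoothMetric s U G) (hQ : IsSmoothSymm U Q)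
    (hz : z ∈ U) (e u v x y : Euc d) :
    middle (G z) (coupledCurvDeriv s G Q z e u v) x y =
      -middle (G z) (coupledCurvDeriv s G Q z e u v) y x := by
  have hM := hG.metric z hz
  have h1 := metric_curvDeriv hG.dom (hG.contDiffOn_tractorConn hQ) hG.contDiffOn_tractorBil
    hG.isMetricConnection_tractorConn hz e u v (0, flat (G z) x, 0) (0, flat (G z) y, 0)
  rw [hM.tractorBil_comm (0, flat (G z) x, 0), tractorBil_apply, tractorBil_apply] at h1
  simp only [hM.sharp_flat] at h1
  have h2 := hG.middle_curv_skew hQ hz (christoffelMap s G z e u) v x y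
  have h3 := hG.middle_curv_skew hQ hz u (christoffelMap s G z e v) x y
  simp only [middle_apply] at h2 h3 ⊢
  simp only [coupledCurvDeriv, _root_.sub_apply, Prod.snd_sub, Prod.fst_sub, map_sub, h2, h3]
  simp at h1
  linarith

/-- The middle component of the coupled covariant derivative of the curvature. -/
theorem pair_coupledCurvDeriv (hG : IsSmoothMetric s U G) (hQ : IsSmoothSymm U Q) (hz : z ∈ U)
    (e u v : Euc d) (t : TractorCoords d) (y : Euc d) :
    pair (coupledCurvDeriv s G Q z e u v t).2.1 y =
      fderivWithin ℝ (fun y' => pair (curv s (tractorConn s G Q) y' u v t).2.1 y) s z e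
      - pair (curv s (tractorConn s G Q) z u v t).2.1 (christoffelMap s G z e y)
      + metricBil (G z) e y * (curv s (tractorConn s G Q) z u v t).2.2
      - pair (curv s (tractorConn s G Q) z u v (tractorConn s G Q z e t)).2.1 y
      - pair (curv s (tractorConn s G Q) z (christoffelMap s G z e u) v t).2.1 y
      - pair (curv s (tractorConn s G Q) z u (christoffelMap s G z e v) t).2.1 y := by
  have hF := contDiffOn_curv hG.dom (hG.contDiffOn_tractorConn hQ) u v
  have h1 : pair (fderivWithin ℝ (fun y' => curv s (tractorConn s G Q) y' u v) s z e t).2.1 y =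
      fderivWithin ℝ (fun y' => pair (curv s (tractorConn s G Q) y' u v t).2.1 y) s z e := by
    rw [← hG.dom.fderivWithin_apply_const hF (by simp) hz]
    exact hG.dom.fderivWithin_clm (((pair.flip y).comp ((ContinuousLinearMap.fst ℝ (Fin d → ℝ) ℝ).comp
      (ContinuousLinearMap.snd ℝ ℝ ((Fin d → ℝ) × ℝ)))))
      (hF.clm_apply (contDiffOn_const (c := t))) (by simp) hz e
  simp only [coupledCurvDeriv, curvDeriv, _root_.add_apply, _root_.sub_apply, clm_mul_apply,
    Prod.fst_add, Prod.fst_sub, Prod.snd_add, Prod.snd_sub, map_add, map_sub, h1,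
    ConformalTractor.pair_tractorConn, hG.curv_tractorConn_fst hQ hz]
  ring

/-- The algebraic Bianchi identity for the coupled covariant derivative. -/
theorem pair_coupledCurvDeriv_cyclic (hG : IsSmoothMetric s U G) (hQ : IsSmoothSymm U Q)
    (hz : z ∈ U) (e u v y : Euc d) (t : TractorCoords d) :
    pair (coupledCurvDeriv s G Q z e u v t).2.1 y + pair (coupledCurvDeriv s G Q z e v y t).2.1 u
      + pair (coupledCurvDeriv s G Q z e y u t).2.1 v =
      metricBil (G z) e y * (curv s (tractorConn s G Q) z u v t).2.2
      + metricBil (G z) e u * (curv s (tractorConn s G Q) z v y t).2.2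
      + metricBil (G z) e v * (curv s (tractorConn s G Q) z y u t).2.2 := by
  have hF : ∀ u v y : Euc d, DifferentiableWithinAt ℝ
      (fun y' => pair (curv s (tractorConn s G Q) y' u v t).2.1 y) s z := fun u v y =>
    ((((pair.flip y).comp ((ContinuousLinearMap.fst ℝ (Fin d → ℝ) ℝ).comp
      (ContinuousLinearMap.snd ℝ ℝ ((Fin d → ℝ) × ℝ))))).differentiableAt).comp_differentiableWithinAt z
      (hG.dom.differentiableWithinAt ((contDiffOn_curv hG.dom (hG.contDiffOn_tractorConn hQ)
        u v).clm_apply (contDiffOn_const (c := t))) (by simp) hz)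
  have h0 := hG.dom.fderivWithin_congr (f₂ := fun _ => (0 : ℝ))
    (fun y' hy' => hG.pair_curv_tractorConn_cyclic hQ hy' u v y t) hz
  have h1 := congrArg (fun L : Euc d →L[ℝ] ℝ => L e) h0
  rw [fderivWithin_fun_add (hG.dom.uniqueDiffWithinAt hz) ((hF u v y).fun_add (hF v y u)) (hF y u v),
    fderivWithin_fun_add (hG.dom.uniqueDiffWithinAt hz) (hF u v y) (hF v y u)] at h1
  simp only [_root_.add_apply, fderivWithin_fun_const, Pi.zero_apply, _root_.zero_apply] at h1
  rw [hG.pair_coupledCurvDeriv hQ hz, hG.pair_coupledCurvDeriv hQ hz,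
    hG.pair_coupledCurvDeriv hQ hz]
  have h2 := hG.pair_curv_tractorConn_cyclic hQ hz u v y (tractorConn s G Q z e t)
  have h3 := hG.pair_curv_tractorConn_cyclic hQ hz (christoffelMap s G z e u) v y t
  have h4 := hG.pair_curv_tractorConn_cyclic hQ hz u (christoffelMap s G z e v) y t
  have h5 := hG.pair_curv_tractorConn_cyclic hQ hz u v (christoffelMap s G z e y) t
  linarith

/-- The trace of the coupled covariant derivative of the tractor curvature. -/
theorem sum_pair_coupledCurvDeriv (hG : IsSmoothMetric s U G) (hd : 3 ≤ d) (hz : z ∈ U)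
    (e v y : Euc d) :
    ∑ a, pair (coupledCurvDeriv s G (schoutenMatrix s G) z e (basisVec a) v
      (0, basisCovec a, 0)).2.1 y =
      pair (curv s (tractorConn s G (schoutenMatrix s G)) z e v (1, 0, 0)).2.1 y
      - metricBil (G z) e y * ∑ a, pair (curv s (tractorConn s G (schoutenMatrix s G)) z (basisVec a)
        v (1, 0, 0)).2.1 (sharp (G z) (basisCovec a)) := by
  have hQ := hG.isSmoothSymm_schoutenMatrix
  have hF : ∀ a : Fin d, DifferentiableWithinAt ℝ (fun y' => pair (curv s (tractorConn s G
      (schoutenMatrix s G)) y' (basisVec a) v (0, basisCovec a, 0)).2.1 y) s z := fun a =>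
    ((((pair.flip y).comp ((ContinuousLinearMap.fst ℝ (Fin d → ℝ) ℝ).comp
      (ContinuousLinearMap.snd ℝ ℝ ((Fin d → ℝ) × ℝ))))).differentiableAt).comp_differentiableWithinAt z
      (hG.dom.differentiableWithinAt ((contDiffOn_curv hG.dom (hG.contDiffOn_tractorConn hQ)
        _ v).clm_apply (contDiffOn_const (c := (0, basisCovec a, 0)))) (by simp) hz)
  have h0 := hG.dom.fderivWithin_congr (f₂ := fun _ => (0 : ℝ))
    (fun y' hy' => hG.sum_pair_curv_schouten hd hy' v y) hz
  have h1 := congrArg (fun L : Euc d →L[ℝ] ℝ => L e) h0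
  rw [fderivWithin_fun_sum (hG.dom.uniqueDiffWithinAt hz) fun a _ => hF a] at h1
  simp only [_root_.sum_apply, fderivWithin_fun_const, Pi.zero_apply, _root_.zero_apply] at h1
  simp_rw [hG.pair_coupledCurvDeriv hQ hz, Finset.sum_sub_distrib, Finset.sum_add_distrib,
    Finset.sum_sub_distrib]
  rw [h1, hG.sum_pair_curv_schouten hd hz, hG.sum_pair_curv_schouten hd hz, ← Finset.mul_sum]
  have h2 : ∀ a, pair (curv s (tractorConn s G (schoutenMatrix s G)) z (basisVec a) v
      (tractorConn s G (schoutenMatrix s G) z e (0, basisCovec a, 0))).2.1 y =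
      -(e a * pair (curv s (tractorConn s G (schoutenMatrix s G)) z (basisVec a) v (1, 0, 0)).2.1 y)
      - ∑ b, christoffelMap s G z e (basisVec b) a *
        pair (curv s (tractorConn s G (schoutenMatrix s G)) z (basisVec a) v
          (0, basisCovec b, 0)).2.1 y := by
    intro a
    have h3 : (tractorConn s G (schoutenMatrix s G) z e (0, basisCovec a, 0)).2.1 =
        -∑ b, christoffelMap s G z e (basisVec b) a • basisCovec b := by
      rw [sum_smul_basisCovec fun b => christoffelMap s G z e (basisVec b) a]
      refine pair_ext fun y' => ?_
      rw [ConformalTractor.pair_tractorConn, pair_basisCovec, pair_neg]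
      have h4 : pair (fun b => christoffelMap s G z e (basisVec b) a) y' =
          christoffelMap s G z e y' a :=
        pair_clm ((EuclideanSpace.proj a : Euc d →L[ℝ] ℝ).comp (christoffelMap s G z e)) y'
      rw [h4]
      simp
    have h5 : pair (curv s (tractorConn s G (schoutenMatrix s G)) z (basisVec a) v
        (0, (tractorConn s G (schoutenMatrix s G) z e (0, basisCovec a, 0)).2.1, 0)).2.1 y =
        -∑ b, christoffelMap s G z e (basisVec b) a *
          pair (curv s (tractorConn s G (schoutenMatrix s G)) z (basisVec a) v
            (0, basisCovec b, 0)).2.1 y := by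
      rw [← middleCov_apply, h3, map_neg, map_sum]
      simp only [map_smul, _root_.neg_apply, _root_.sum_apply, _root_.smul_apply, smul_eq_mul,
        middleCov_apply]
    rw [tractorCoords_decomp (tractorConn s G (schoutenMatrix s G) z e (0, basisCovec a, 0)),
      map_add, map_add, map_smul, map_smul, hG.curv_tractorConn_top hQ hz, tractorConn_fst,
      pair_basisCovec, Prod.snd_add, Prod.snd_add, Prod.fst_add, Prod.fst_add, map_add, map_add,
      _root_.add_apply, _root_.add_apply, h5]
    simp
    ring
  have h3 : ∑ a, pair (curv s (tractorConn s G (schoutenMatrix s G)) z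
      (christoffelMap s G z e (basisVec a)) v (0, basisCovec a, 0)).2.1 y =
      ∑ a, ∑ b, christoffelMap s G z e (basisVec b) a *
        pair (curv s (tractorConn s G (schoutenMatrix s G)) z (basisVec a) v
          (0, basisCovec b, 0)).2.1 y := by
    rw [Finset.sum_comm]
    refine Finset.sum_congr rfl fun b _ => ?_
    conv_lhs => rw [← sum_smul_basisVec (christoffelMap s G z e (basisVec b)), curv_sum_left]
    simp [curv_smul_left, Prod.fst_sum, Prod.snd_sum]
  have h4 : ∑ a, e a * pair (curv s (tractorConn s G (schoutenMatrix s G)) z (basisVec a) v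
      (1, 0, 0)).2.1 y =
      pair (curv s (tractorConn s G (schoutenMatrix s G)) z e v (1, 0, 0)).2.1 y := by
    conv_rhs => rw [← sum_smul_basisVec e, curv_sum_left]
    simp [curv_smul_left, Prod.fst_sum, Prod.snd_sum]
  rw [h3]
  simp_rw [h2, Finset.sum_sub_distrib, Finset.sum_neg_distrib, h4,
    hG.curv_tractorConn_snd_snd hQ hz, Finset.sum_neg_distrib]
  ring

theorem middle_curv_pair_symm (hG : IsSmoothMetric s U G) (hQ : IsSmoothSymm U Q) (hz : z ∈ U)
    (u v x y : Euc d) : middle (G z) (curv s (tractorConn s G Q) z u v) x y =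
      middle (G z) (curv s (tractorConn s G Q) z x y) u v :=
  pair_symm_of_cyclic (R := fun u v x y => middle (G z) (curv s (tractorConn s G Q) z u v) x y)
    (fun u v x y => by simp only [middle_apply]; rw [curv_swap]; simp)
    (fun u v x y => hG.middle_curv_skew hQ hz u v x y)
    (fun u v x y => hG.pair_curv_tractorConn_cyclic hQ hz u v y (0, flat (G z) x, 0)) u v x y

theorem pair_coupledCurvDeriv_top (hG : IsSmoothMetric s U G) (hQ : IsSmoothSymm U Q) (hz : z ∈ U)
    (e u v y : Euc d) : pair (coupledCurvDeriv s G Q z e u v (0, 0, 1)).2.1 y =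
      -middle (G z) (curv s (tractorConn s G Q) z u v) e y := by
  have h1 := hG.dom.fderivWithin_congr
    (f₁ := fun y' => pair (curv s (tractorConn s G Q) y' u v (0, 0, 1)).2.1 y)
    (f₂ := fun _ => (0 : ℝ)) (fun y' hy' => by
      simp only [hG.curv_tractorConn_top hQ hy']
      simp) hz
  have h2 : tractorConn s G Q z e (0, 0, 1) = (0, flat (G z) e, 0) := by
    refine Prod.ext ?_ (Prod.ext (pair_ext fun y' => ?_) ?_)
    · rw [tractorConn_fst]; simp
    · rw [ConformalTractor.pair_tractorConn, pair_flat]; simp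
    · rw [tractorConn_snd_snd]; simp
  rw [hG.pair_coupledCurvDeriv hQ hz, h1, h2]
  simp only [hG.curv_tractorConn_top hQ hz, middle_apply]
  simp

section Parallel

variable {V : Euc d → TractorCoords d}

theorem curv_normal (hG : IsSmoothMetric s U G) (hQ : IsSmoothSymm U Q)
    (hV : ContDiffOn ℝ 2 V U) (hp : ∀ z ∈ U, ∀ u, cderiv s (tractorConn s G Q) u V z = 0)
    (hz : z ∈ U) (h0 : (V z).1 = 0) (u v : Euc d) :
    curv s (tractorConn s G Q) z u v (0, (V z).2.1, 0) = 0 := by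
  have h1 := curv_apply_eq_zero hG.dom (hG.contDiffOn_tractorConn hQ) hV hp hz u v
  rw [tractorCoords_decomp (V z), h0, map_add, map_add, map_smul, map_smul,
    hG.curv_tractorConn_top hQ hz] at h1
  simpa using h1

/-- The tractor curvature along the zero set of `σ` vanishes in the direction of the gradient of
`σ`, in dimension `d ≠ 4`. -/
theorem curv_gradient_eq_zero (hG : IsSmoothMetric s U G) (hd : 3 ≤ d) (hd4 : d ≠ 4)
    (hV : ContDiffOn ℝ 2 V U)
    (hp : ∀ z ∈ U, ∀ u, cderiv s (tractorConn s G (schoutenMatrix s G)) u V z = 0)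
    (hz : z ∈ U) (h0 : (V z).1 = 0) (v : Euc d) :
    curv s (tractorConn s G (schoutenMatrix s G)) z (sharp (G z) (V z).2.1) v = 0 := by
  have hM := hG.metric z hz
  have hQ := hG.isSmoothSymm_schoutenMatrix
  have hA := hG.contDiffOn_tractorConn hQ
  have hW1 : ∀ v x y, IsLinearMap ℝ fun u =>
      middle (G z) (curv s (tractorConn s G (schoutenMatrix s G)) z u v) x y := fun v x y =>
    ⟨fun u u' => by simp [middle_apply, curv_add_left],
      fun c u => by simp [middle_apply, curv_smul_left]⟩
  have hCm : ∀ u v, pair (curv s (tractorConn s G (schoutenMatrix s G)) z u v (1, 0, 0)).2.1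
      (sharp (G z) (V z).2.1) = 0 := by
    intro u v
    have h1 := hG.curv_tractorConn_snd_snd hQ hz u v (V z).2.1
    rw [hG.curv_normal hQ hV hp hz h0] at h1
    simpa using h1.symm
  have hC : ∀ y, pair (curv s (tractorConn s G (schoutenMatrix s G)) z (sharp (G z) (V z).2.1) v
      (1, 0, 0)).2.1 y = 0 := by
    intro y
    refine hM.cotton_normal_eq_zero hd hd4
      (C := fun u v y => pair (curv s (tractorConn s G (schoutenMatrix s G)) z u v (1, 0, 0)).2.1 y)
      (N := fun e u v x y => middle (G z) (coupledCurvDeriv s G (schoutenMatrix s G) z e u v) x y)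
      (W := fun u v x y => middle (G z) (curv s (tractorConn s G (schoutenMatrix s G)) z u v) x y)
      (m := sharp (G z) (V z).2.1) (ρ := (V z).2.2)
      (fun v y => ⟨fun u u' => by simp [curv_add_left], fun c u => by simp [curv_smul_left]⟩)
      (fun u v => ⟨fun u u' => by simp, fun c u => by simp⟩)
      (fun u v y => by rw [curv_swap]; simp)
      (fun u v y => hG.pair_curv_tractorConn_cyclic hQ hz u v y _)
      (fun e u v x y => by simp only [middle_apply]; rw [hG.coupledCurvDeriv_swap hz]; simp)
      (fun e u v x y => hG.middle_coupledCurvDeriv_skew hQ hz e u v x y)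
      (fun e u v x y => ?_) (fun e u v x y => ?_) (fun e v y => ?_) (fun v y => ?_)
      (fun e u v y => ?_) hCm v y
    · have h1 := congrArg (fun L => middle (G z) L x y) (hG.coupledCurvDeriv_cyclic hQ hz e u v)
      simpa [middle_apply] using h1
    · simp only [middle_apply]
      rw [hG.pair_coupledCurvDeriv_cyclic hQ hz, hG.curv_tractorConn_snd_snd hQ hz,
        hG.curv_tractorConn_snd_snd hQ hz, hG.curv_tractorConn_snd_snd hQ hz, hM.sharp_flat]
      ring
    · simp only [middle_apply, hM.flat_sharp]
      exact hG.sum_pair_coupledCurvDeriv hd hz e v y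
    · have h1 : ∀ a, middle (G z) (curv s (tractorConn s G (schoutenMatrix s G)) z
          (sharp (G z) (basisCovec a)) v) (basisVec a) y = ∑ b, metricBil (G z) (basisVec a)
          (basisVec b) * middle (G z) (curv s (tractorConn s G (schoutenMatrix s G)) z
          (sharp (G z) (basisCovec a)) v) (sharp (G z) (basisCovec b)) y := fun a =>
        (hM.sum_bil_mul (basisVec a) (f := fun x => middle (G z) (curv s (tractorConn s G
          (schoutenMatrix s G)) z (sharp (G z) (basisCovec a)) v) x y)
          ⟨fun x x' => by simp, fun c x => by simp⟩).symm
      simp only [h1]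
      rw [Finset.sum_comm]
      have h2 : ∀ b, ∑ a, metricBil (G z) (basisVec a) (basisVec b) * middle (G z) (curv s
          (tractorConn s G (schoutenMatrix s G)) z (sharp (G z) (basisCovec a)) v)
          (sharp (G z) (basisCovec b)) y = pair (curv s (tractorConn s G (schoutenMatrix s G)) z
          (basisVec b) v (0, basisCovec b, 0)).2.1 y := by
        intro b
        have h3 := hM.sum_bil_mul (basisVec b) (hW1 v (sharp (G z) (basisCovec b)) y)
        simp only [hM.bil_comm (basisVec b)] at h3
        rw [h3, middle_apply, hM.flat_sharp]
      simp only [h2]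
      exact hG.sum_pair_curv_schouten hd hz v y
    · have h1 := curvDeriv_apply_eq_zero hG.dom hA hV hp hz e u v
      have h2 := curv_apply_eq_zero hG.dom hA hV hp hz
      have h3 : coupledCurvDeriv s G (schoutenMatrix s G) z e u v (V z) = 0 := by
        simp only [coupledCurvDeriv, _root_.sub_apply, h1, h2, sub_zero]
      rw [tractorCoords_decomp (V z), h0, map_add, map_add, map_smul, map_smul] at h3
      have h4 := congrArg (fun t : TractorCoords d => pair t.2.1 y) h3
      simp only [zero_smul, zero_add, Prod.snd_add, Prod.fst_add, Prod.smul_snd, Prod.smul_fst,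
        map_add, map_smul, _root_.add_apply, _root_.smul_apply, smul_eq_mul,
        hG.pair_coupledCurvDeriv_top hQ hz, Prod.snd_zero, Prod.fst_zero, map_zero,
        _root_.zero_apply] at h4
      rw [middle_apply, hM.flat_sharp]
      linarith
  refine ContinuousLinearMap.ext fun t => ?_
  have hbot : curv s (tractorConn s G (schoutenMatrix s G)) z (sharp (G z) (V z).2.1) v
      (1, 0, 0) = 0 := by
    refine Prod.ext (hG.curv_tractorConn_fst hQ hz _ _ _) (Prod.ext (pair_ext fun y => ?_) ?_)
    · rw [hC]; simp
    · exact hG.curv_tractorConn_bot_snd_snd hQ hz _ _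
  have hmid : curv s (tractorConn s G (schoutenMatrix s G)) z (sharp (G z) (V z).2.1) v
      (0, t.2.1, 0) = 0 := by
    refine Prod.ext (hG.curv_tractorConn_fst hQ hz _ _ _) (Prod.ext (pair_ext fun y => ?_) ?_)
    · have h1 := hG.middle_curv_pair_symm hQ hz (sharp (G z) (V z).2.1) v (sharp (G z) t.2.1) y
      rw [middle_apply, middle_apply, hM.flat_sharp, hM.flat_sharp,
        hG.curv_normal hQ hV hp hz h0] at h1
      exact h1.trans (by simp)
    · rw [hG.curv_tractorConn_snd_snd hQ hz, hC]; simp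
  rw [tractorCoords_decomp t, map_add, map_add, map_smul, map_smul, hbot, hmid,
    hG.curv_tractorConn_top hQ hz]
  simp

end Parallel

end IsSmoothMetric

end Cotton

section HypersurfaceChart

variable {n : ℕ} {s U : Set (Euc (n + 1))} {G : Euc (n + 1) → Matrix (Fin (n + 1)) (Fin (n + 1)) ℝ}
  {V : Euc (n + 1) → TractorCoords (n + 1)} {s' U' : Set (Euc n)} {f : Euc n → Euc (n + 1)} {c : ℝ}
  {G' : Euc n → Matrix (Fin n) (Fin n) ℝ} {z : Euc n}

/-- The coordinate form of a hypersurface `f` in the zero set of the scale `σ` of a parallel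
tractor `V`, where `c • V` has norm one along the hypersurface. -/
structure IsHypersurfaceChart (s U : Set (Euc (n + 1)))
    (G : Euc (n + 1) → Matrix (Fin (n + 1)) (Fin (n + 1)) ℝ)
    (V : Euc (n + 1) → TractorCoords (n + 1)) (s' U' : Set (Euc n)) (f : Euc n → Euc (n + 1))
    (c : ℝ) : Prop where
  metric : IsSmoothMetric s U G
  smooth_tractor : ContDiffOn ℝ 2 V U
  parallel : ∀ z ∈ U, ∀ u, cderiv s (tractorConn s G (schoutenMatrix s G)) u V z = 0
  dom : IsChartDomain s' U'
  smooth : ContDiffOn ℝ ∞ f U'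
  mapsTo : MapsTo f U' U
  injective : ∀ z ∈ U', Function.Injective (fderivWithin ℝ f s' z)
  zero : ∀ z ∈ U', (V (f z)).1 = 0
  norm : ∀ z ∈ U', c ^ 2 * pair (V (f z)).2.1 (sharp (G (f z)) (V (f z)).2.1) = 1

/-- `G'` is the metric induced by `G` on the hypersurface `f`. -/
def IsInducedMetric (G : Euc (n + 1) → Matrix (Fin (n + 1)) (Fin (n + 1)) ℝ) (s' U' : Set (Euc n))
    (f : Euc n → Euc (n + 1)) (G' : Euc n → Matrix (Fin n) (Fin n) ℝ) : Prop :=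
  ∀ z ∈ U', ∀ i j, G' z i j = metricBil (G (f z)) (fderivWithin ℝ f s' z (basisVec i))
    (fderivWithin ℝ f s' z (basisVec j))

theorem bil_comp {d : ℕ} (B : Euc d →L[ℝ] Euc d →L[ℝ] ℝ) (L : Euc n →L[ℝ] Euc d) (x y : Euc n) :
    bil (fun i j => B (L (basisVec i)) (L (basisVec j))) x y = B (L x) (L y) := by
  rw [bil_apply, clm_eq_sum L x, clm_eq_sum L y]
  simp only [map_sum, map_smul, _root_.sum_apply, _root_.smul_apply, smul_eq_mul, Finset.mul_sum]
  rw [Finset.sum_comm]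
  exact Finset.sum_congr rfl fun _ _ => Finset.sum_congr rfl fun _ _ => by ring

theorem IsInducedMetric.metricBil_eq (hG' : IsInducedMetric G s' U' f G') (hz : z ∈ U')
    (x y : Euc n) : metricBil (G' z) x y =
      metricBil (G (f z)) (fderivWithin ℝ f s' z x) (fderivWithin ℝ f s' z y) := by
  rw [← bil_comp]
  refine congrArg (fun c : Fin n → Fin n → ℝ => bil c x y) ?_
  funext i j
  exact hG' z hz i j

namespace IsHypersurfaceChart


theorem contDiffOn_fderivWithin (h : IsHypersurfaceChart s U G V s' U' f c) :
    ContDiffOn ℝ ∞ (fderivWithin ℝ f s') U' :=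
  h.dom.contDiffOn_fderivWithin h.smooth (by simp)

theorem contDiffOn_fderivWithin_apply (h : IsHypersurfaceChart s U G V s' U' f c) (u : Euc n) :
    ContDiffOn ℝ ∞ (fun y => fderivWithin ℝ f s' y u) U' :=
  h.contDiffOn_fderivWithin.clm_apply contDiffOn_const

theorem contDiffOn_comp_tractor (h : IsHypersurfaceChart s U G V s' U' f c) :
    ContDiffOn ℝ 2 (fun y => V (f y)) U' :=
  h.smooth_tractor.comp (h.smooth.of_le two_le_infty) h.mapsTo

theorem isMetricMatrix (h : IsHypersurfaceChart s U G V s' U' f c) (hz : z ∈ U') :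
    IsMetricMatrix (G (f z)) :=
  h.metric.metric _ (h.mapsTo hz)

theorem conn_smooth (h : IsHypersurfaceChart s U G V s' U' f c) :
    ContDiffOn ℝ ∞ (tractorConn s G (schoutenMatrix s G)) U :=
  h.metric.contDiffOn_tractorConn h.metric.isSmoothSymm_schoutenMatrix

/-- The induced metric is a smooth metric. -/
theorem isSmoothMetric (h : IsHypersurfaceChart s U G V s' U' f c)
    (hG' : IsInducedMetric G s' U' f G') : IsSmoothMetric s' U' G' where
  dom := h.dom
  smooth i j := by
    refine ContDiffOn.congr ?_ fun z hz => hG' z hz i j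
    exact ((h.metric.contDiffOn_metricBil.comp h.smooth h.mapsTo).clm_apply
      (h.contDiffOn_fderivWithin_apply _)).clm_apply (h.contDiffOn_fderivWithin_apply _)
  metric z hz := by
    refine ⟨fun i j => ?_, fun x hx => ?_⟩
    · rw [hG' z hz, hG' z hz, (h.isMetricMatrix hz).bil_comm]
    · rw [hG'.metricBil_eq hz]
      refine (h.isMetricMatrix hz).pos _ fun h0 => hx ?_
      exact h.injective z hz (by rw [h0, map_zero])

/-- The tractor connection along the hypersurface. -/
def alongConn (s : Set (Euc (n + 1))) (G : Euc (n + 1) → Matrix (Fin (n + 1)) (Fin (n + 1)) ℝ)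
    (s' : Set (Euc n)) (f : Euc n → Euc (n + 1)) :
    Euc n → Euc n →L[ℝ] TractorCoords (n + 1) →L[ℝ] TractorCoords (n + 1) :=
  pullbackForm s' f (tractorConn s G (schoutenMatrix s G))

theorem alongConn_apply (u : Euc n) : alongConn s G s' f z u =
    tractorConn s G (schoutenMatrix s G) (f z) (fderivWithin ℝ f s' z u) := rfl

theorem contDiffOn_alongConn (h : IsHypersurfaceChart s U G V s' U' f c) :
    ContDiffOn ℝ ∞ (alongConn s G s' f) U' :=
  contDiffOn_pullbackForm h.dom h.smooth h.mapsTo h.conn_smooth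

theorem curv_alongConn (h : IsHypersurfaceChart s U G V s' U' f c) (hz : z ∈ U') (u v : Euc n) :
    curv s' (alongConn s G s' f) z u v = curv s (tractorConn s G (schoutenMatrix s G)) (f z)
      (fderivWithin ℝ f s' z u) (fderivWithin ℝ f s' z v) :=
  curv_pullbackForm h.metric.dom h.dom h.smooth h.mapsTo h.conn_smooth hz u v

theorem cderiv_alongConn (h : IsHypersurfaceChart s U G V s' U' f c) (hz : z ∈ U') (u : Euc n) :
    cderiv s' (alongConn s G s' f) u (fun y => V (f y)) z = 0 := by
  rw [alongConn, cderiv_pullbackForm h.metric.dom h.dom h.smooth h.mapsTo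
    (h.smooth_tractor.of_le (by norm_num)) hz, h.parallel _ (h.mapsTo hz)]

theorem fderivWithin_comp_tractor (h : IsHypersurfaceChart s U G V s' U' f c) (hz : z ∈ U')
    (u : Euc n) : fderivWithin ℝ (fun y => V (f y)) s' z u =
      -tractorConn s G (schoutenMatrix s G) (f z) (fderivWithin ℝ f s' z u) (V (f z)) :=
  eq_neg_of_add_eq_zero_left (h.cderiv_alongConn hz u)

/-- The tractor connection along the hypersurface is metric. -/
theorem isMetricConnection_alongConn (h : IsHypersurfaceChart s U G V s' U' f c) :
    IsMetricConnection s' U' (alongConn s G s' f) (fun y => tractorBil (G (f y))) := by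
  intro z hz u t t'
  have h1 : ContDiffOn ℝ 1 (fun y => tractorBil (G y) t t') U :=
    ((h.metric.contDiffOn_tractorBil.clm_apply contDiffOn_const).clm_apply contDiffOn_const).of_le
      (by simp)
  rw [h.metric.dom.fderivWithin_comp h.dom (h.smooth.of_le (by simp)) h.mapsTo h1 hz]
  exact h.metric.isMetricConnection_tractorConn _ (h.mapsTo hz) _ t t'

theorem pair_tangent (h : IsHypersurfaceChart s U G V s' U' f c) (hz : z ∈ U') (u : Euc n) :
    pair (V (f z)).2.1 (fderivWithin ℝ f s' z u) = 0 := by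
  have h1 := h.dom.fderivWithin_clm (ContinuousLinearMap.fst ℝ ℝ ((Fin (n + 1) → ℝ) × ℝ))
    h.contDiffOn_comp_tractor (by norm_num) hz u
  rw [h.fderivWithin_comp_tractor hz, h.dom.fderivWithin_congr
    (f₁ := fun y => ContinuousLinearMap.fst ℝ ℝ ((Fin (n + 1) → ℝ) × ℝ) (V (f y)))
    (f₂ := fun _ => 0) (fun y hy => h.zero y hy) hz] at h1
  have h2 : ContinuousLinearMap.fst ℝ ℝ ((Fin (n + 1) → ℝ) × ℝ)
      (-tractorConn s G (schoutenMatrix s G) (f z) (fderivWithin ℝ f s' z u) (V (f z))) =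
      pair (V (f z)).2.1 (fderivWithin ℝ f s' z u) := by
    change -(tractorConn s G (schoutenMatrix s G) (f z) (fderivWithin ℝ f s' z u) (V (f z))).1 = _
    rw [tractorConn_fst, neg_neg]
  rw [h2] at h1
  rw [h1]
  simp

theorem fderivWithin_bottom (h : IsHypersurfaceChart s U G V s' U' f c) (hz : z ∈ U') (u : Euc n) :
    fderivWithin ℝ (fun y => (V (f y)).2.2) s' z u =
      metricBil (schoutenMatrix s G (f z)) (fderivWithin ℝ f s' z u)
        (sharp (G (f z)) (V (f z)).2.1) := by
  have h1 := h.dom.fderivWithin_clm ((ContinuousLinearMap.snd ℝ (Fin (n + 1) → ℝ) ℝ).comp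
    (ContinuousLinearMap.snd ℝ ℝ ((Fin (n + 1) → ℝ) × ℝ))) h.contDiffOn_comp_tractor
    (by norm_num) hz u
  refine h1.symm.trans ?_
  rw [h.fderivWithin_comp_tractor hz]
  change -(tractorConn s G (schoutenMatrix s G) (f z) (fderivWithin ℝ f s' z u) (V (f z))).2.2 = _
  rw [tractorConn_snd_snd, neg_neg]

/-- The ambient covariant derivative of the coordinate vector fields of the hypersurface. -/
def secondDeriv (s : Set (Euc (n + 1))) (G : Euc (n + 1) → Matrix (Fin (n + 1)) (Fin (n + 1)) ℝ)
    (s' : Set (Euc n)) (f : Euc n → Euc (n + 1)) (z u v : Euc n) : Euc (n + 1) :=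
  fderivWithin ℝ (fderivWithin ℝ f s') s' z u v
    + christoffelMap s G (f z) (fderivWithin ℝ f s' z u) (fderivWithin ℝ f s' z v)

/-- The normal component of the second derivative: the hypersurface is totally umbilic. -/
theorem pair_secondDeriv (h : IsHypersurfaceChart s U G V s' U' f c) (hz : z ∈ U') (u v : Euc n) :
    pair (V (f z)).2.1 (secondDeriv s G s' f z u v) = (V (f z)).2.2 *
      metricBil (G (f z)) (fderivWithin ℝ f s' z u) (fderivWithin ℝ f s' z v) := by
  let L := pair.comp ((ContinuousLinearMap.fst ℝ (Fin (n + 1) → ℝ) ℝ).comp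
    (ContinuousLinearMap.snd ℝ ℝ ((Fin (n + 1) → ℝ) × ℝ)))
  have hL : ContDiffOn ℝ 2 (fun y => L (V (f y))) U' :=
    contDiffOn_const.clm_apply h.contDiffOn_comp_tractor
  have h1 := h.dom.fderivWithin_apply hL (by norm_num)
    (h.contDiffOn_fderivWithin_apply v) (by simp) hz u
  rw [h.dom.fderivWithin_congr (f₁ := fun y => L (V (f y)) (fderivWithin ℝ f s' y v))
    (f₂ := fun _ => 0) (fun y hy => h.pair_tangent hy v) hz,
    ← h.dom.fderivWithin_clm L h.contDiffOn_comp_tractor (by norm_num) hz,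
    h.fderivWithin_comp_tractor hz,
    h.dom.fderivWithin_apply_const h.contDiffOn_fderivWithin (by simp) hz] at h1
  have h2 : L (-tractorConn s G (schoutenMatrix s G) (f z) (fderivWithin ℝ f s' z u) (V (f z)))
      (fderivWithin ℝ f s' z v) = pair (V (f z)).2.1 (christoffelMap s G (f z)
        (fderivWithin ℝ f s' z u) (fderivWithin ℝ f s' z v)) - (V (f z)).2.2 *
        metricBil (G (f z)) (fderivWithin ℝ f s' z u) (fderivWithin ℝ f s' z v) := by
    rw [map_neg, _root_.neg_apply]
    change -pair (tractorConn s G (schoutenMatrix s G) (f z) (fderivWithin ℝ f s' z u)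
      (V (f z))).2.1 (fderivWithin ℝ f s' z v) = _
    rw [pair_tractorConn, h.zero z hz]
    ring
  rw [h2] at h1
  simp only [fderivWithin_fun_const, Pi.zero_apply, _root_.zero_apply] at h1
  rw [secondDeriv, map_add]
  change (0 : ℝ) = _ + pair (V (f z)).2.1 _ at h1
  linarith

/-- A vector orthogonal to the hypersurface and to its conormal vanishes. -/
theorem eq_zero_of_orthogonal (h : IsHypersurfaceChart s U G V s' U' f c) (hz : z ∈ U')
    {y : Euc (n + 1)} (h1 : ∀ w, metricBil (G (f z)) y (fderivWithin ℝ f s' z w) = 0)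
    (h2 : pair (V (f z)).2.1 y = 0) : y = 0 := by
  have hμ : pair (V (f z)).2.1 ≠ 0 := by
    intro h0
    have := h.norm z hz
    rw [h0] at this
    simp at this
  have hle : LinearMap.range (fderivWithin ℝ f s' z).toLinearMap ≤
      LinearMap.ker (pair (V (f z)).2.1).toLinearMap := by
    rintro _ ⟨w, rfl⟩
    exact h.pair_tangent hz w
  have hr : Module.finrank ℝ (LinearMap.range (fderivWithin ℝ f s' z).toLinearMap) = n := by
    rw [LinearMap.finrank_range_of_inj (h.injective z hz)]
    simp
  have hk : Module.finrank ℝ (LinearMap.ker (pair (V (f z)).2.1).toLinearMap) = n := by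
    have h3 := Module.Dual.finrank_ker_add_one_of_ne_zero
      (f := (pair (V (f z)).2.1).toLinearMap) (fun h0 => hμ (by
        ext w
        exact congrArg (fun L : Euc (n + 1) →ₗ[ℝ] ℝ => L w) h0))
    simp at h3
    exact h3
  have heq := Submodule.eq_of_le_of_finrank_eq hle (hr.trans hk.symm)
  have hy : y ∈ LinearMap.range (fderivWithin ℝ f s' z).toLinearMap := by
    rw [heq]
    exact h2
  obtain ⟨w, rfl⟩ := hy
  by_contra h0
  exact ((h.isMetricMatrix hz).pos _ h0).ne' (h1 w)

theorem eq_of_orthogonal (h : IsHypersurfaceChart s U G V s' U' f c) (hz : z ∈ U')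
    {y y' : Euc (n + 1)} (h1 : ∀ w, metricBil (G (f z)) y (fderivWithin ℝ f s' z w) =
      metricBil (G (f z)) y' (fderivWithin ℝ f s' z w))
    (h2 : pair (V (f z)).2.1 y = pair (V (f z)).2.1 y') : y = y' := by
  refine sub_eq_zero.1 (h.eq_zero_of_orthogonal hz (fun w => ?_) ?_)
  · rw [map_sub, _root_.sub_apply, h1, sub_self]
  · rw [map_sub, h2, sub_self]

theorem metricBil_sharp_tangent (h : IsHypersurfaceChart s U G V s' U' f c) (hz : z ∈ U')
    (w : Euc n) : metricBil (G (f z)) (sharp (G (f z)) (V (f z)).2.1) (fderivWithin ℝ f s' z w)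
      = 0 := by
  rw [(h.isMetricMatrix hz).bil_sharp, h.pair_tangent hz]

/-- The decomposition of a vector into its tangential and normal components. -/
theorem decomp (h : IsHypersurfaceChart s U G V s' U' f c) (hG' : IsInducedMetric G s' U' f G')
    (hz : z ∈ U') {y : Euc (n + 1)} {p : Euc n}
    (hp : ∀ w, metricBil (G' z) p w = metricBil (G (f z)) y (fderivWithin ℝ f s' z w)) :
    y = fderivWithin ℝ f s' z p
      + (c ^ 2 * pair (V (f z)).2.1 y) • sharp (G (f z)) (V (f z)).2.1 := by
  refine h.eq_of_orthogonal hz (fun w => ?_) ?_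
  · rw [map_add, _root_.add_apply, map_smul, _root_.smul_apply, h.metricBil_sharp_tangent hz, ← hp,
      hG'.metricBil_eq hz]
    simp
  · rw [map_add, map_smul, h.pair_tangent hz, smul_eq_mul]
    linear_combination -pair (V (f z)).2.1 y * h.norm z hz

/-- The Gauss formula. -/
theorem metricBil_secondDeriv (h : IsHypersurfaceChart s U G V s' U' f c)
    (hG' : IsInducedMetric G s' U' f G') (hz : z ∈ U') (u v w : Euc n) :
    metricBil (G (f z)) (secondDeriv s G s' f z u v) (fderivWithin ℝ f s' z w) =
      metricBil (G' z) (christoffelMap s' G' z u v) w := by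
  have hM := h.isMetricMatrix hz
  have hS := h.isSmoothMetric hG'
  have hsymm : ∀ u v, secondDeriv s G s' f z u v = secondDeriv s G s' f z v u := fun u v => by
    rw [secondDeriv, secondDeriv, h.dom.fderivWithin_comm (h.smooth.of_le two_le_infty) hz,
      h.metric.christoffelMap_comm (h.mapsTo hz)]
  have key : ∀ u v w, fderivWithin ℝ (fun y => metricBil (G' y) v w) s' z u =
      metricBil (G (f z)) (secondDeriv s G s' f z u v) (fderivWithin ℝ f s' z w)
        + metricBil (G (f z)) (fderivWithin ℝ f s' z v) (secondDeriv s G s' f z u w) := by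
    intro u v w
    have hb : ContDiffOn ℝ 1 (fun y => metricBil (G (f y))) U' :=
      (h.metric.contDiffOn_metricBil.comp h.smooth h.mapsTo).of_le (by simp)
    have h1 : ∀ v, ContDiffOn ℝ 1 (fun y => fderivWithin ℝ f s' y v) U' := fun v =>
      (h.contDiffOn_fderivWithin_apply v).of_le (by simp)
    rw [h.dom.fderivWithin_congr (fun y hy => hG'.metricBil_eq hy v w) hz,
      h.dom.fderivWithin_bilin hb (h1 v) (h1 w) hz,
      h.dom.fderivWithin_apply_const h.contDiffOn_fderivWithin (by simp) hz,
      h.dom.fderivWithin_apply_const h.contDiffOn_fderivWithin (by simp) hz]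
    have h2 : ContDiffOn ℝ 1 (fun y => metricBil (G y) (fderivWithin ℝ f s' z v)
        (fderivWithin ℝ f s' z w)) U :=
      ((h.metric.contDiffOn_metricBil.clm_apply contDiffOn_const).clm_apply contDiffOn_const).of_le
        (by simp)
    rw [h.metric.dom.fderivWithin_comp h.dom (h.smooth.of_le (by simp)) h.mapsTo h2 hz,
      h.metric.isMetricConnection_christoffelMap _ (h.mapsTo hz), secondDeriv, secondDeriv,
      map_add, map_add, _root_.add_apply]
    ring
  rw [hS.metricBil_christoffelMap hz, key, key, key, hsymm v u, hsymm w u, hsymm w v,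
    hM.bil_comm (fderivWithin ℝ f s' z v), hM.bil_comm (fderivWithin ℝ f s' z u)]
  ring

/-- The second derivative in terms of the induced connection and the normal vector. -/
theorem secondDeriv_eq (h : IsHypersurfaceChart s U G V s' U' f c)
    (hG' : IsInducedMetric G s' U' f G') (hz : z ∈ U') (u v : Euc n) :
    secondDeriv s G s' f z u v = fderivWithin ℝ f s' z (christoffelMap s' G' z u v)
      + (c ^ 2 * (V (f z)).2.2 * metricBil (G' z) u v) • sharp (G (f z)) (V (f z)).2.1 := by
  have h1 := h.decomp hG' hz (y := secondDeriv s G s' f z u v) (p := christoffelMap s' G' z u v)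
    fun w => (h.metricBil_secondDeriv hG' hz u v w).symm
  rw [h.pair_secondDeriv hz, ← hG'.metricBil_eq hz] at h1
  rw [mul_assoc]
  exact h1

end IsHypersurfaceChart

end HypersurfaceChart

section Parallel

variable {E T : Type*} [NormedAddCommGroup E] [NormedSpace ℝ E] [NormedAddCommGroup T]
  [NormedSpace ℝ T] {s U : Set E} {A : E → E →L[ℝ] T →L[ℝ] T}

/-- Parallel sections are smooth. -/
theorem contDiffOn_of_parallel [FiniteDimensional ℝ E] (h : IsChartDomain s U) (hA : ContDiffOn ℝ ∞ A U) {V : E → T}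
    (hV : ContDiffOn ℝ 1 V U) (hp : ∀ z ∈ U, ∀ u, cderiv s A u V z = 0) : ContDiffOn ℝ ∞ V U := by
  have hU : ∀ z ∈ U, s ∩ U ∈ 𝓝[s] z := fun z hz => inter_mem self_mem_nhdsWithin (h.mem_nhdsWithin z hz)
  have hUD : UniqueDiffOn ℝ U := fun z hz =>
    (h.uniqueDiffWithinAt hz).mono_nhds (nhdsWithin_le_iff.2 (h.mem_nhdsWithin z hz))
  have hD : ∀ z ∈ U, fderivWithin ℝ V U z = -(A z).flip (V z) := fun z hz => by
    ext u
    rw [((h.hasFDerivWithinAt hV one_ne_zero hz).mono h.subset).fderivWithin (hUD z hz)]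
    exact eq_neg_of_add_eq_zero_left (hp z hz u)
  rw [contDiffOn_infty]
  intro m
  induction m with
  | zero => exact hV.of_le (by simp)
  | succ m ih =>
    refine (contDiffOn_succ_iff_fderivWithin (n := (m : ℕ∞ω)) hUD).2
      ⟨hV.differentiableOn one_ne_zero, fun h0 => absurd h0 (by simp), ?_⟩
    have hA' : ContDiffOn ℝ m (fun z => -(A z).flip (V z)) U := by
      rw [contDiffOn_clm_apply]
      intro u
      have hm : (m : ℕ∞ω) ≤ ∞ := WithTop.coe_le_coe.2 (le_top : (m : ℕ∞) ≤ ⊤)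
      exact (((hA.of_le hm).clm_apply contDiffOn_const).clm_apply ih).neg
    exact hA'.congr hD

theorem IsChartDomain.cderiv_congr (h : IsChartDomain s U) {V W : E → T} (hVW : EqOn V W U) {z : E}
    (hz : z ∈ U) (u : E) : cderiv s A u V z = cderiv s A u W z := by
  rw [cderiv, cderiv, h.fderivWithin_congr hVW hz, hVW hz]

end Parallel

section HypersurfaceChart

variable {n : ℕ} {s U : Set (Euc (n + 1))} {G : Euc (n + 1) → Matrix (Fin (n + 1)) (Fin (n + 1)) ℝ}
  {V : Euc (n + 1) → TractorCoords (n + 1)} {s' U' : Set (Euc n)} {f : Euc n → Euc (n + 1)} {c : ℝ}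
  {G' : Euc n → Matrix (Fin n) (Fin n) ℝ} {z : Euc n}

/-- The restriction of covectors to the hypersurface. -/
def restrictCov (s' : Set (Euc n)) (f : Euc n → Euc (n + 1)) (z : Euc n) :
    (Fin (n + 1) → ℝ) →L[ℝ] (Fin n → ℝ) :=
  ContinuousLinearMap.pi fun i => pair.flip (fderivWithin ℝ f s' z (basisVec i))

theorem pair_restrictCov (m : Fin (n + 1) → ℝ) (u : Euc n) :
    pair (restrictCov s' f z m) u = pair m (fderivWithin ℝ f s' z u) :=
  pair_clm ((pair m).comp (fderivWithin ℝ f s' z)) u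

/-- The map from ambient tractors to tractors of the hypersurface, which on the tractors
orthogonal to `V` is the canonical isomorphism. The mean curvature is `-c ρ`. -/
def toIntrinsicMap (V : Euc (n + 1) → TractorCoords (n + 1)) (s' : Set (Euc n))
    (f : Euc n → Euc (n + 1)) (c : ℝ) (z : Euc n) : TractorCoords (n + 1) →L[ℝ] TractorCoords n :=
  (ContinuousLinearMap.fst ℝ ℝ ((Fin (n + 1) → ℝ) × ℝ)).prod
    (((restrictCov s' f z).comp ((ContinuousLinearMap.fst ℝ (Fin (n + 1) → ℝ) ℝ).comp
      (ContinuousLinearMap.snd ℝ ℝ ((Fin (n + 1) → ℝ) × ℝ)))).prod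
    ((ContinuousLinearMap.snd ℝ (Fin (n + 1) → ℝ) ℝ).comp
      (ContinuousLinearMap.snd ℝ ℝ ((Fin (n + 1) → ℝ) × ℝ)) +
      (1 / 2 * (c * (V (f z)).2.2) ^ 2) • ContinuousLinearMap.fst ℝ ℝ ((Fin (n + 1) → ℝ) × ℝ)))

theorem toIntrinsicMap_apply (t : TractorCoords (n + 1)) : toIntrinsicMap V s' f c z t =
    (t.1, restrictCov s' f z t.2.1, t.2.2 + 1 / 2 * (c * (V (f z)).2.2) ^ 2 * t.1) := rfl

/-- The Schouten tensor of the hypersurface according to the Gauss equation. -/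
def gaussSchouten (s : Set (Euc (n + 1))) (G : Euc (n + 1) → Matrix (Fin (n + 1)) (Fin (n + 1)) ℝ)
    (V : Euc (n + 1) → TractorCoords (n + 1)) (s' : Set (Euc n)) (f : Euc n → Euc (n + 1)) (c : ℝ)
    (z : Euc n) : Matrix (Fin n) (Fin n) ℝ :=
  Matrix.of fun i j => metricBil (schoutenMatrix s G (f z)) (fderivWithin ℝ f s' z (basisVec i))
      (fderivWithin ℝ f s' z (basisVec j)) +
    1 / 2 * (c * (V (f z)).2.2) ^ 2 * metricBil (G (f z)) (fderivWithin ℝ f s' z (basisVec i))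
      (fderivWithin ℝ f s' z (basisVec j))

theorem metricBil_gaussSchouten (u v : Euc n) : metricBil (gaussSchouten s G V s' f c z) u v =
    metricBil (schoutenMatrix s G (f z)) (fderivWithin ℝ f s' z u) (fderivWithin ℝ f s' z v) +
      1 / 2 * (c * (V (f z)).2.2) ^ 2 *
        metricBil (G (f z)) (fderivWithin ℝ f s' z u) (fderivWithin ℝ f s' z v) := by
  have h1 := bil_comp (metricBil (schoutenMatrix s G (f z)) +
    (1 / 2 * (c * (V (f z)).2.2) ^ 2) • metricBil (G (f z))) (fderivWithin ℝ f s' z) u v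
  simp only [_root_.add_apply, _root_.smul_apply, smul_eq_mul] at h1
  rw [← h1]
  refine congrArg (fun b : Fin n → Fin n → ℝ => bil b u v) ?_
  funext i j
  rfl

/-- The projection onto the orthogonal complement of `V`. -/
def normalProj (G : Euc (n + 1) → Matrix (Fin (n + 1)) (Fin (n + 1)) ℝ)
    (V : Euc (n + 1) → TractorCoords (n + 1)) (f : Euc n → Euc (n + 1)) (c : ℝ) (z : Euc n)
    (t : TractorCoords (n + 1)) : TractorCoords (n + 1) :=
  t - (c ^ 2 * tractorBil (G (f z)) t (V (f z))) • V (f z)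

namespace IsHypersurfaceChart

theorem contDiffOn_tractor (h : IsHypersurfaceChart s U G V s' U' f c) : ContDiffOn ℝ ∞ V U :=
  contDiffOn_of_parallel h.metric.dom h.conn_smooth (h.smooth_tractor.of_le (by norm_num)) h.parallel

theorem contDiffOn_tractor_comp (h : IsHypersurfaceChart s U G V s' U' f c) :
    ContDiffOn ℝ ∞ (fun y => V (f y)) U' :=
  h.contDiffOn_tractor.comp h.smooth h.mapsTo

theorem contDiffOn_bottom (h : IsHypersurfaceChart s U G V s' U' f c) :
    ContDiffOn ℝ ∞ (fun y => (V (f y)).2.2) U' :=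
  h.contDiffOn_tractor_comp.snd.snd

theorem contDiffOn_tractorBil_comp (h : IsHypersurfaceChart s U G V s' U' f c) :
    ContDiffOn ℝ ∞ (fun y => tractorBil (G (f y))) U' :=
  h.metric.contDiffOn_tractorBil.comp h.smooth h.mapsTo

theorem contDiffOn_restrictCov (h : IsHypersurfaceChart s U G V s' U' f c) :
    ContDiffOn ℝ ∞ (restrictCov s' f) U' := by
  rw [contDiffOn_clm_apply]
  intro m
  refine contDiffOn_pi.2 fun i => ?_
  exact contDiffOn_const.clm_apply (h.contDiffOn_fderivWithin_apply (basisVec i))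

theorem contDiffOn_toIntrinsicMap (h : IsHypersurfaceChart s U G V s' U' f c) :
    ContDiffOn ℝ ∞ (toIntrinsicMap V s' f c) U' := by
  rw [contDiffOn_clm_apply]
  intro t
  exact contDiffOn_const.prodMk ((h.contDiffOn_restrictCov.clm_apply contDiffOn_const).prodMk
    (contDiffOn_const.add ((contDiffOn_const.mul
      ((contDiffOn_const.mul h.contDiffOn_bottom).pow 2)).mul contDiffOn_const)))

theorem isSmoothSymm_gaussSchouten (h : IsHypersurfaceChart s U G V s' U' f c) :
    IsSmoothSymm U' (gaussSchouten s G V s' f c) where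
  smooth i j := by
    have h1 := h.contDiffOn_fderivWithin_apply
    have h2 : ContDiffOn ℝ ∞ (fun y => metricBil (schoutenMatrix s G (f y))) U' :=
      (contDiffOn_bil h.metric.isSmoothSymm_schoutenMatrix.smooth).comp h.smooth h.mapsTo
    have h3 : ContDiffOn ℝ ∞ (fun y => metricBil (G (f y))) U' :=
      h.metric.contDiffOn_metricBil.comp h.smooth h.mapsTo
    exact ((h2.clm_apply (h1 _)).clm_apply (h1 _)).add ((contDiffOn_const.mul
      ((contDiffOn_const.mul h.contDiffOn_bottom).pow 2)).mul ((h3.clm_apply (h1 _)).clm_apply (h1 _)))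
  symm z hz i j := by
    simp only [gaussSchouten, Matrix.of_apply]
    rw [(h.isMetricMatrix hz).bil_comm,
      bil_comm (h.metric.isSmoothSymm_schoutenMatrix.symm _ (h.mapsTo hz))]

theorem contDiffOn_normalProj (h : IsHypersurfaceChart s U G V s' U' f c) {W : Euc n → _}
    {m : ℕ∞ω} (hm : m ≤ ∞) (hW : ContDiffOn ℝ m W U') :
    ContDiffOn ℝ m (fun y => normalProj G V f c y (W y)) U' :=
  hW.sub ((contDiffOn_const.mul (((h.contDiffOn_tractorBil_comp.of_le hm).clm_apply hW).clm_apply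
    (h.contDiffOn_tractor_comp.of_le hm))).smul (h.contDiffOn_tractor_comp.of_le hm))

theorem tractorBil_self (h : IsHypersurfaceChart s U G V s' U' f c) (hz : z ∈ U') :
    c ^ 2 * tractorBil (G (f z)) (V (f z)) (V (f z)) = 1 := by
  rw [tractorBil_apply, h.zero z hz, ← h.norm z hz]
  ring

theorem tractorBil_normalProj (h : IsHypersurfaceChart s U G V s' U' f c) (hz : z ∈ U')
    (t : TractorCoords (n + 1)) : tractorBil (G (f z)) (normalProj G V f c z t) (V (f z)) = 0 := by
  rw [normalProj, map_sub, map_smul, _root_.sub_apply, _root_.smul_apply, smul_eq_mul]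
  linear_combination -tractorBil (G (f z)) t (V (f z)) * h.tractorBil_self hz

theorem normalProj_of_orthogonal {t : TractorCoords (n + 1)}
    (ht : tractorBil (G (f z)) t (V (f z)) = 0) : normalProj G V f c z t = t := by
  rw [normalProj, ht]
  simp

/-- The tractor connection along the hypersurface preserves the complement of `V`. -/
theorem tractorBil_cderiv (h : IsHypersurfaceChart s U G V s' U' f c) (hz : z ∈ U')
    {W : Euc n → TractorCoords (n + 1)} (hW : ContDiffOn ℝ 1 W U')
    (hW0 : ∀ y ∈ U', tractorBil (G (f y)) (W y) (V (f y)) = 0) (u : Euc n) :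
    tractorBil (G (f z)) (cderiv s' (alongConn s G s' f) u W z) (V (f z)) = 0 := by
  have h1 := IsMetricConnection.fderivWithin_eq h.dom h.isMetricConnection_alongConn
    (h.contDiffOn_tractorBil_comp.of_le (by simp)) hW
    (h.contDiffOn_tractor_comp.of_le (by simp)) hz u
  rw [h.cderiv_alongConn hz, h.dom.fderivWithin_congr (f₂ := fun _ => (0 : ℝ))
    (fun y hy => hW0 y hy) hz] at h1
  simpa using h1.symm

/-- The canonical isomorphism intertwines the tractor connection along the hypersurface with the
connection of the induced metric. -/
theorem cderiv_toIntrinsicMap (h : IsHypersurfaceChart s U G V s' U' f c)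
    (hG' : IsInducedMetric G s' U' f G') (hz : z ∈ U') {W : Euc n → TractorCoords (n + 1)}
    (hW : ContDiffOn ℝ 1 W U') (hW0 : tractorBil (G (f z)) (W z) (V (f z)) = 0) (u : Euc n) :
    cderiv s' (tractorConn s' G' (gaussSchouten s G V s' f c)) u
      (fun y => toIntrinsicMap V s' f c y (W y)) z =
      toIntrinsicMap V s' f c z (cderiv s' (alongConn s G s' f) u W z) := by
  have hM := h.isMetricMatrix hz
  have hM' := (h.isSmoothMetric hG').metric z hz
  have hΨ : ContDiffOn ℝ 1 (fun y => toIntrinsicMap V s' f c y (W y)) U' :=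
    (h.contDiffOn_toIntrinsicMap.of_le (by simp)).clm_apply hW
  have ho : pair (W z).2.1 (sharp (G (f z)) (V (f z)).2.1) + (W z).1 * (V (f z)).2.2 = 0 := by
    rw [tractorBil_apply, h.zero z hz] at hW0
    linear_combination hW0
  have e1 := fun u => h.dom.fderivWithin_clm
    (ContinuousLinearMap.fst ℝ ℝ ((Fin n → ℝ) × ℝ)) hΨ one_ne_zero hz u
  have e1' := fun u => h.dom.fderivWithin_clm
    (ContinuousLinearMap.fst ℝ ℝ ((Fin (n + 1) → ℝ) × ℝ)) hW one_ne_zero hz u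
  rw [alongConn, cderiv, cderiv]
  refine Prod.ext ?_ (Prod.ext (pair_ext fun v => ?_) ?_)
  · change ContinuousLinearMap.fst ℝ ℝ ((Fin n → ℝ) × ℝ) _ + (tractorConn s' G' _ z u _).1 =
      ContinuousLinearMap.fst ℝ ℝ ((Fin (n + 1) → ℝ) × ℝ) (fderivWithin ℝ W s' z u) +
        (tractorConn s G _ (f z) (fderivWithin ℝ f s' z u) (W z)).1
    rw [e1, e1', tractorConn_fst, tractorConn_fst, toIntrinsicMap_apply, pair_restrictCov]
    rfl
  · let L' := pair.flip.comp (ContinuousLinearMap.id ℝ (Euc n))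
    have e2 := h.dom.fderivWithin_clm ((pair.flip v).comp
      ((ContinuousLinearMap.fst ℝ (Fin n → ℝ) ℝ).comp
        (ContinuousLinearMap.snd ℝ ℝ ((Fin n → ℝ) × ℝ)))) hΨ one_ne_zero hz u
    let L := pair.comp ((ContinuousLinearMap.fst ℝ (Fin (n + 1) → ℝ) ℝ).comp
      (ContinuousLinearMap.snd ℝ ℝ ((Fin (n + 1) → ℝ) × ℝ)))
    have hL : ContDiffOn ℝ 1 (fun y => L (W y)) U' := contDiffOn_const.clm_apply hW
    have e3 := h.dom.fderivWithin_apply hL one_ne_zero (h.contDiffOn_fderivWithin_apply v)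
      (by simp) hz u
    rw [← h.dom.fderivWithin_clm L hW one_ne_zero hz,
      h.dom.fderivWithin_apply_const h.contDiffOn_fderivWithin (by simp) hz] at e3
    have e4 : fderivWithin ℝ (fun y => ((pair.flip v).comp
      ((ContinuousLinearMap.fst ℝ (Fin n → ℝ) ℝ).comp
        (ContinuousLinearMap.snd ℝ ℝ ((Fin n → ℝ) × ℝ)))) (toIntrinsicMap V s' f c y (W y))) s' z =
        fderivWithin ℝ (fun y => L (W y) (fderivWithin ℝ f s' y v)) s' z := by
      congr 1
      funext y
      exact pair_restrictCov _ _
    rw [e4, e3] at e2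
    have e5 := h.secondDeriv_eq hG' hz u v
    rw [secondDeriv] at e5
    have e6 := congrArg (pair (W z).2.1) e5
    simp only [map_add, map_smul, smul_eq_mul] at e6
    change pair (fderivWithin ℝ (fun y => toIntrinsicMap V s' f c y (W y)) s' z u).2.1 v =
      pair (fderivWithin ℝ W s' z u).2.1 (fderivWithin ℝ f s' z v) +
        pair (W z).2.1 (fderivWithin ℝ (fderivWithin ℝ f s') s' z u v) at e2
    change pair ((fderivWithin ℝ (fun y => toIntrinsicMap V s' f c y (W y)) s' z u).2.1 +
      (tractorConn s' G' _ z u _).2.1) v = pair (restrictCov s' f z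
        ((fderivWithin ℝ W s' z u).2.1 +
          (tractorConn s G _ (f z) (fderivWithin ℝ f s' z u) (W z)).2.1)) v
    rw [pair_restrictCov, map_add, map_add, _root_.add_apply, _root_.add_apply, e2,
      pair_tractorConn, pair_tractorConn, metricBil_gaussSchouten, toIntrinsicMap_apply,
      pair_restrictCov, ← hG'.metricBil_eq hz]
    linear_combination e6 + c ^ 2 * (V (f z)).2.2 * metricBil (G' z) u v * ho
  · have e2 := h.dom.fderivWithin_clm ((ContinuousLinearMap.snd ℝ (Fin n → ℝ) ℝ).comp
        (ContinuousLinearMap.snd ℝ ℝ ((Fin n → ℝ) × ℝ))) hΨ one_ne_zero hz u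
    have e3 := h.dom.fderivWithin_clm ((ContinuousLinearMap.snd ℝ (Fin (n + 1) → ℝ) ℝ).comp
        (ContinuousLinearMap.snd ℝ ℝ ((Fin (n + 1) → ℝ) × ℝ))) hW one_ne_zero hz u
    have d1 := h.dom.hasFDerivWithinAt hW one_ne_zero hz
    have d2 := h.dom.hasFDerivWithinAt h.contDiffOn_bottom (by simp) hz
    have d3 := (d1.snd.snd.add ((((d2.const_mul c).pow 2).const_mul (1 / 2)).mul d1.fst))
    have e4 : fderivWithin ℝ (fun y => ((ContinuousLinearMap.snd ℝ (Fin n → ℝ) ℝ).comp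
        (ContinuousLinearMap.snd ℝ ℝ ((Fin n → ℝ) × ℝ))) (toIntrinsicMap V s' f c y (W y))) s' z u =
        (fderivWithin ℝ W s' z u).2.2 + (1 / 2 * (c * (V (f z)).2.2) ^ 2 *
          (fderivWithin ℝ W s' z u).1 + c ^ 2 * (V (f z)).2.2 *
          metricBil (schoutenMatrix s G (f z)) (fderivWithin ℝ f s' z u)
        (sharp (G (f z)) (V (f z)).2.1) * (W z).1) := by
      rw [← h.fderivWithin_bottom hz]
      refine (congrArg (fun L => L u) (h.dom.fderivWithin_eq hz d3)).trans ?_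
      simp
      ring
    rw [e4] at e2
    let p := sharp (G' z) (restrictCov s' f z (W z).2.1)
    have hp1 : ∀ w, metricBil (G' z) p w = pair (W z).2.1 (fderivWithin ℝ f s' z w) := fun w => by
      rw [hM'.bil_sharp, pair_restrictCov]
    have hp := h.decomp hG' hz (y := sharp (G (f z)) (W z).2.1) (p := p)
      fun w => by rw [hM.bil_sharp, hp1]
    have hp2 := congrArg (metricBil (schoutenMatrix s G (f z)) (fderivWithin ℝ f s' z u)) hp
    have hp3 := hp1 u
    rw [hM'.bil_comm, hG'.metricBil_eq hz] at hp3
    simp only [map_add, map_smul, smul_eq_mul] at hp2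
    rw [hM.pair_sharp_comm] at hp2
    change (fderivWithin ℝ (fun y => toIntrinsicMap V s' f c y (W y)) s' z u).2.2 = _ at e2
    change (fderivWithin ℝ (fun y => toIntrinsicMap V s' f c y (W y)) s' z u).2.2 +
      (tractorConn s' G' _ z u _).2.2 = ((fderivWithin ℝ W s' z u).2.2 +
          (tractorConn s G _ (f z) (fderivWithin ℝ f s' z u) (W z)).2.2) +
        1 / 2 * (c * (V (f z)).2.2) ^ 2 * ((fderivWithin ℝ W s' z u).1 +
          (tractorConn s G _ (f z) (fderivWithin ℝ f s' z u) (W z)).1)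
    rw [e2, tractorConn_snd_snd, tractorConn_snd_snd, tractorConn_fst, metricBil_gaussSchouten,
      toIntrinsicMap_apply]
    change _ + -(metricBil (schoutenMatrix s G (f z)) (fderivWithin ℝ f s' z u)
      (fderivWithin ℝ f s' z p) + 1 / 2 * (c * (V (f z)).2.2) ^ 2 *
        metricBil (G (f z)) (fderivWithin ℝ f s' z u) (fderivWithin ℝ f s' z p)) = _
    linear_combination hp2 - 1 / 2 * (c * (V (f z)).2.2) ^ 2 * hp3 + c ^ 2 *
      metricBil (schoutenMatrix s G (f z)) (fderivWithin ℝ f s' z u)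
        (sharp (G (f z)) (V (f z)).2.1) * ho

end IsHypersurfaceChart

end HypersurfaceChart

section HypersurfaceChart

variable {n : ℕ} {s U : Set (Euc (n + 1))} {G : Euc (n + 1) → Matrix (Fin (n + 1)) (Fin (n + 1)) ℝ}
  {V : Euc (n + 1) → TractorCoords (n + 1)} {s' U' : Set (Euc n)} {f : Euc n → Euc (n + 1)} {c : ℝ}
  {G' : Euc n → Matrix (Fin n) (Fin n) ℝ} {z : Euc n}

namespace IsHypersurfaceChart

theorem cderiv_cderiv_alongConn (h : IsHypersurfaceChart s U G V s' U' f c) (hz : z ∈ U')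
    {W : Euc n → TractorCoords (n + 1)} (hW : ContDiffOn ℝ 2 W U') (u v : Euc n) :
    cderiv s' (alongConn s G s' f) u (cderiv s' (alongConn s G s' f) v W) z -
      cderiv s' (alongConn s G s' f) v (cderiv s' (alongConn s G s' f) u W) z =
      curv s (tractorConn s G (schoutenMatrix s G)) (f z) (fderivWithin ℝ f s' z u)
        (fderivWithin ℝ f s' z v) (W z) := by
  rw [cderiv_cderiv_sub h.dom h.contDiffOn_alongConn hW hz, h.curv_alongConn hz]

/-- The canonical isomorphism intertwines the curvatures. -/
theorem curv_toIntrinsicMap (h : IsHypersurfaceChart s U G V s' U' f c)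
    (hG' : IsInducedMetric G s' U' f G') (hz : z ∈ U') {t : TractorCoords (n + 1)}
    (ht : tractorBil (G (f z)) t (V (f z)) = 0) (u v : Euc n) :
    curv s' (tractorConn s' G' (gaussSchouten s G V s' f c)) z u v (toIntrinsicMap V s' f c z t) =
      toIntrinsicMap V s' f c z (curv s (tractorConn s G (schoutenMatrix s G)) (f z)
        (fderivWithin ℝ f s' z u) (fderivWithin ℝ f s' z v) t) := by
  let W : Euc n → TractorCoords (n + 1) := fun y => normalProj G V f c y t
  have hW : ContDiffOn ℝ 2 W U' := h.contDiffOn_normalProj two_le_infty contDiffOn_const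
  have hW0 : ∀ y ∈ U', tractorBil (G (f y)) (W y) (V (f y)) = 0 := fun y hy =>
    h.tractorBil_normalProj hy t
  have hWz : W z = t := normalProj_of_orthogonal ht
  have hΨ : ContDiffOn ℝ 2 (fun y => toIntrinsicMap V s' f c y (W y)) U' :=
    (h.contDiffOn_toIntrinsicMap.of_le two_le_infty).clm_apply hW
  have hA := (h.isSmoothMetric hG').contDiffOn_tractorConn h.isSmoothSymm_gaussSchouten
  have hW1 := hW.of_le one_le_two
  have key : ∀ u v, cderiv s' (tractorConn s' G' (gaussSchouten s G V s' f c)) u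
      (cderiv s' (tractorConn s' G' (gaussSchouten s G V s' f c)) v
        fun y => toIntrinsicMap V s' f c y (W y)) z = toIntrinsicMap V s' f c z
        (cderiv s' (alongConn s G s' f) u (cderiv s' (alongConn s G s' f) v W) z) := by
    intro u v
    rw [h.dom.cderiv_congr (fun y hy => h.cderiv_toIntrinsicMap hG' hy hW1 (hW0 y hy) v) hz]
    exact h.cderiv_toIntrinsicMap hG' hz
      (contDiffOn_cderiv h.dom h.contDiffOn_alongConn hW (by norm_num) (by simp) v)
      (h.tractorBil_cderiv hz hW1 hW0 v) u
  have h1 := cderiv_cderiv_sub h.dom hA hΨ hz u v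
  rw [key, key, ← map_sub, h.cderiv_cderiv_alongConn hz hW, hWz] at h1
  exact h1.symm

/-- The inverse metric in terms of the induced metric. -/
theorem sharp_eq (h : IsHypersurfaceChart s U G V s' U' f c) (hG' : IsInducedMetric G s' U' f G')
    (hz : z ∈ U') (m : Fin (n + 1) → ℝ) : sharp (G (f z)) m =
      fderivWithin ℝ f s' z (sharp (G' z) (restrictCov s' f z m)) +
        (c ^ 2 * pair m (sharp (G (f z)) (V (f z)).2.1)) • sharp (G (f z)) (V (f z)).2.1 := by
  have hM := h.isMetricMatrix hz
  rw [hM.pair_sharp_comm m]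
  refine h.decomp hG' hz fun w => ?_
  rw [((h.isSmoothMetric hG').metric z hz).bil_sharp, hM.bil_sharp, pair_restrictCov]

/-- The metric trace over the hypersurface. -/
theorem sum_tangent (h : IsHypersurfaceChart s U G V s' U' f c) (hG' : IsInducedMetric G s' U' f G')
    (hz : z ∈ U') (B : Euc (n + 1) →L[ℝ] Euc (n + 1) →L[ℝ] ℝ) :
    ∑ a, B (basisVec a) (sharp (G (f z)) (basisCovec a)) =
      ∑ i, B (fderivWithin ℝ f s' z (basisVec i))
        (fderivWithin ℝ f s' z (sharp (G' z) (basisCovec i))) +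
      c ^ 2 * B (sharp (G (f z)) (V (f z)).2.1) (sharp (G (f z)) (V (f z)).2.1) := by
  have h1 : ∀ a, B (basisVec a) (sharp (G (f z)) (basisCovec a)) =
      ∑ i, fderivWithin ℝ f s' z (basisVec i) a * B (basisVec a)
        (fderivWithin ℝ f s' z (sharp (G' z) (basisCovec i))) +
      c ^ 2 * (sharp (G (f z)) (V (f z)).2.1 a * B (basisVec a)
        (sharp (G (f z)) (V (f z)).2.1)) := by
    intro a
    have h2 : restrictCov s' f z (basisCovec a) =
        ∑ i, fderivWithin ℝ f s' z (basisVec i) a • basisCovec i := by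
      rw [sum_smul_basisCovec]
      funext i
      exact pair_basisCovec a _
    rw [h.sharp_eq hG' hz (basisCovec a), h2]
    simp only [map_add, map_sum, map_smul, smul_eq_mul, pair_basisCovec]
    ring
  have h3 : ∀ x y, B x y = ∑ a, x a * B (basisVec a) y := fun x y => by
    have := clm_eq_sum (B.flip y) x
    simpa using this
  rw [Finset.sum_congr rfl fun a _ => h1 a, Finset.sum_add_distrib, Finset.sum_comm,
    ← Finset.mul_sum, ← h3]
  simp only [← h3]

/-- The Gauss equation for the Schouten tensor. -/
theorem gaussSchouten_eq (h : IsHypersurfaceChart s U G V s' U' f c)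
    (hG' : IsInducedMetric G s' U' f G') (hn : 3 ≤ n) (hz : z ∈ U') :
    gaussSchouten s G V s' f c z = schoutenMatrix s' G' z := by
  have hM := h.isMetricMatrix hz
  have hM' := (h.isSmoothMetric hG').metric z hz
  refine (h.isSmoothMetric hG').eq_schoutenMatrix h.isSmoothSymm_gaussSchouten hn hz fun v y => ?_
  let F := curv s (tractorConn s G (schoutenMatrix s G)) (f z)
  have hsum := h.metric.sum_pair_curv_schouten (by omega) (h.mapsTo hz)
    (fderivWithin ℝ f s' z v) (fderivWithin ℝ f s' z y)
  have hlin : ∀ x w, IsLinearMap ℝ fun u => middle (G (f z)) (F u w) x (fderivWithin ℝ f s' z y) :=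
    fun x w => ⟨fun u u' => by simp only [middle_apply, F, curv_add_left]; simp,
      fun r u => by simp only [middle_apply, F, curv_smul_left]; simp⟩
  let B : Euc (n + 1) →L[ℝ] Euc (n + 1) →L[ℝ] ℝ :=
    LinearMap.toContinuousLinearMap (LinearMap.toContinuousLinearMap.toLinearMap ∘ₗ
      LinearMap.mk₂ ℝ (fun u x => middle (G (f z)) (F u (fderivWithin ℝ f s' z v)) x
          (fderivWithin ℝ f s' z y))
        (fun u u' x => (hlin x _).map_add u u') (fun r u x => (hlin x _).map_smul r u)
        (fun u x x' => by simp) (fun r u x => by simp))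
  have hB : ∀ u x, B u x = middle (G (f z)) (F u (fderivWithin ℝ f s' z v)) x
      (fderivWithin ℝ f s' z y) := fun _ _ => rfl
  have h1 := h.sum_tangent hG' hz B
  have h2 : B (sharp (G (f z)) (V (f z)).2.1) (sharp (G (f z)) (V (f z)).2.1) = 0 := by
    rw [hB, middle_apply, hM.flat_sharp, h.metric.curv_normal h.metric.isSmoothSymm_schoutenMatrix
      h.smooth_tractor h.parallel (h.mapsTo hz) (h.zero z hz)]
    simp
  have h3 : ∀ a, B (basisVec a) (sharp (G (f z)) (basisCovec a)) =
      pair (F (basisVec a) (fderivWithin ℝ f s' z v) (0, basisCovec a, 0)).2.1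
        (fderivWithin ℝ f s' z y) := fun a => by
    rw [hB, middle_apply, hM.flat_sharp]
  rw [Finset.sum_congr rfl fun a _ => h3 a, hsum, h2, mul_zero, add_zero] at h1
  refine Eq.trans (Finset.sum_congr rfl fun i _ => ?_) h1.symm
  let x := fderivWithin ℝ f s' z (sharp (G' z) (basisCovec i))
  have hx : toIntrinsicMap V s' f c z (0, flat (G (f z)) x, 0) = (0, basisCovec i, 0) := by
    rw [toIntrinsicMap_apply]
    refine Prod.ext rfl (Prod.ext (pair_ext fun w => ?_) (by simp))
    change pair (restrictCov s' f z (flat (G (f z)) x)) w = _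
    rw [pair_restrictCov, pair_flat, ← hG'.metricBil_eq hz, hM'.bil_sharp]
  have hx0 : tractorBil (G (f z)) (0, flat (G (f z)) x, 0) (V (f z)) = 0 := by
    rw [tractorBil_apply, pair_flat, hM.bil_comm, h.metricBil_sharp_tangent hz]
    simp
  rw [← hx, h.curv_toIntrinsicMap hG' hz hx0, toIntrinsicMap_apply, pair_restrictCov]
  rfl

/-- The curvature annihilates the normal tractor. -/
theorem curv_tractor (h : IsHypersurfaceChart s U G V s' U' f c) (hz : z ∈ U')
    (u v : Euc (n + 1)) :
    curv s (tractorConn s G (schoutenMatrix s G)) (f z) u v (V (f z)) = 0 :=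
  curv_apply_eq_zero h.metric.dom h.conn_smooth h.smooth_tractor h.parallel (h.mapsTo hz) u v

theorem curv_normalProj (h : IsHypersurfaceChart s U G V s' U' f c) (hz : z ∈ U')
    (u v : Euc (n + 1)) (t : TractorCoords (n + 1)) :
    curv s (tractorConn s G (schoutenMatrix s G)) (f z) u v (normalProj G V f c z t) =
      curv s (tractorConn s G (schoutenMatrix s G)) (f z) u v t := by
  rw [normalProj, map_sub, map_smul, h.curv_tractor hz, smul_zero, sub_zero]

/-- The curvature preserves the complement of the normal tractor. -/
theorem tractorBil_curv (h : IsHypersurfaceChart s U G V s' U' f c) (hz : z ∈ U')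
    (u v : Euc (n + 1)) (t : TractorCoords (n + 1)) :
    tractorBil (G (f z)) (curv s (tractorConn s G (schoutenMatrix s G)) (f z) u v t) (V (f z)) = 0 := by
  have h1 := metric_curv h.metric.dom h.conn_smooth h.metric.contDiffOn_tractorBil
    h.metric.isMetricConnection_tractorConn (h.mapsTo hz) u v t (V (f z))
  rw [h.curv_tractor hz, map_zero, add_zero] at h1
  exact h1

/-- In dimensions other than four the curvature only depends on the tangential parts. -/
theorem curv_eq_tangential (h : IsHypersurfaceChart s U G V s' U' f c) (hn : 2 ≤ n) (hn4 : n + 1 ≠ 4)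
    (hG' : IsInducedMetric G s' U' f G') (hz : z ∈ U') {x y : Euc (n + 1)} {p q : Euc n}
    (hp : ∀ w, metricBil (G' z) p w = metricBil (G (f z)) x (fderivWithin ℝ f s' z w))
    (hq : ∀ w, metricBil (G' z) q w = metricBil (G (f z)) y (fderivWithin ℝ f s' z w)) :
    curv s (tractorConn s G (schoutenMatrix s G)) (f z) x y =
      curv s (tractorConn s G (schoutenMatrix s G)) (f z) (fderivWithin ℝ f s' z p)
        (fderivWithin ℝ f s' z q) := by
  have h1 := h.metric.curv_gradient_eq_zero (by omega) hn4 h.smooth_tractor h.parallel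
    (h.mapsTo hz) (h.zero z hz)
  have h2 : ∀ w, curv s (tractorConn s G (schoutenMatrix s G)) (f z) w
      (sharp (G (f z)) (V (f z)).2.1) = 0 := fun w => by rw [curv_swap, h1, neg_zero]
  conv_lhs => rw [h.decomp hG' hz hp, h.decomp hG' hz hq]
  rw [curv_add_left, curv_smul_left, h1, smul_zero, add_zero, curv_add_right, curv_smul_right, h2,
    smul_zero, add_zero]

end IsHypersurfaceChart

end HypersurfaceChart

section ManifoldCoords

variable {d : ℕ} {H : Type*} [TopologicalSpace H] {I : ModelWithCorners ℝ (Euc d) H}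
  {M : Type*} [TopologicalSpace M] [ChartedSpace H M] [IsManifold I ∞ M]

/-- The tangent vector at `y` with given components in the chart at `x₀`. -/
def fromCoords (I : ModelWithCorners ℝ (Euc d) H) [IsManifold I ∞ M] (x₀ y : M) :
    Euc d →L[ℝ] TangentSpace I y :=
  (trivializationAt (Euc d) (TangentSpace I : M → Type _) x₀).symmL ℝ y

theorem coordVec_eq (x₀ y : M) (i : Fin d) : coordVec I x₀ y i = fromCoords I x₀ y (basisVec i) :=
  rfl

theorem fromCoords_vecCoords {x₀ y : M} (hy : y ∈ (extChartAt I x₀).source) (v : TangentSpace I y) :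
    fromCoords I x₀ y (vecCoords I x₀ y v) = v :=
  Trivialization.symmL_continuousLinearMapAt _ (by simpa using hy) v

theorem vecCoords_fromCoords {x₀ y : M} (hy : y ∈ (extChartAt I x₀).source) (u : Euc d) :
    vecCoords I x₀ y (fromCoords I x₀ y u) = u :=
  Trivialization.continuousLinearMapAt_symmL _ (by simpa using hy) u

theorem metricBil_metricCoords (g : MetricField I M) (x₀ : M) (z u v : Euc d) :
    metricBil (metricCoords I g x₀ z) u v = g ((extChartAt I x₀).symm z)
      (fromCoords I x₀ _ u) (fromCoords I x₀ _ v) := by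
  let B : Euc d →L[ℝ] Euc d →L[ℝ] ℝ := ContinuousLinearMap.bilinearComp
    (E := Euc d) (F := Euc d) (E' := Euc d) (F' := Euc d) (g ((extChartAt I x₀).symm z))
    (fromCoords I x₀ ((extChartAt I x₀).symm z)) (fromCoords I x₀ ((extChartAt I x₀).symm z))
  exact bil_comp B (ContinuousLinearMap.id ℝ (Euc d)) u v

theorem metricBil_metricCoords_source (g : MetricField I M) {x₀ y : M}
    (hy : y ∈ (extChartAt I x₀).source) (u v : Euc d) :
    metricBil (metricCoords I g x₀ (extChartAt I x₀ y)) u v =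
      g y (fromCoords I x₀ y u) (fromCoords I x₀ y v) := by
  rw [metricBil_metricCoords, (extChartAt I x₀).left_inv hy]

theorem fromCoords_injective {x₀ y : M} (hy : y ∈ (extChartAt I x₀).source) :
    Function.Injective (fromCoords I x₀ y) :=
  Function.LeftInverse.injective (vecCoords_fromCoords hy)

variable (g : ContMDiffRiemannianMetric I ∞ (Euc d) (TangentSpace I : M → Type _))

theorem isMetricMatrix_metricCoords {x₀ : M} {z : Euc d} (hz : z ∈ (extChartAt I x₀).target) :
    IsMetricMatrix (metricCoords I g.inner x₀ z) where
  symm a b := g.symm _ _ _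
  pos x hx := by
    rw [metricBil_metricCoords]
    refine g.pos _ _ fun h0 => hx ?_
    exact fromCoords_injective ((extChartAt I x₀).map_target hz) (h0.trans (map_zero _).symm)

theorem isChartDomain_target (x₀ : M) : IsChartDomain (range I) (extChartAt I x₀).target where
  convex := I.convex_range
  nonempty_interior := I.nonempty_interior
  subset := extChartAt_target_subset_range x₀
  mem_nhdsWithin _ hz := extChartAt_target_mem_nhdsWithin_of_mem hz

theorem contDiffOn_metricCoords (x₀ : M) (i j : Fin d) :
    ContDiffOn ℝ ∞ (fun z => metricCoords I g.inner x₀ z i j) (extChartAt I x₀).target := by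
  have hc : ∀ i, ContMDiffOn I (I.prod 𝓘(ℝ, Euc d)) ∞
      (fun y => TotalSpace.mk' (Euc d) y (coordVec I x₀ y i)) (extChartAt I x₀).source := by
    intro i
    have h1 := (trivializationAt (Euc d) (TangentSpace I : M → Type _) x₀).contMDiffOn_localFrame_baseSet
      (I := I) (n := ∞) (EuclideanSpace.basisFun (Fin d) ℝ).toBasis i
    have hs : (trivializationAt (Euc d) (TangentSpace I : M → Type _) x₀).baseSet =
      (extChartAt I x₀).source := by simp
    rw [hs] at h1
    refine h1.congr fun y hy => congrArg (TotalSpace.mk' (Euc d) y) ?_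
    have hy' : y ∈ (trivializationAt (Euc d) (TangentSpace I : M → Type _) x₀).baseSet := by
      rwa [hs]
    refine Eq.trans ?_ (Trivialization.localFrame_apply_of_mem_baseSet _ _ hy').symm
    rw [Trivialization.basisAt, Module.Basis.map_apply]
    simp [coordVec, Trivialization.symmL_apply _ hy']
  have h2 : ContMDiffOn I 𝓘(ℝ, ℝ) ∞ (fun y => g.inner y (coordVec I x₀ y i) (coordVec I x₀ y j))
      (extChartAt I x₀).source := by
    have h3 := ContMDiffOn.clm_bundle_apply₂ (F₁ := Euc d) (F₂ := Euc d) (F₃ := ℝ) (b := id)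
      (E₃ := Bundle.Trivial M ℝ)
      (ψ := g.inner) (g.contMDiff.contMDiffOn (s := (extChartAt I x₀).source)) (hc i) (hc j)
    intro y hy
    have h4 := h3 y hy
    simp only [contMDiffWithinAt_totalSpace] at h4
    exact h4.2
  have h3 := h2.comp (contMDiffOn_extChartAt_symm (n := ∞) x₀)
    fun z hz => (extChartAt I x₀).map_target hz
  exact contMDiffOn_iff_contDiffOn.1 h3

theorem isSmoothMetric_metricCoords (x₀ : M) :
    IsSmoothMetric (range I) (extChartAt I x₀).target (metricCoords I g.inner x₀) where
  dom := isChartDomain_target x₀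
  smooth := contDiffOn_metricCoords g x₀
  metric _ hz := isMetricMatrix_metricCoords g hz

theorem pair_tractorCoords (x₀ y : M) (t : Tractor I y) (u : Euc d) :
    pair (tractorCoords I x₀ y t).2.1 u = t.2.1 (fromCoords I x₀ y u) :=
  pair_clm ((show Euc d →L[ℝ] ℝ from t.2.1).comp (fromCoords I x₀ y)) u

theorem tractorOfCoords_mid (x : M) (t : TractorCoords d) (v : TangentSpace I x) :
    (tractorOfCoords I x t).2.1 v = pair t.2.1 (vecCoords I x x v) := by
  rw [pair_apply]
  simp [tractorOfCoords, _root_.sum_apply]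

theorem tractorOfCoords_tractorCoords (x : M) (t : Tractor I x) :
    tractorOfCoords I x (tractorCoords I x x t) = t := by
  refine Prod.ext rfl (Prod.ext ?_ rfl)
  ext v
  rw [tractorOfCoords_mid, pair_tractorCoords, fromCoords_vecCoords (mem_extChartAt_source x)]

theorem tractorCoords_tractorOfCoords (x : M) (t : TractorCoords d) :
    tractorCoords I x x (tractorOfCoords I x t) = t := by
  refine Prod.ext rfl (Prod.ext (pair_ext fun u => ?_) rfl)
  rw [pair_tractorCoords, tractorOfCoords_mid, vecCoords_fromCoords (mem_extChartAt_source x)]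

theorem tractorCoords_smul (x₀ y : M) (r : ℝ) (t : Tractor I y) :
    tractorCoords I x₀ y (r • t) = r • tractorCoords I x₀ y t := rfl

theorem tractorCoords_sub (x₀ y : M) (t t' : Tractor I y) :
    tractorCoords I x₀ y (t - t') = tractorCoords I x₀ y t - tractorCoords I x₀ y t' := rfl

theorem tractorCoords_injective (x : M) : Function.Injective (tractorCoords I x x) :=
  Function.LeftInverse.injective (tractorOfCoords_tractorCoords x)

/-- The tractor metric may be computed in any chart. -/
theorem tractorMetric_eq {x₀ y : M} (hy : y ∈ (extChartAt I x₀).source) (t t' : Tractor I y) :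
    tractorMetric I g.inner y t t' = tractorBil (metricCoords I g.inner x₀ (extChartAt I x₀ y))
      (tractorCoords I x₀ y t) (tractorCoords I x₀ y t') := by
  obtain ⟨m, hm⟩ : ∃ m : TangentSpace I y, ∀ v, g.inner y m v = t'.2.1 v := by
    have hM := isMetricMatrix_metricCoords g (mem_extChartAt_target (I := I) y)
    refine ⟨fromCoords I y y (sharp (metricCoords I g.inner y (extChartAt I y y))
      (tractorCoords I y y t').2.1), fun v => ?_⟩
    have h1 := hM.bil_sharp (tractorCoords I y y t').2.1 (vecCoords I y y v)
    rwa [metricBil_metricCoords_source _ (mem_extChartAt_source y), pair_tractorCoords,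
      fromCoords_vecCoords (mem_extChartAt_source y)] at h1
  have key : ∀ x₀ : M, y ∈ (extChartAt I x₀).source →
      tractorBil (metricCoords I g.inner x₀ (extChartAt I x₀ y))
        (tractorCoords I x₀ y t) (tractorCoords I x₀ y t') =
        t.2.1 m + t.1 * t'.2.2 + t.2.2 * t'.1 := by
    intro x₀ hy
    have hM := isMetricMatrix_metricCoords g ((extChartAt I x₀).map_source hy)
    have h1 : sharp (metricCoords I g.inner x₀ (extChartAt I x₀ y)) (tractorCoords I x₀ y t').2.1 =
        vecCoords I x₀ y m := hM.ext_bil fun u => by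
      rw [hM.bil_sharp, pair_tractorCoords, metricBil_metricCoords_source _ hy,
        fromCoords_vecCoords hy, hm]
    rw [tractorBil_apply, h1, pair_tractorCoords, fromCoords_vecCoords hy]
    rfl
  rw [key x₀ hy, ← key y (mem_extChartAt_source y), tractorBil_eq]
  rfl

end ManifoldCoords

/-- A parallel tractor in a convex coordinate domain. -/
structure IsParallelChart {d : ℕ} (s U : Set (Euc d)) (G : Euc d → Matrix (Fin d) (Fin d) ℝ)
    (V : Euc d → TractorCoords d) : Prop where
  metric : IsSmoothMetric s U G
  convex : Convex ℝ U
  smooth_tractor : ContDiffOn ℝ 2 V U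
  parallel : ∀ z ∈ U, ∀ u, cderiv s (tractorConn s G (schoutenMatrix s G)) u V z = 0

section ProductRule

variable {EB : Type*} [NormedAddCommGroup EB] [NormedSpace ℝ EB]
  {HB : Type*} [TopologicalSpace HB] {K : ModelWithCorners ℝ EB HB}
  {B : Type*} [TopologicalSpace B] [ChartedSpace HB B]
  {E T₁ T₂ : Type*} [NormedAddCommGroup E] [NormedSpace ℝ E] [NormedAddCommGroup T₁]
  [NormedSpace ℝ T₁] [NormedAddCommGroup T₂] [NormedSpace ℝ T₂]

theorem hasMFDerivWithinAt_clm_apply {Φ : E → T₁ →L[ℝ] T₂} {Φ' : E →L[ℝ] T₁ →L[ℝ] T₂} {s : Set E}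
    {κ : B → E} {τ : B → T₁} {T : Set B} {b : B} {κ' : EB →L[ℝ] E} {τ' : EB →L[ℝ] T₁}
    (hΦ : HasFDerivWithinAt Φ Φ' s (κ b)) (hs : MapsTo κ T s)
    (hκ : HasMFDerivWithinAt K 𝓘(ℝ, E) κ T b κ') (hτ : HasMFDerivWithinAt K 𝓘(ℝ, T₁) τ T b τ') :
    HasMFDerivWithinAt K 𝓘(ℝ, T₂) (fun b' => Φ (κ b') (τ b')) T b
      ((Φ (κ b)).comp τ' + (Φ'.comp κ').flip (τ b) : EB →L[ℝ] T₂) := by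
  refine ⟨(hΦ.continuousWithinAt.comp hκ.1 hs).clm_apply hτ.1, ?_⟩
  have h1 : HasFDerivWithinAt (fun z => κ ((extChartAt K b).symm z)) κ'
      ((extChartAt K b).symm ⁻¹' T ∩ range K) (extChartAt K b b) := hκ.2
  have h2 : HasFDerivWithinAt (fun z => τ ((extChartAt K b).symm z)) τ'
      ((extChartAt K b).symm ⁻¹' T ∩ range K) (extChartAt K b b) := hτ.2
  have hb : (extChartAt K b).symm (extChartAt K b b) = b := extChartAt_to_inv b
  rw [← hb] at hΦ
  have h3 := (hΦ.comp (extChartAt K b b) h1 fun z hz => hs hz.1).clm_apply h2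
  simp only [Function.comp_def, hb] at h3
  exact h3

/-- The derivative of a vector-valued map. -/
def mderiv (K : ModelWithCorners ℝ EB HB) (h : B → E) (T : Set B) (b : B) : EB →L[ℝ] E :=
  mfderivWithin K 𝓘(ℝ, E) h T b

theorem mderiv_congr {h h' : B → E} {T : Set B} {b : B} (hb : b ∈ T) (hh : h =ᶠ[𝓝[T] b] h') :
    mderiv K h T b = mderiv K h' T b := by
  have h1 := hh.mfderivWithin_eq (I := K) (I' := 𝓘(ℝ, E)) (hh.self_of_nhdsWithin hb)
  exact h1

theorem mderiv_eq {h : B → E} {h' : EB →L[ℝ] E} {T : Set B} {b : B}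
    (hu : UniqueMDiffWithinAt K T b) (hh : HasMFDerivWithinAt K 𝓘(ℝ, E) h T b h') :
    mderiv K h T b = h' :=
  hh.mfderivWithin hu

theorem hasMFDerivWithinAt_mderiv {h : B → E} {T : Set B} {b : B}
    (hh : MDifferentiableWithinAt K 𝓘(ℝ, E) h T b) :
    HasMFDerivWithinAt K 𝓘(ℝ, E) h T b (mderiv K h T b : EB →L[ℝ] E) :=
  hh.hasMFDerivWithinAt

theorem mderiv_clm_apply {Φ : E → T₁ →L[ℝ] T₂} {s : Set E} {κ : B → E} {τ : B → T₁}
    {T : Set B} {b : B} (hu : UniqueMDiffWithinAt K T b)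
    (hΦ : DifferentiableWithinAt ℝ Φ s (κ b)) (hs : MapsTo κ T s)
    (hκ : MDifferentiableWithinAt K 𝓘(ℝ, E) κ T b) (hτ : MDifferentiableWithinAt K 𝓘(ℝ, T₁) τ T b) :
    MDifferentiableWithinAt K 𝓘(ℝ, T₂) (fun b' => Φ (κ b') (τ b')) T b ∧ ∀ w,
      mderiv K (fun b' => Φ (κ b') (τ b')) T b w =
        fderivWithin ℝ Φ s (κ b) (mderiv K κ T b w) (τ b) + Φ (κ b) (mderiv K τ T b w) := by
  have h1 := hasMFDerivWithinAt_clm_apply (κ' := mderiv K κ T b) (τ' := mderiv K τ T b)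
    hΦ.hasFDerivWithinAt hs (hasMFDerivWithinAt_mderiv hκ) (hasMFDerivWithinAt_mderiv hτ)
  refine ⟨h1.mdifferentiableWithinAt, fun w => ?_⟩
  rw [mderiv_eq hu h1]
  exact add_comm _ _

end ProductRule

section ParallelTractor

variable {d : ℕ} {H : Type*} [TopologicalSpace H] {I : ModelWithCorners ℝ (Euc d) H}
  {M : Type*} [TopologicalSpace M] [ChartedSpace H M] [IsManifold I ∞ M]
  (g : ContMDiffRiemannianMetric I ∞ (Euc d) (TangentSpace I : M → Type _))
  {t : ∀ x : M, Tractor I x}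

/-- The components of a tractor field as functions of the coordinates. -/
def localTractor (t : ∀ x : M, Tractor I x) (x₀ : M) (z : Euc d) : TractorCoords d :=
  tractorCoords I x₀ ((extChartAt I x₀).symm z) (t ((extChartAt I x₀).symm z))

theorem localTractor_source {x₀ y : M} (hy : y ∈ (extChartAt I x₀).source) :
    localTractor t x₀ (extChartAt I x₀ y) = tractorCoords I x₀ y (t y) := by
  rw [localTractor, (extChartAt I x₀).left_inv hy]

theorem extChartAt_mem_range (x₀ y : M) : extChartAt I x₀ y ∈ range I := by
  simp [extChartAt]

theorem exists_isParallelChart (ht : SmoothTractorAlong I I id t univ)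
    (hpar : IsParallelTractor I g.inner t) (x₀ : M) :
    ∃ U : Set (Euc d), U ⊆ (extChartAt I x₀).target ∧ U ∈ 𝓝[range I] (extChartAt I x₀ x₀) ∧
      IsParallelChart (range I) U (metricCoords I g.inner x₀) (localTractor t x₀) := by
  have h1 := (contMDiffWithinAt_iff.1 (ht x₀ (mem_univ _))).2
  simp only [preimage_univ, univ_inter] at h1
  have h2 : ContDiffWithinAt ℝ ∞ (localTractor t x₀) (range I) (extChartAt I x₀ x₀) := h1
  obtain ⟨u, hu, hu'⟩ := (h2.of_le two_le_infty).contDiffOn' (m := 2) le_rfl (by simp)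
  rw [insert_eq_of_mem (extChartAt_mem_range x₀ x₀)] at hu'
  have h3 : u ∩ (extChartAt I x₀).target ∈ 𝓝[range I] (extChartAt I x₀ x₀) :=
    inter_mem (mem_nhdsWithin_of_mem_nhds (hu.mem_nhds hu'.1)) (extChartAt_target_mem_nhdsWithin x₀)
  obtain ⟨ε, hε, hball⟩ := Metric.mem_nhdsWithin_iff.1 h3
  have hU : Metric.ball (extChartAt I x₀ x₀) ε ∩ range I ⊆ (extChartAt I x₀).target :=
    fun z hz => (hball hz).2
  have hM := isSmoothMetric_metricCoords g x₀
  refine ⟨Metric.ball (extChartAt I x₀ x₀) ε ∩ range I, hU, ?_, ⟨?_, ?_, ?_, ?_⟩⟩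
  · rw [inter_comm]
    exact inter_mem_nhdsWithin _ (Metric.ball_mem_nhds _ hε)
  · refine ⟨⟨I.convex_range, I.nonempty_interior, inter_subset_right, fun z hz => ?_⟩,
      fun a b => (hM.smooth a b).mono hU, fun z hz => hM.metric z (hU hz)⟩
    rw [inter_comm]
    exact inter_mem_nhdsWithin _ (Metric.isOpen_ball.mem_nhds hz.1)
  · exact (convex_ball _ _).inter I.convex_range
  · exact hu'.2.mono fun z hz => ⟨hz.2, (hball hz).1⟩
  · intro z hz u
    have h4 : fderivWithin ℝ (localTractor t x₀) (range I) z + (tractorConn (range I)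
        (metricCoords I g.inner x₀) (schoutenMatrix (range I) (metricCoords I g.inner x₀)) z).flip
        (localTractor t x₀ z) = 0 := by
      ext1 u
      rw [clm_eq_sum]
      refine Finset.sum_eq_zero fun a _ => ?_
      have h5 := hpar x₀ z (hU hz) a
      rw [chartTractorDeriv, ← tractorConn_apply_eq_tractorForm] at h5
      exact smul_eq_zero_of_right _ h5
    exact congrArg (fun L : Euc d →L[ℝ] TractorCoords d => L u) h4

variable {EB : Type*} [NormedAddCommGroup EB] [NormedSpace ℝ EB]
  {HB : Type*} [TopologicalSpace HB] {K : ModelWithCorners ℝ EB HB}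
  {B : Type*} [TopologicalSpace B] [ChartedSpace HB B]

theorem vecCoords_mfderivWithin {f : B → M} {T : Set B} {b : B} (hu : UniqueMDiffWithinAt K T b)
    (hf : MDifferentiableWithinAt K I f T b) {x₀ : M} (hx : f b ∈ (extChartAt I x₀).source)
    (w : TangentSpace K b) :
    vecCoords I x₀ (f b) (mfderivWithin K I f T b w) =
      mderiv K (fun b' => extChartAt I x₀ (f b')) T b w := by
  have hx' : f b ∈ (chartAt H x₀).source := by rwa [← extChartAt_source I]
  have h1 := (mdifferentiableAt_extChartAt (I := I) hx').hasMFDerivAt.comp_hasMFDerivWithinAt b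
    hf.hasMFDerivWithinAt
  rw [vecCoords, TangentBundle.continuousLinearMapAt_trivializationAt hx']
  exact (congrArg (fun L : EB →L[ℝ] Euc d => L w) (mderiv_eq hu h1)).symm

theorem mdifferentiableWithinAt_extChartAt_comp {f : B → M} {T : Set B} {b : B}
    (hf : MDifferentiableWithinAt K I f T b) {x₀ : M} (hx : f b ∈ (extChartAt I x₀).source) :
    MDifferentiableWithinAt K 𝓘(ℝ, Euc d) (fun b' => extChartAt I x₀ (f b')) T b :=
  (mdifferentiableAt_extChartAt (I := I) (by rwa [← extChartAt_source I])).comp_mdifferentiableWithinAt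
    b hf

/-- The tractor derivative along a map in components. -/
def coordsDeriv (g : MetricField I M) (K : ModelWithCorners ℝ EB HB) (f : B → M)
    (V : ∀ b, Tractor I (f b)) (T : Set B) (b : B) (w : EB) : TractorCoords d :=
  mderiv K (fun b' => tractorCoords I (f b) (f b') (V b')) T b w +
    tractorConn (range I) (metricCoords I g (f b)) (schoutenMatrix (range I)
      (metricCoords I g (f b))) (extChartAt I (f b) (f b))
      (mderiv K (fun b' => extChartAt I (f b) (f b')) T b w) (tractorCoords I (f b) (f b) (V b))

theorem tractorDeriv_eq {f : B → M} {V : ∀ b, Tractor I (f b)} {T : Set B} {b : B}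
    (hu : UniqueMDiffWithinAt K T b) (hf : MDifferentiableWithinAt K I f T b)
    (g : MetricField I M) (w : TangentSpace K b) :
    tractorDeriv I K g f V T b w = tractorOfCoords I (f b) (coordsDeriv g K f V T b w) := by
  unfold tractorDeriv coordsDeriv
  rw [tractorConn_apply_eq_tractorForm, vecCoords_mfderivWithin hu hf (mem_extChartAt_source _)]
  rfl

theorem tractorCoords_tractorDeriv {f : B → M} {V : ∀ b, Tractor I (f b)} {T : Set B} {b : B}
    (hu : UniqueMDiffWithinAt K T b) (hf : MDifferentiableWithinAt K I f T b)
    (g : MetricField I M) (w : TangentSpace K b) :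
    tractorCoords I (f b) (f b) (tractorDeriv I K g f V T b w) = coordsDeriv g K f V T b w := by
  rw [tractorDeriv_eq hu hf, tractorCoords_tractorOfCoords]

/-- The pairing with a parallel tractor is differentiated by differentiating the other factor. -/
theorem mderiv_tractorMetric (ht : SmoothTractorAlong I I id t univ)
    (hpar : IsParallelTractor I g.inner t) {f : B → M} {V : ∀ b, Tractor I (f b)} {T : Set B} {b : B}
    (hb : b ∈ T) (hu : UniqueMDiffWithinAt K T b) (hf : MDifferentiableWithinAt K I f T b)
    (hV : MDifferentiableWithinAt K 𝓘(ℝ, TractorCoords d)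
      (fun b' => tractorCoords I (f b) (f b') (V b')) T b) :
    MDifferentiableWithinAt K 𝓘(ℝ, ℝ) (fun b' => tractorMetric I g.inner (f b') (V b') (t (f b'))) T b ∧
      ∀ w : TangentSpace K b,
      mderiv K (fun b' => tractorMetric I g.inner (f b') (V b') (t (f b'))) T b w =
        tractorMetric I g.inner (f b) (tractorDeriv I K g.inner f V T b w) (t (f b)) := by
  obtain ⟨U, hU, hUn, hc⟩ := exists_isParallelChart g ht hpar (f b)
  set G := metricCoords I g.inner (f b)
  have hz : extChartAt I (f b) (f b) ∈ U := mem_of_mem_nhdsWithin (extChartAt_mem_range _ _) hUn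
  let Φ : Euc d → TractorCoords d →L[ℝ] ℝ := fun z =>
    (tractorBil (G z)).flip (localTractor t (f b) z)
  have hΦ : ContDiffOn ℝ 2 Φ U := by
    rw [contDiffOn_clm_apply]
    intro t'
    exact ((hc.metric.contDiffOn_tractorBil.of_le two_le_infty).clm_apply contDiffOn_const).clm_apply
      hc.smooth_tractor
  have h1 := mderiv_clm_apply hu (hc.metric.dom.differentiableWithinAt hΦ two_ne_zero hz)
    (fun b' _ => extChartAt_mem_range _ _)
    (mdifferentiableWithinAt_extChartAt_comp hf (mem_extChartAt_source _)) hV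
  have hev : (fun b' => tractorMetric I g.inner (f b') (V b') (t (f b'))) =ᶠ[𝓝[T] b]
      fun b' => Φ (extChartAt I (f b) (f b')) (tractorCoords I (f b) (f b') (V b')) := by
    filter_upwards [hf.continuousWithinAt (extChartAt_source_mem_nhds (I := I) (f b))] with b' hb'
    rw [tractorMetric_eq g hb', ← localTractor_source hb']
    rfl
  refine ⟨h1.1.congr_of_eventuallyEq hev (hev.self_of_nhdsWithin hb), fun w => ?_⟩
  have h2 := IsMetricConnection.fderivWithin_eq hc.metric.dom
    (hc.metric.isMetricConnection_tractorConn (Q := schoutenMatrix (range I) G))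
    (hc.metric.contDiffOn_tractorBil.of_le (by simp))
    (contDiffOn_const (c := tractorCoords I (f b) (f b) (V b)))
    (hc.smooth_tractor.of_le one_le_two) hz
    (mderiv K (fun b' => extChartAt I (f b) (f b')) T b w)
  rw [hc.parallel _ hz, map_zero, add_zero, cderiv, fderivWithin_const_apply, _root_.zero_apply,
    zero_add] at h2
  rw [mderiv_congr hb hev, h1.2 w, tractorMetric_eq g (mem_extChartAt_source _),
    tractorCoords_tractorDeriv hu hf, ← hc.metric.dom.fderivWithin_apply_const hΦ two_ne_zero hz,
    ← localTractor_source (t := t) (mem_extChartAt_source (f b)), add_comm]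
  have h3 : ∀ x y : TractorCoords d, tractorBil (G (extChartAt I (f b) (f b))) (x + y) =
      tractorBil (G (extChartAt I (f b) (f b))) x + tractorBil (G (extChartAt I (f b) (f b))) y :=
    map_add _
  refine Eq.trans (congrArg (_ + ·) h2) ?_
  exact (congrArg (fun L : TractorCoords d →L[ℝ] ℝ => L _) (h3 _ _)).symm

end ParallelTractor

section TangentMap

variable {n d : ℕ} {H : Type*} [TopologicalSpace H] {I : ModelWithCorners ℝ (Euc d) H}
  {M : Type*} [TopologicalSpace M] [ChartedSpace H M] [IsManifold I ∞ M]
  {H' : Type*} [TopologicalSpace H'] {J : ModelWithCorners ℝ (Euc n) H'}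
  {S : Type*} [TopologicalSpace S] [ChartedSpace H' S] [IsManifold J ∞ S]

/-- A map between manifolds in the charts at `x` and `ι x`. -/
def localMap (I : ModelWithCorners ℝ (Euc d) H) (J : ModelWithCorners ℝ (Euc n) H') (ι : S → M)
    (x : S) (z : Euc n) : Euc d :=
  extChartAt I (ι x) (ι ((extChartAt J x).symm z))

theorem localMap_source {ι : S → M} {x y : S} (hy : y ∈ (extChartAt J x).source) :
    localMap I J ι x (extChartAt J x y) = extChartAt I (ι x) (ι y) := by
  rw [localMap, (extChartAt J x).left_inv hy]

theorem mfderiv_fromCoords {ι : S → M} {x y : S} (hy : y ∈ (extChartAt J x).source)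
    (hy' : ι y ∈ (extChartAt I (ι x)).source) (hι : MDifferentiableAt J I ι y) (u : Euc n) :
    mfderiv J I ι y (fromCoords J x y u) =
      fromCoords I (ι x) (ι y) (fderivWithin ℝ (localMap I J ι x) (range J) (extChartAt J x y) u) := by
  obtain ⟨z, hz, rfl⟩ : ∃ z ∈ (extChartAt J x).target, (extChartAt J x).symm z = y :=
    ⟨_, (extChartAt J x).map_source hy, (extChartAt J x).left_inv hy⟩
  have hyc : (extChartAt J x).symm z ∈ (chartAt H' x).source := by rwa [← extChartAt_source J]
  have h1 := (mdifferentiableWithinAt_extChartAt_symm (I := J) hz)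
  have h2 : fromCoords J x ((extChartAt J x).symm z) u =
      mfderivWithin 𝓘(ℝ, Euc n) J (extChartAt J x).symm (range J) z u := by
    rw [fromCoords, TangentBundle.symmL_trivializationAt hyc]
    exact congrArg (fun z' => (mfderivWithin 𝓘(ℝ, Euc n) J (extChartAt J x).symm (range J) z' :
      Euc n →L[ℝ] Euc n) u) ((extChartAt J x).right_inv hz)
  have hu : UniqueMDiffWithinAt 𝓘(ℝ, Euc n) (range J) z :=
    (J.uniqueDiffOn _ (extChartAt_target_subset_range x hz)).uniqueMDiffWithinAt
  have h3 : mfderivWithin 𝓘(ℝ, Euc n) I (ι ∘ (extChartAt J x).symm) (range J) z = _ :=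
    (hι.hasMFDerivAt.comp_hasMFDerivWithinAt z h1.hasMFDerivWithinAt).mfderivWithin hu
  have h4 := vecCoords_mfderivWithin hu (hι.comp_mdifferentiableWithinAt z h1) hy' u
  have h5 : mderiv 𝓘(ℝ, Euc n) (fun b' => extChartAt I (ι x) ((ι ∘ (extChartAt J x).symm) b'))
      (range J) z = fderivWithin ℝ (localMap I J ι x) (range J) z := mfderivWithin_eq_fderivWithin
  rw [h5, h3] at h4
  rw [(extChartAt J x).right_inv hz, ← h4, h2]
  exact (fromCoords_vecCoords hy' _).symm

end TangentMap

section ParallelTractor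

variable {d : ℕ} {H : Type*} [TopologicalSpace H] {I : ModelWithCorners ℝ (Euc d) H}
  {M : Type*} [TopologicalSpace M] [ChartedSpace H M] [IsManifold I ∞ M]
  (g : ContMDiffRiemannianMetric I ∞ (Euc d) (TangentSpace I : M → Type _))
  {t : ∀ x : M, Tractor I x}
  {EB : Type*} [NormedAddCommGroup EB] [NormedSpace ℝ EB]
  {HB : Type*} [TopologicalSpace HB] {K : ModelWithCorners ℝ EB HB}
  {B : Type*} [TopologicalSpace B] [ChartedSpace HB B]

theorem mderiv_comp {E T₂ : Type*} [NormedAddCommGroup E] [NormedSpace ℝ E] [NormedAddCommGroup T₂]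
    [NormedSpace ℝ T₂] {h : E → T₂} {s : Set E} {κ : B → E} {T : Set B} {b : B}
    (hu : UniqueMDiffWithinAt K T b) (hh : DifferentiableWithinAt ℝ h s (κ b)) (hs : MapsTo κ T s)
    (hκ : MDifferentiableWithinAt K 𝓘(ℝ, E) κ T b) (w : EB) :
    mderiv K (fun b' => h (κ b')) T b w = fderivWithin ℝ h s (κ b) (mderiv K κ T b w) := by
  have h1 := HasMFDerivWithinAt.comp b hh.hasFDerivWithinAt.hasMFDerivWithinAt
    (hasMFDerivWithinAt_mderiv hκ) hs
  exact congrArg (fun L : EB →L[ℝ] T₂ => L w) (mderiv_eq hu h1)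

theorem mderiv_const {E : Type*} [NormedAddCommGroup E] [NormedSpace ℝ E] (e : E) (T : Set B) (b : B) :
    mderiv K (fun _ => e) T b = 0 :=
  mfderivWithin_const

/-- The derivative of the scale of a parallel tractor. -/
theorem mderiv_scale (ht : SmoothTractorAlong I I id t univ)
    (hpar : IsParallelTractor I g.inner t) {f : B → M} {T : Set B} {b : B}
    (hb : b ∈ T) (hu : UniqueMDiffWithinAt K T b) (hf : MDifferentiableWithinAt K I f T b) :
    MDifferentiableWithinAt K 𝓘(ℝ, ℝ) (fun b' => (t (f b')).1) T b ∧ ∀ w : TangentSpace K b,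
      mderiv K (fun b' => (t (f b')).1) T b w = (t (f b)).2.1 (mfderivWithin K I f T b w) := by
  let V : ∀ b', Tractor I (f b') := fun _ => (0, 0, 1)
  have hV' : ∀ x b', tractorCoords I x (f b') (V b') = (0, 0, 1) := fun _ _ => rfl
  have hV : (fun b' => tractorCoords I (f b) (f b') (V b')) = fun _ => (0, 0, 1) := rfl
  have h1 := mderiv_tractorMetric g ht hpar hb hu hf (V := V)
    (by rw [hV]; exact mdifferentiableWithinAt_const)
  have h2 : (fun b' => tractorMetric I g.inner (f b') (V b') (t (f b'))) =
      fun b' => (t (f b')).1 := by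
    funext b'
    rw [tractorMetric_eq g (mem_extChartAt_source _), tractorBil_apply, hV']
    simp [tractorCoords]
  rw [h2] at h1
  refine ⟨h1.1, fun w => (h1.2 w).trans ?_⟩
  have hM := isMetricMatrix_metricCoords g (mem_extChartAt_target (I := I) (f b))
  rw [tractorMetric_eq g (mem_extChartAt_source _), tractorCoords_tractorDeriv hu hf]
  have h3 : coordsDeriv g.inner K f V T b w = (0, flat (metricCoords I g.inner (f b)
      (extChartAt I (f b) (f b))) (vecCoords I (f b) (f b) (mfderivWithin K I f T b w)), 0) := by
    unfold coordsDeriv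
    rw [hV, hV', mderiv_const, ← vecCoords_mfderivWithin hu hf (mem_extChartAt_source _)]
    refine Prod.ext ?_ (Prod.ext (pair_ext fun y => ?_) ?_)
    · change (0 : ℝ) + _ = 0
      rw [tractorConn_fst]
      simp
    · change pair (0 + _) y = _
      rw [zero_add, pair_tractorConn, pair_flat]
      simp
    · change (0 : ℝ) + _ = 0
      rw [tractorConn_snd_snd]
      simp
  rw [h3, tractorBil_apply]
  simp only [zero_mul, add_zero]
  rw [hM.pair_sharp_comm, hM.sharp_flat, pair_tractorCoords, fromCoords_vecCoords (mem_extChartAt_source _)]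

/-- The norm of a parallel tractor is locally constant. -/
theorem eventually_tractorMetric_eq (ht : SmoothTractorAlong I I id t univ)
    (hpar : IsParallelTractor I g.inner t) (x : M) :
    ∀ᶠ y in 𝓝 x, tractorMetric I g.inner y (t y) (t y) = tractorMetric I g.inner x (t x) (t x) := by
  obtain ⟨U, hU, hUn, hc⟩ := exists_isParallelChart g ht hpar x
  have hz : extChartAt I x x ∈ U := mem_of_mem_nhdsWithin (extChartAt_mem_range _ _) hUn
  set G := metricCoords I g.inner x
  have hφ : ContDiffOn ℝ 1 (fun z => tractorBil (G z) (localTractor t x z) (localTractor t x z)) U :=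
    ((hc.metric.contDiffOn_tractorBil.of_le (by simp)).clm_apply
      (hc.smooth_tractor.of_le one_le_two)).clm_apply (hc.smooth_tractor.of_le one_le_two)
  have hUD : UniqueDiffOn ℝ U := fun z hz => (hc.metric.dom.uniqueDiffWithinAt hz).mono_nhds
    (nhdsWithin_le_iff.2 (hc.metric.dom.mem_nhdsWithin z hz))
  have h1 : ∀ z ∈ U, fderivWithin ℝ (fun z => tractorBil (G z) (localTractor t x z)
      (localTractor t x z)) U z = 0 := fun z hz => by
    rw [((hc.metric.dom.hasFDerivWithinAt hφ one_ne_zero hz).mono hc.metric.dom.subset).fderivWithin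
      (hUD z hz)]
    ext1 u
    rw [IsMetricConnection.fderivWithin_eq hc.metric.dom
      (hc.metric.isMetricConnection_tractorConn (Q := schoutenMatrix (range I) G))
      (hc.metric.contDiffOn_tractorBil.of_le (by simp)) (hc.smooth_tractor.of_le one_le_two)
      (hc.smooth_tractor.of_le one_le_two) hz, hc.parallel z hz]
    simp
  have h2 : ∀ y, y ∈ (extChartAt I x).source → tractorMetric I g.inner y (t y) (t y) =
      tractorBil (G (extChartAt I x y)) (localTractor t x (extChartAt I x y))
        (localTractor t x (extChartAt I x y)) := fun y hy => by
    rw [tractorMetric_eq g hy, localTractor_source hy]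
  have h3 : ∀ᶠ y in 𝓝 x, extChartAt I x y ∈ U :=
    (tendsto_nhdsWithin_iff.2 ⟨continuousAt_extChartAt x, Eventually.of_forall fun y =>
      extChartAt_mem_range x y⟩).eventually hUn
  filter_upwards [h3, extChartAt_source_mem_nhds (I := I) x] with y hy hy'
  rw [h2 y hy', h2 x (mem_extChartAt_source x)]
  exact hc.convex.is_const_of_fderivWithin_eq_zero (hφ.differentiableOn one_ne_zero) h1 hy hz

end ParallelTractor

section Hypersurface

variable {n : ℕ} {H : Type*} [TopologicalSpace H] {I : ModelWithCorners ℝ (Euc (n + 1)) H}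
  {M : Type*} [TopologicalSpace M] [ChartedSpace H M] [IsManifold I ∞ M]
  {H' : Type*} [TopologicalSpace H'] {J : ModelWithCorners ℝ (Euc n) H'}
  {S : Type*} [TopologicalSpace S] [ChartedSpace H' S] [IsManifold J ∞ S]
  {g : ContMDiffRiemannianMetric I ∞ (Euc (n + 1)) (TangentSpace I : M → Type _)}
  {t : ∀ x : M, Tractor I x} {ι : S → M} {ν : ∀ x : S, TangentSpace I (ι x) →L[ℝ] ℝ}

/-- An immersed hypersurface in the zero set of the scale of a parallel tractor. -/
structure IsEinsteinHypersurface (J : ModelWithCorners ℝ (Euc n) H')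
    (g : ContMDiffRiemannianMetric I ∞ (Euc (n + 1)) (TangentSpace I : M → Type _))
    (t : ∀ x : M, Tractor I x) (ι : S → M) (ν : ∀ x : S, TangentSpace I (ι x) →L[ℝ] ℝ) : Prop where
  smooth_tractor : SmoothTractorAlong I I id t univ
  parallel : IsParallelTractor I g.inner t
  smooth : ContMDiff J I ∞ ι
  immersion : ∀ x, Function.Injective (mfderiv J I ι x)
  zero : ∀ x, (t (ι x)).1 = 0
  ne_zero : ∀ x, (t (ι x)).2.1 ≠ 0
  conormal : SmoothTractorAlong I J ι (fun x => ((0, ν x, 0) : Tractor I (ι x))) univ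
  conormal_norm : ∀ x, tractorMetric I g.inner (ι x) (0, ν x, 0) (0, ν x, 0) = 1
  conormal_tangent : ∀ x (w : TangentSpace J x), ν x (mfderiv J I ι x w) = 0

/-- The factor between the conormal and the gradient of the scale. -/
def conormalFactor (g : ContMDiffRiemannianMetric I ∞ (Euc (n + 1)) (TangentSpace I : M → Type _))
    (t : ∀ x : M, Tractor I x) (ι : S → M) (ν : ∀ x : S, TangentSpace I (ι x) →L[ℝ] ℝ) (x : S) : ℝ :=
  tractorMetric I g.inner (ι x) (0, ν x, 0) (t (ι x))

theorem eq_smul_of_ker_le {E : Type*} [AddCommGroup E] [Module ℝ E] {φ ψ : E →ₗ[ℝ] ℝ}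
    (h : ∀ v, φ v = 0 → ψ v = 0) (hφ : φ ≠ 0) : ∃ r : ℝ, ψ = r • φ := by
  obtain ⟨v, hv⟩ : ∃ v, φ v ≠ 0 := by
    by_contra! h0
    exact hφ (LinearMap.ext h0)
  refine ⟨ψ v / φ v, LinearMap.ext fun w => ?_⟩
  have h1 := h (w - (φ w / φ v) • v) (by simp [hv])
  rw [map_sub, map_smul, sub_eq_zero, smul_eq_mul] at h1
  rw [h1, LinearMap.smul_apply, smul_eq_mul]
  field_simp

namespace IsEinsteinHypersurface

theorem mdifferentiableAt (h : IsEinsteinHypersurface J g t ι ν) (x : S) :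
    MDifferentiableAt J I ι x :=
  (h.smooth x).mdifferentiableAt (by simp)

theorem tractor_tangent (h : IsEinsteinHypersurface J g t ι ν) (x : S) (w : TangentSpace J x) :
    (t (ι x)).2.1 (mfderiv J I ι x w) = 0 := by
  have h1 := (mderiv_scale g h.smooth_tractor h.parallel (mem_univ x) (uniqueMDiffWithinAt_univ J)
    (h.mdifferentiableAt x).mdifferentiableWithinAt).2 w
  have h2 : (fun y => (t (ι y)).1) = fun _ => (0 : ℝ) := funext h.zero
  rw [h2, mderiv_const, mfderivWithin_univ] at h1
  exact h1.symm

theorem tractor_eq (h : IsEinsteinHypersurface J g t ι ν) (x : S) :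
    (t (ι x)).2.1 = conormalFactor g t ι ν x • ν x := by
  have hM := isMetricMatrix_metricCoords g (mem_extChartAt_target (I := I) (ι x))
  have hν : ν x ≠ 0 := by
    intro h0
    have := h.conormal_norm x
    rw [h0, tractorMetric_eq g (mem_extChartAt_source _), tractorBil_apply] at this
    simp [tractorCoords] at this
    exact absurd this (by simp [pair_apply])
  let φ : Euc (n + 1) →ₗ[ℝ] ℝ := (ν x).toLinearMap
  let ψ : Euc (n + 1) →ₗ[ℝ] ℝ := (t (ι x)).2.1.toLinearMap
  let L : Euc n →ₗ[ℝ] Euc (n + 1) := (mfderiv J I ι x).toLinearMap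
  have hφ : φ ≠ 0 := fun h0 => hν (ContinuousLinearMap.coe_injective h0)
  have hker : LinearMap.range L = LinearMap.ker φ := by
    refine Submodule.eq_of_le_of_finrank_eq ?_ ?_
    · rintro _ ⟨w, rfl⟩
      exact h.conormal_tangent x w
    · rw [LinearMap.finrank_range_of_inj (f := L) (h.immersion x)]
      have h3 := Module.Dual.finrank_ker_add_one_of_ne_zero (f := φ) hφ
      simp only [finrank_euclideanSpace, Fintype.card_fin] at h3 ⊢
      omega
  obtain ⟨r, hr⟩ := eq_smul_of_ker_le (φ := φ) (ψ := ψ) (fun v hv => by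
    obtain ⟨w, rfl⟩ : v ∈ LinearMap.range L := by rw [hker]; exact hv
    exact h.tractor_tangent x w) hφ
  have hr' : (t (ι x)).2.1 = r • ν x := ContinuousLinearMap.coe_injective hr
  have h4 : conormalFactor g t ι ν x = r := by
    have h5 := h.conormal_norm x
    rw [tractorMetric_eq g (mem_extChartAt_source _), tractorBil_apply] at h5
    rw [conormalFactor, tractorMetric_eq g (mem_extChartAt_source _), tractorBil_apply]
    have h6 : (tractorCoords I (ι x) (ι x) (t (ι x))).2.1 =
        r • (tractorCoords I (ι x) (ι x) (0, ν x, 0)).2.1 := by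
      funext i
      change (t (ι x)).2.1 _ = _
      rw [hr']
      rfl
    rw [h6, map_smul, map_smul, smul_eq_mul]
    simp only [tractorCoords, zero_mul, mul_zero, add_zero, h.zero] at h5 ⊢
    rw [h5, mul_one]
  rw [h4, hr']

theorem conormalFactor_ne_zero (h : IsEinsteinHypersurface J g t ι ν) (x : S) :
    conormalFactor g t ι ν x ≠ 0 := by
  intro h0
  have h1 := h.tractor_eq x
  rw [h0, zero_smul] at h1
  exact h.ne_zero x h1

theorem tractorMetric_self (h : IsEinsteinHypersurface J g t ι ν) (x : S) :
    tractorMetric I g.inner (ι x) (t (ι x)) (t (ι x)) = conormalFactor g t ι ν x ^ 2 := by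
  have h6 : (tractorCoords I (ι x) (ι x) (t (ι x))).2.1 =
      conormalFactor g t ι ν x • (tractorCoords I (ι x) (ι x) (0, ν x, 0)).2.1 := by
    funext i
    change (t (ι x)).2.1 _ = _
    rw [h.tractor_eq]
    rfl
  have h5 := h.conormal_norm x
  rw [tractorMetric_eq g (mem_extChartAt_source _), tractorBil_apply] at h5 ⊢
  rw [h6, map_smul, map_smul, map_smul, _root_.smul_apply, smul_eq_mul, smul_eq_mul]
  simp only [tractorCoords, zero_mul, mul_zero, add_zero, h.zero] at h5 ⊢
  rw [h5]
  ring

theorem eventually_conormalFactor (h : IsEinsteinHypersurface J g t ι ν) (x : S) :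
    ∀ᶠ y in 𝓝 x, conormalFactor g t ι ν y = conormalFactor g t ι ν x := by
  have h1 := (mderiv_tractorMetric g h.smooth_tractor h.parallel (mem_univ x)
    (uniqueMDiffWithinAt_univ J) (h.mdifferentiableAt x).mdifferentiableWithinAt
    (V := fun x => ((0, ν x, 0) : Tractor I (ι x)))
    ((h.conormal x (mem_univ x)).mdifferentiableWithinAt (by simp))).1.continuousWithinAt
  rw [continuousWithinAt_univ] at h1
  have h2 : ContinuousAt (conormalFactor g t ι ν) x := h1
  have h3 := (h2.mul_const (conormalFactor g t ι ν x)).eventually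
    (lt_mem_nhds (mul_self_pos.2 (h.conormalFactor_ne_zero x)))
  have h4 := (h.smooth.continuous.continuousAt (x := x)).eventually
    (eventually_tractorMetric_eq g h.smooth_tractor h.parallel (ι x))
  filter_upwards [h3, h4] with y h3 h4
  rw [h.tractorMetric_self, h.tractorMetric_self] at h4
  rcases sq_eq_sq_iff_eq_or_eq_neg.1 h4 with h5 | h5
  · exact h5
  · rw [h5] at h3
    nlinarith [mul_self_nonneg (conormalFactor g t ι ν x)]

end IsEinsteinHypersurface

end Hypersurface

section Hypersurface

variable {n : ℕ} {H : Type*} [TopologicalSpace H] {I : ModelWithCorners ℝ (Euc (n + 1)) H}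
  {M : Type*} [TopologicalSpace M] [ChartedSpace H M] [IsManifold I ∞ M]
  {H' : Type*} [TopologicalSpace H'] {J : ModelWithCorners ℝ (Euc n) H'}
  {S : Type*} [TopologicalSpace S] [ChartedSpace H' S] [IsManifold J ∞ S]
  {g : ContMDiffRiemannianMetric I ∞ (Euc (n + 1)) (TangentSpace I : M → Type _)}
  {t : ∀ x : M, Tractor I x} {ι : S → M} {ν : ∀ x : S, TangentSpace I (ι x) →L[ℝ] ℝ}

namespace IsEinsteinHypersurface

/-- The hypersurface is totally umbilic. -/
theorem secondFundamentalForm_eq (h : IsEinsteinHypersurface J g t ι ν) (x : S)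
    (w w' : TangentSpace J x) : secondFundamentalForm I J g.inner ι ν x w w' =
      -((conormalFactor g t ι ν x)⁻¹ * (t (ι x)).2.2) *
        g.inner (ι x) (mfderiv J I ι x w) (mfderiv J I ι x w') := by
  obtain ⟨U, hU, hUn, hc⟩ := exists_isParallelChart g h.smooth_tractor h.parallel (ι x)
  set G := metricCoords I g.inner (ι x)
  set c := (conormalFactor g t ι ν x)⁻¹
  let κ : S → Euc (n + 1) := fun y => extChartAt I (ι x) (ι y)
  have hz : κ x ∈ U := mem_of_mem_nhdsWithin (extChartAt_mem_range _ _) hUn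
  have hu := uniqueMDiffWithinAt_univ J (x := x)
  have hf := (h.mdifferentiableAt x).mdifferentiableWithinAt (s := univ)
  have hκ : MDifferentiableWithinAt J 𝓘(ℝ, Euc (n + 1)) κ univ x :=
    mdifferentiableWithinAt_extChartAt_comp hf (mem_extChartAt_source _)
  let L : TractorCoords (n + 1) →L[ℝ] TractorCoords (n + 1) :=
    c • ((ContinuousLinearMap.inr ℝ ℝ ((Fin (n + 1) → ℝ) × ℝ)).comp
      ((ContinuousLinearMap.inl ℝ (Fin (n + 1) → ℝ) ℝ).comp
        ((ContinuousLinearMap.fst ℝ (Fin (n + 1) → ℝ) ℝ).comp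
          (ContinuousLinearMap.snd ℝ ℝ ((Fin (n + 1) → ℝ) × ℝ)))))
  have hL : ∀ τ, L τ = (0, c • τ.2.1, 0) := fun τ => by
    refine Prod.ext ?_ (Prod.ext rfl ?_) <;> exact mul_zero c
  have hcoords : ∀ y, conormalFactor g t ι ν y = conormalFactor g t ι ν x →
      ι y ∈ (extChartAt I (ι x)).source →
      tractorCoords I (ι x) (ι y) (0, ν y, 0) = L (localTractor t (ι x) (κ y)) := fun y hy hy' => by
    rw [localTractor_source hy', hL]
    refine Prod.ext rfl (Prod.ext (pair_ext fun u => ?_) rfl)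
    rw [map_smul, _root_.smul_apply, pair_tractorCoords, pair_tractorCoords, h.tractor_eq y, hy,
      _root_.smul_apply, smul_smul, inv_mul_cancel₀ (h.conormalFactor_ne_zero x), one_smul]
  have hev : (fun y => tractorCoords I (ι x) (ι y) (0, ν y, 0)) =ᶠ[𝓝[univ] x]
      fun y => L (localTractor t (ι x) (κ y)) := by
    rw [nhdsWithin_univ]
    filter_upwards [h.eventually_conormalFactor x, (h.smooth.continuous.continuousAt (x := x)).eventually
      (extChartAt_source_mem_nhds (I := I) (ι x))] with y hy hy' using hcoords y hy hy'
  have hd := hc.metric.dom.differentiableWithinAt hc.smooth_tractor two_ne_zero hz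
  have hd' := hc.metric.dom.differentiableWithinAt (L.contDiff.comp_contDiffOn hc.smooth_tractor)
    two_ne_zero hz
  have h1 : mderiv J (fun y => tractorCoords I (ι x) (ι y) (0, ν y, 0)) univ x w =
      L (-tractorConn (range I) G (schoutenMatrix (range I) G) (κ x) (mderiv J κ univ x w)
        (localTractor t (ι x) (κ x))) := by
    rw [mderiv_congr (mem_univ x) hev]
    refine (mderiv_comp hu hd' (fun _ _ => extChartAt_mem_range _ _) hκ w).trans ?_
    refine (hc.metric.dom.fderivWithin_clm L hc.smooth_tractor two_ne_zero hz _).symm.trans ?_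
    exact congrArg L (eq_neg_of_add_eq_zero_left (hc.parallel _ hz _))
  have hv : ∀ w : TangentSpace J x, mderiv J κ univ x w =
      vecCoords I (ι x) (ι x) (mfderiv J I ι x w) := fun w => by
    have := vecCoords_mfderivWithin hu hf (mem_extChartAt_source (I := I) (ι x)) w
    rw [mfderivWithin_univ] at this
    exact this.symm
  rw [secondFundamentalForm, tractorDeriv_eq hu hf, tractorOfCoords_mid]
  unfold coordsDeriv
  rw [h1, hcoords x rfl (mem_extChartAt_source _), hv, hL, hL]
  change pair (c • (-(tractorConn _ _ _ _ _ _).2.1) + (tractorConn _ _ _ _ _ _).2.1) _ = _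
  rw [map_add, map_smul, map_neg, _root_.add_apply, _root_.smul_apply, _root_.neg_apply,
    pair_tractorConn, pair_tractorConn, localTractor_source (mem_extChartAt_source _),
    metricBil_metricCoords_source _ (mem_extChartAt_source _),
    fromCoords_vecCoords (mem_extChartAt_source _), fromCoords_vecCoords (mem_extChartAt_source _)]
  simp only [tractorCoords, h.zero, map_smul, _root_.smul_apply, smul_eq_mul]
  ring

theorem isMetricMatrix_inducedMetric (h : IsEinsteinHypersurface J g t ι ν) (x : S) :
    IsMetricMatrix (metricAt J (inducedMetric I J g.inner ι) x) where
  symm a b := g.symm _ _ _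
  pos u hu := by
    rw [metricAt, metricBil_metricCoords_source _ (mem_extChartAt_source _)]
    refine g.pos _ _ fun h0 => hu ?_
    refine fromCoords_injective (mem_extChartAt_source (I := J) x) ?_
    rw [map_zero]
    exact h.immersion x (h0.trans (map_zero _).symm)

theorem meanCurvature_eq (h : IsEinsteinHypersurface J g t ι ν) (hn : n ≠ 0) (x : S) :
    meanCurvature I J g.inner ι ν x = -((conormalFactor g t ι ν x)⁻¹ * (t (ι x)).2.2) := by
  have hM := h.isMetricMatrix_inducedMetric x
  have h1 : ∀ i j, secondFundamentalForm I J g.inner ι ν x (coordVec J x x i) (coordVec J x x j) =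
      -((conormalFactor g t ι ν x)⁻¹ * (t (ι x)).2.2) *
        metricAt J (inducedMetric I J g.inner ι) x i j := fun i j => by
    have h2 := metricBil_metricCoords_source (inducedMetric I J g.inner ι)
      (mem_extChartAt_source (I := J) x) (basisVec i) (basisVec j)
    rw [bil_basisVec] at h2
    rw [h.secondFundamentalForm_eq, metricAt, h2]
    rfl
  have h3 := hM.metricTrace_self
  rw [hM.metricTrace_eq] at h3
  have h4 : (n : ℝ) ≠ 0 := by exact_mod_cast hn
  rw [meanCurvature]
  simp only [h1, mul_left_comm _ (-((conormalFactor g t ι ν x)⁻¹ * (t (ι x)).2.2)),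
    ← Finset.mul_sum]
  rw [h3]
  field_simp

/-- The normal tractor is a multiple of the parallel tractor. -/
theorem normalTractor_eq (h : IsEinsteinHypersurface J g t ι ν) (hn : n ≠ 0) (x : S) :
    normalTractor I J g.inner ι ν x = (conormalFactor g t ι ν x)⁻¹ • t (ι x) := by
  refine Prod.ext ?_ (Prod.ext ?_ ?_)
  · simp [normalTractor, h.zero]
  · change ν x = (conormalFactor g t ι ν x)⁻¹ • (t (ι x)).2.1
    rw [h.tractor_eq, smul_smul, inv_mul_cancel₀ (h.conormalFactor_ne_zero x), one_smul]
  · change -meanCurvature I J g.inner ι ν x = (conormalFactor g t ι ν x)⁻¹ * (t (ι x)).2.2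
    rw [h.meanCurvature_eq hn, neg_neg]

/-- The hypersurface and the parallel tractor in adapted coordinates. -/
theorem exists_isHypersurfaceChart (h : IsEinsteinHypersurface J g t ι ν) (x : S) :
    ∃ U U', IsHypersurfaceChart (range I) U (metricCoords I g.inner (ι x)) (localTractor t (ι x))
        (range J) U' (localMap I J ι x) (conormalFactor g t ι ν x)⁻¹ ∧
      IsInducedMetric (metricCoords I g.inner (ι x)) (range J) U' (localMap I J ι x)
        (metricCoords J (inducedMetric I J g.inner ι) x) ∧
      extChartAt J x x ∈ U' ∧ ∀ z ∈ U', z ∈ (extChartAt J x).target ∧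
        ι ((extChartAt J x).symm z) ∈ (extChartAt I (ι x)).source ∧
        conormalFactor g t ι ν ((extChartAt J x).symm z) = conormalFactor g t ι ν x := by
  obtain ⟨U, hU, hUn, hc⟩ := exists_isParallelChart g h.smooth_tractor h.parallel (ι x)
  set c := (conormalFactor g t ι ν x)⁻¹ with hcdef
  have hsrc : ∀ᶠ y in 𝓝 x, ι y ∈ (extChartAt I (ι x)).source :=
    (h.smooth.continuous.continuousAt (x := x)).eventually (extChartAt_source_mem_nhds (I := I) (ι x))
  have hUx : ∀ᶠ y in 𝓝 x, extChartAt I (ι x) (ι y) ∈ U :=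
    (tendsto_nhdsWithin_iff.2 ⟨(continuousAt_extChartAt (ι x)).tendsto.comp
      (h.smooth.continuous.continuousAt (x := x)).tendsto, Eventually.of_forall fun y =>
      extChartAt_mem_range _ _⟩).eventually hUn
  obtain ⟨O, hO, hOo, hxO⟩ := eventually_nhds_iff.1 (hsrc.and (hUx.and (h.eventually_conormalFactor x)))
  let U' : Set (Euc n) := (extChartAt J x).target ∩ (extChartAt J x).symm ⁻¹' O
  have key : ∀ z ∈ U', z ∈ (extChartAt J x).target ∧
      ι ((extChartAt J x).symm z) ∈ (extChartAt I (ι x)).source ∧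
        conormalFactor g t ι ν ((extChartAt J x).symm z) = conormalFactor g t ι ν x := fun z hz =>
    ⟨hz.1, (hO _ hz.2).1, (hO _ hz.2).2.2⟩
  have hder : ∀ z ∈ U', ∀ u, mfderiv J I ι ((extChartAt J x).symm z)
      (fromCoords J x ((extChartAt J x).symm z) u) = fromCoords I (ι x) (ι ((extChartAt J x).symm z))
        (fderivWithin ℝ (localMap I J ι x) (range J) z u) := fun z hz u => by
    rw [mfderiv_fromCoords ((extChartAt J x).map_target hz.1) (key z hz).2.1 (h.mdifferentiableAt _),
      (extChartAt J x).right_inv hz.1]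
  have hF : ContDiffOn ℝ ∞ (localMap I J ι x) U' := by
    have h1 := h.smooth.comp_contMDiffOn ((contMDiffOn_extChartAt_symm (I := J) (n := ∞) x).mono
      (inter_subset_left (t := (extChartAt J x).symm ⁻¹' O)))
    have h2 := (contMDiffOn_extChartAt (I := I) (n := ∞) (x := ι x)).comp h1 fun z hz => by
      rw [← extChartAt_source I]
      exact (key z hz).2.1
    exact contMDiffOn_iff_contDiffOn.1 h2
  have hloc : ∀ z ∈ U', localTractor t (ι x) (localMap I J ι x z) =
      tractorCoords I (ι x) (ι ((extChartAt J x).symm z)) (t (ι ((extChartAt J x).symm z))) :=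
    fun z hz => localTractor_source (key z hz).2.1
  refine ⟨U, U', ⟨hc.metric, hc.smooth_tractor, hc.parallel, ⟨J.convex_range, J.nonempty_interior,
    fun z hz => extChartAt_target_subset_range x hz.1, fun z hz => ?_⟩, hF,
    fun z hz => (hO _ hz.2).2.1, fun z hz => ?_, fun z hz => ?_, fun z hz => ?_⟩, fun z hz i j => ?_,
    ⟨mem_extChartAt_target x, ?_⟩, key⟩
  · have h1 := extChartAt_target_mem_nhdsWithin_of_mem (I := J) hz.1
    refine inter_mem h1 ?_
    exact ((continuousOn_extChartAt_symm x z hz.1).mono_of_mem_nhdsWithin h1).preimage_mem_nhdsWithin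
      (hOo.mem_nhds hz.2)
  · intro u v huv
    refine fromCoords_injective ((extChartAt J x).map_target hz.1) (h.immersion _ ?_)
    rw [hder z hz, hder z hz, huv]
  · rw [hloc z hz]
    exact h.zero _
  · have h1 := h.tractorMetric_self ((extChartAt J x).symm z)
    rw [tractorMetric_eq g (key z hz).2.1, (key z hz).2.2, tractorBil_apply] at h1
    rw [hloc z hz]
    simp only [tractorCoords, h.zero, zero_mul, mul_zero, add_zero] at h1 ⊢
    refine (congrArg (c ^ 2 * ·) h1).trans ?_
    rw [← mul_pow, inv_mul_cancel₀ (h.conormalFactor_ne_zero x), one_pow]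
  · rw [localMap, metricBil_metricCoords_source _ (key z hz).2.1]
    exact (congrArg₂ (fun a b => g.inner _ a b) (hder z hz _) (hder z hz _))
  · change (extChartAt J x).symm (extChartAt J x x) ∈ O
    rw [extChartAt_to_inv]
    exact hxO

end IsEinsteinHypersurface

end Hypersurface

theorem tractorConn_congr {d : ℕ} {s : Set (Euc d)} {G Q Q' : Euc d → Matrix (Fin d) (Fin d) ℝ}
    {z : Euc d} (hQ : Q z = Q' z) : tractorConn s G Q z = tractorConn s G Q' z := by
  refine ContinuousLinearMap.ext fun u => ContinuousLinearMap.ext fun τ => ?_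
  refine Prod.ext (by rw [tractorConn_fst, tractorConn_fst]) (Prod.ext (pair_ext fun y => ?_) ?_)
  · rw [pair_tractorConn, pair_tractorConn, hQ]
  · rw [tractorConn_snd_snd, tractorConn_snd_snd, hQ]

section Hypersurface

variable {n : ℕ} {H : Type*} [TopologicalSpace H] {I : ModelWithCorners ℝ (Euc (n + 1)) H}
  {M : Type*} [TopologicalSpace M] [ChartedSpace H M] [IsManifold I ∞ M]
  {H' : Type*} [TopologicalSpace H'] {J : ModelWithCorners ℝ (Euc n) H'}
  {S : Type*} [TopologicalSpace S] [ChartedSpace H' S] [IsManifold J ∞ S]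
  {g : ContMDiffRiemannianMetric I ∞ (Euc (n + 1)) (TangentSpace I : M → Type _)}
  {t : ∀ x : M, Tractor I x} {ι : S → M} {ν : ∀ x : S, TangentSpace I (ι x) →L[ℝ] ℝ}

theorem tractorMetric_smul_right (x : M) (τ τ' : Tractor I x) (r : ℝ) :
    tractorMetric I g.inner x τ (r • τ') = r * tractorMetric I g.inner x τ τ' := by
  rw [tractorMetric_eq g (mem_extChartAt_source _), tractorMetric_eq g (mem_extChartAt_source _),
    tractorCoords_smul, map_smul, smul_eq_mul]

theorem tractorMetric_zero_left (x : M) (τ : Tractor I x) : tractorMetric I g.inner x 0 τ = 0 := by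
  rw [tractorMetric_eq g (mem_extChartAt_source _)]
  exact congrArg (fun L : TractorCoords (n + 1) →L[ℝ] ℝ => L _) (map_zero (tractorBil _))

namespace IsEinsteinHypersurface

theorem inSigmaBundle_iff (h : IsEinsteinHypersurface J g t ι ν) (hn : n ≠ 0) (x : S)
    (τ : Tractor I (ι x)) : InSigmaBundle I J g.inner ι ν x τ ↔
      tractorMetric I g.inner (ι x) τ (t (ι x)) = 0 := by
  rw [InSigmaBundle, h.normalTractor_eq hn, tractorMetric_smul_right,
    mul_eq_zero_iff_left (inv_ne_zero (h.conormalFactor_ne_zero x))]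

theorem sigmaProj_of_mem {x : S} {τ : Tractor I (ι x)} (hτ : InSigmaBundle I J g.inner ι ν x τ) :
    sigmaProj I J g.inner ι ν x τ = τ := by
  rw [InSigmaBundle] at hτ
  rw [sigmaProj, hτ, zero_smul, sub_zero]

theorem mfderiv_eq (h : IsEinsteinHypersurface J g t ι ν) (x : S) (u : TangentSpace J x) :
    vecCoords I (ι x) (ι x) (mfderiv J I ι x u) = fderivWithin ℝ (localMap I J ι x) (range J)
      (extChartAt J x x) (vecCoords J x x u) := by
  have h1 := mfderiv_fromCoords (mem_extChartAt_source (I := J) x)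
    (mem_extChartAt_source (I := I) (ι x)) (h.mdifferentiableAt x) (vecCoords J x x u)
  rw [fromCoords_vecCoords (mem_extChartAt_source _)] at h1
  rw [h1, vecCoords_fromCoords (mem_extChartAt_source _)]

/-- The tangential projection is the adjoint of the inclusion. -/
theorem metricBil_tangentProj (h : IsEinsteinHypersurface J g t ι ν) (x : S)
    (v : TangentSpace I (ι x)) (w : Euc n) :
    metricBil (metricCoords J (inducedMetric I J g.inner ι) x (extChartAt J x x))
      (vecCoords J x x (tangentProj I J g.inner ι x v)) w =
      metricBil (metricCoords I g.inner (ι x) (localMap I J ι x (extChartAt J x x)))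
        (vecCoords I (ι x) (ι x) v)
        (fderivWithin ℝ (localMap I J ι x) (range J) (extChartAt J x x) w) := by
  have hM := h.isMetricMatrix_inducedMetric x
  rw [metricAt] at hM
  let m : Fin n → ℝ := fun j => g.inner (ι x) (mfderiv J I ι x (fromCoords J x x (basisVec j))) v
  have h1 : vecCoords J x x (tangentProj I J g.inner ι x v) =
      sharp (metricCoords J (inducedMetric I J g.inner ι) x (extChartAt J x x)) m := by
    have h2 : tangentProj I J g.inner ι x v = ∑ i, (∑ j,
        (metricAt J (inducedMetric I J g.inner ι) x)⁻¹ i j * m j) • coordVec J x x i := by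
      simp only [tangentProj, _root_.sum_apply, _root_.smul_apply,
        ContinuousLinearMap.smulRight_apply, smul_smul, Finset.sum_smul]
      rfl
    rw [h2, map_sum]
    simp only [map_smul, coordVec_eq, vecCoords_fromCoords (mem_extChartAt_source (I := J) x)]
    exact sum_smul_basisVec (sharp (metricCoords J (inducedMetric I J g.inner ι) x
      (extChartAt J x x)) m)
  rw [h1, hM.bil_sharp, localMap_source (mem_extChartAt_source _),
    metricBil_metricCoords_source _ (mem_extChartAt_source _),
    fromCoords_vecCoords (mem_extChartAt_source _),
    ← mfderiv_fromCoords (mem_extChartAt_source (I := J) x)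
    (mem_extChartAt_source (I := I) (ι x)) (h.mdifferentiableAt x)]
  let L : Euc n →L[ℝ] ℝ := (show Euc (n + 1) →L[ℝ] ℝ from g.inner (ι x) v).comp
    ((show Euc n →L[ℝ] Euc (n + 1) from mfderiv J I ι x).comp (fromCoords J x x))
  have hm : m = fun j => L (basisVec j) := funext fun j => g.symm (ι x) _ _
  rw [hm]
  exact pair_clm L w

/-- The components of the canonical isomorphism. -/
theorem tractorCoords_toIntrinsic (h : IsEinsteinHypersurface J g t ι ν) (hn : n ≠ 0) {x y : S}
    (hy : y ∈ (extChartAt J x).source) (hy' : ι y ∈ (extChartAt I (ι x)).source)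
    (hc : conormalFactor g t ι ν y = conormalFactor g t ι ν x) (τ : Tractor I (ι y)) :
    tractorCoords J x y (toIntrinsic I J g.inner ι ν y τ) =
      toIntrinsicMap (localTractor t (ι x)) (range J) (localMap I J ι x)
        (conormalFactor g t ι ν x)⁻¹ (extChartAt J x y) (tractorCoords I (ι x) (ι y) τ) := by
  rw [toIntrinsicMap_apply, localMap_source hy, localTractor_source hy']
  refine Prod.ext rfl (Prod.ext (pair_ext fun u => ?_) ?_)
  · rw [pair_tractorCoords, pair_restrictCov, pair_tractorCoords,
      ← mfderiv_fromCoords hy hy' (h.mdifferentiableAt y)]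
    change τ.2.1 _ - _ * ν y (mfderiv J I ι y _) = _
    rw [h.conormal_tangent, mul_zero, sub_zero]
    rfl
  · change τ.2.2 + 1 / 2 * meanCurvature I J g.inner ι ν y ^ 2 * τ.1 =
      τ.2.2 + 1 / 2 * ((conormalFactor g t ι ν x)⁻¹ * (t (ι y)).2.2) ^ 2 * τ.1
    rw [h.meanCurvature_eq hn, hc, neg_sq]

theorem ofIntrinsic_toIntrinsic (h : IsEinsteinHypersurface J g t ι ν) (x : S) {τ : Tractor I (ι x)}
    (hτ : InSigmaBundle I J g.inner ι ν x τ) :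
    ofIntrinsic I J g.inner ι ν x (toIntrinsic I J g.inner ι ν x τ) = τ := by
  obtain ⟨U, U', hc, hG', hxU, hU'⟩ := h.exists_isHypersurfaceChart x
  set c := (conormalFactor g t ι ν x)⁻¹ with hcdef
  set Hm := meanCurvature I J g.inner ι ν x with hHm
  refine Prod.ext rfl (Prod.ext ?_ ?_)
  swap
  · change τ.2.2 + 1 / 2 * Hm ^ 2 * τ.1 - 1 / 2 * Hm ^ 2 * τ.1 = τ.2.2
    ring
  ext v
  let θ : TangentSpace I (ι x) →L[ℝ] ℝ := τ.2.1 - (Hm * τ.1) • ν x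
  change θ (mfderiv J I ι x (tangentProj I J g.inner ι x v)) + (Hm * τ.1) * ν x v = τ.2.1 v
  have h1 := hc.decomp hG' hxU (h.metricBil_tangentProj x v)
  rw [← h.mfderiv_eq] at h1
  have h2 := congrArg (pair (tractorCoords I (ι x) (ι x) ((0, θ, 0) : Tractor I (ι x))).2.1) h1
  rw [map_add, map_smul, pair_tractorCoords, pair_tractorCoords,
    fromCoords_vecCoords (mem_extChartAt_source _), fromCoords_vecCoords (mem_extChartAt_source _)] at h2
  have h3 : pair (tractorCoords I (ι x) (ι x) ((0, θ, 0) : Tractor I (ι x))).2.1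
      (sharp (metricCoords I g.inner (ι x) (localMap I J ι x (extChartAt J x x)))
        (localTractor t (ι x) (localMap I J ι x (extChartAt J x x))).2.1) = 0 := by
    rw [localMap_source (mem_extChartAt_source _), localTractor_source (mem_extChartAt_source _)]
    have h4 := h.conormal_norm x
    rw [InSigmaBundle, tractorMetric_eq g (mem_extChartAt_source _), tractorBil_apply] at hτ
    rw [tractorMetric_eq g (mem_extChartAt_source _), tractorBil_apply] at h4
    have h5 : (tractorCoords I (ι x) (ι x) (t (ι x))).2.1 =
        conormalFactor g t ι ν x • (tractorCoords I (ι x) (ι x) ((0, ν x, 0) : Tractor I (ι x))).2.1 :=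
      pair_ext fun u => by
        rw [map_smul, _root_.smul_apply, pair_tractorCoords, pair_tractorCoords, h.tractor_eq]
        rfl
    have h6 : (tractorCoords I (ι x) (ι x) ((0, θ, 0) : Tractor I (ι x))).2.1 =
        (tractorCoords I (ι x) (ι x) τ).2.1 -
          (Hm * τ.1) • (tractorCoords I (ι x) (ι x) ((0, ν x, 0) : Tractor I (ι x))).2.1 := rfl
    have h7 : (tractorCoords I (ι x) (ι x) (normalTractor I J g.inner ι ν x)).2.1 =
        (tractorCoords I (ι x) (ι x) ((0, ν x, 0) : Tractor I (ι x))).2.1 := rfl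
    rw [h7] at hτ
    rw [h5, h6, map_smul, map_smul, map_sub, map_smul, _root_.sub_apply, _root_.smul_apply,
      smul_eq_mul, smul_eq_mul]
    simp only [tractorCoords, normalTractor, mul_zero, add_zero] at h4 hτ ⊢
    rw [h4]
    rw [← hHm] at hτ
    linear_combination conormalFactor g t ι ν x * hτ
  rw [h3, smul_zero, add_zero] at h2
  change θ v = θ _ at h2
  rw [← h2]
  change τ.2.1 v - (Hm * τ.1) * ν x v + _ = _
  ring

variable {EB : Type*} [NormedAddCommGroup EB] [NormedSpace ℝ EB]
  {HB : Type*} [TopologicalSpace HB] {K : ModelWithCorners ℝ EB HB}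
  {B : Type*} [TopologicalSpace B] [ChartedSpace HB B]

/-- The tractor connection preserves the complement of the normal tractor. -/
theorem inSigmaBundle_tractorDeriv (h : IsEinsteinHypersurface J g t ι ν) (hn : n ≠ 0) {f : B → S}
    {V : ∀ b, Tractor I (ι (f b))} {T : Set B} {b : B} (hb : b ∈ T)
    (hu : UniqueMDiffWithinAt K T b) (hf : MDifferentiableWithinAt K J f T b)
    (hV : MDifferentiableWithinAt K 𝓘(ℝ, TractorCoords (n + 1))
      (fun b' => tractorCoords I (ι (f b)) (ι (f b')) (V b')) T b)
    (hV0 : ∀ b ∈ T, InSigmaBundle I J g.inner ι ν (f b) (V b)) (w : TangentSpace K b) :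
    InSigmaBundle I J g.inner ι ν (f b) (tractorDeriv I K g.inner (fun b' => ι (f b')) V T b w) := by
  have h1 := (mderiv_tractorMetric g h.smooth_tractor h.parallel hb hu
    ((h.mdifferentiableAt (f b)).comp_mdifferentiableWithinAt b hf) hV).2 w
  have h2 : (fun b' => tractorMetric I g.inner (ι (f b')) (V b') (t (ι (f b')))) =ᶠ[𝓝[T] b]
      fun _ => 0 :=
    eventually_of_mem self_mem_nhdsWithin fun b' hb' => (h.inSigmaBundle_iff hn _ _).1 (hV0 b' hb')
  rw [h.inSigmaBundle_iff hn]
  refine h1.symm.trans ?_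
  exact (congrArg (fun L : EB →L[ℝ] ℝ => L w) (mderiv_congr hb h2)).trans (by
    rw [mderiv_const]; rfl)

/-- The tractor connection restricts to the intrinsic tractor connection. -/
theorem sigmaDeriv_eq_tractorDeriv (h : IsEinsteinHypersurface J g t ι ν) (hn : 2 ≤ n) {f : B → S}
    {V : ∀ b, Tractor I (ι (f b))} {T : Set B} {b : B} (hb : b ∈ T)
    (hu : UniqueMDiffWithinAt K T b) (hf : MDifferentiableWithinAt K J f T b)
    (hV : MDifferentiableWithinAt K 𝓘(ℝ, TractorCoords (n + 1))
      (fun b' => tractorCoords I (ι (f b)) (ι (f b')) (V b')) T b)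
    (hV0 : ∀ b ∈ T, InSigmaBundle I J g.inner ι ν (f b) (V b)) (w : TangentSpace K b) :
    sigmaDeriv I J g.inner ι ν K f V T b w =
      tractorDeriv I K g.inner (fun b' => ι (f b')) V T b w := by
  have hn0 : n ≠ 0 := by omega
  have hmem := h.inSigmaBundle_tractorDeriv hn0 hb hu hf hV hV0 w
  unfold sigmaDeriv
  split_ifs with h2
  · exact sigmaProj_of_mem hmem
  have hn3 : 3 ≤ n := by omega
  obtain ⟨U, U', hc, hG', hxU, hU'⟩ := h.exists_isHypersurfaceChart (f b)
  set c := (conormalFactor g t ι ν (f b))⁻¹ with hcdef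
  set F := localMap I J ι (f b)
  set Ψ := toIntrinsicMap (localTractor t (ι (f b))) (range J) F c
  let κ : B → Euc n := fun b' => extChartAt J (f b) (f b')
  let τ : B → TractorCoords (n + 1) := fun b' => tractorCoords I (ι (f b)) (ι (f b')) (V b')
  have hιf := (h.mdifferentiableAt (f b)).comp_mdifferentiableWithinAt b hf
  have hκ : MDifferentiableWithinAt K 𝓘(ℝ, Euc n) κ T b :=
    mdifferentiableWithinAt_extChartAt_comp hf (mem_extChartAt_source _)
  have hsrc : ∀ᶠ b' in 𝓝[T] b, f b' ∈ (extChartAt J (f b)).source :=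
    hf.continuousWithinAt.eventually (extChartAt_source_mem_nhds (I := J) (f b))
  have hsrc' : ∀ᶠ b' in 𝓝[T] b, ι (f b') ∈ (extChartAt I (ι (f b))).source :=
    hιf.continuousWithinAt.eventually (extChartAt_source_mem_nhds (I := I) (ι (f b)))
  have hfac := hf.continuousWithinAt.eventually (h.eventually_conormalFactor (f b))
  have hev : (fun b' => tractorCoords J (f b) (f b') (toIntrinsic I J g.inner ι ν (f b') (V b')))
      =ᶠ[𝓝[T] b] fun b' => Ψ (κ b') (τ b') := by
    filter_upwards [hsrc, hsrc', hfac] with b' h1 h2 h3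
    exact h.tractorCoords_toIntrinsic hn0 h1 h2 h3 (V b')
  have hev' : (fun b' => extChartAt I (ι (f b)) (ι (f b'))) =ᶠ[𝓝[T] b] fun b' => F (κ b') := by
    filter_upwards [hsrc] with b' h1
    exact (localMap_source h1).symm
  have hFd : mderiv K (fun b' => extChartAt I (ι (f b)) (ι (f b'))) T b w =
      fderivWithin ℝ F (range J) (κ b) (mderiv K κ T b w) :=
    (congrArg (fun L : EB →L[ℝ] Euc (n + 1) => L w) (mderiv_congr hb hev')).trans
      (mderiv_comp hu (hc.dom.differentiableWithinAt hc.smooth (by simp) hxU)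
        (fun _ _ => extChartAt_mem_range _ _) hκ w)
  have hΨd := (mderiv_clm_apply hu (hc.dom.differentiableWithinAt hc.contDiffOn_toIntrinsicMap
    (by simp) hxU) (fun _ _ => extChartAt_mem_range _ _) hκ hV).2 w
  have h0 : tractorBil (metricCoords I g.inner (ι (f b)) (F (κ b))) (τ b)
      (localTractor t (ι (f b)) (F (κ b))) = 0 := by
    have h1 := (h.inSigmaBundle_iff hn0 _ _).1 (hV0 b hb)
    rw [tractorMetric_eq g (mem_extChartAt_source _)] at h1
    rw [← localTractor_source (t := t) (mem_extChartAt_source _)] at h1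
    rw [show F (κ b) = _ from localMap_source (mem_extChartAt_source _)]
    exact h1
  have hint := hc.cderiv_toIntrinsicMap hG' hxU (contDiffOn_const (c := τ b)) h0 (mderiv K κ T b w)
  have hconn : coordsDeriv (inducedMetric I J g.inner ι) K f
      (fun b' => toIntrinsic I J g.inner ι ν (f b') (V b')) T b w =
      Ψ (κ b) (coordsDeriv g.inner K (fun b' => ι (f b')) V T b w) := by
    have hb0 : tractorCoords J (f b) (f b) (toIntrinsic I J g.inner ι ν (f b) (V b)) =
      Ψ (κ b) (τ b) := hev.self_of_nhdsWithin hb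
    unfold coordsDeriv
    beta_reduce
    rw [mderiv_congr hb hev, hΨd, hb0,
      ← tractorConn_congr (hc.gaussSchouten_eq hG' hn3 hxU), hFd, map_add,
      ← hc.dom.fderivWithin_apply_const hc.contDiffOn_toIntrinsicMap (by simp) hxU]
    rw [cderiv, cderiv, fderivWithin_const_apply, _root_.zero_apply, zero_add,
      IsHypersurfaceChart.alongConn_apply] at hint
    rw [show F (κ b) = _ from localMap_source (mem_extChartAt_source _)] at hint
    rw [add_right_comm]
    refine (congrArg (· + _) hint).trans ?_
    rw [add_comm]
  have hres : tractorDeriv J K (inducedMetric I J g.inner ι) f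
      (fun b' => toIntrinsic I J g.inner ι ν (f b') (V b')) T b w =
      toIntrinsic I J g.inner ι ν (f b)
        (tractorDeriv I K g.inner (fun b' => ι (f b')) V T b w) := by
    refine tractorCoords_injective (f b) ?_
    rw [tractorCoords_tractorDeriv hu hf, hconn, h.tractorCoords_toIntrinsic hn0
      (mem_extChartAt_source _) (mem_extChartAt_source _) rfl]
    exact congrArg (Ψ (κ b)) (tractorCoords_tractorDeriv hu hιf g.inner w).symm
  rw [hres]
  exact h.ofIntrinsic_toIntrinsic (f b) hmem

end IsEinsteinHypersurface

end Hypersurface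

theorem curv_eq_sum {d : ℕ} {𝔄 : Type*} [NormedRing 𝔄] [NormedAlgebra ℝ 𝔄] (s : Set (Euc d))
    (A : Euc d → Euc d →L[ℝ] 𝔄) (z u v : Euc d) :
    curv s A z u v = ∑ a, ∑ b, (u a * v b) • curv s A z (basisVec a) (basisVec b) := by
  conv_lhs => rw [← sum_smul_basisVec u, ← sum_smul_basisVec v, curv_sum_left]
  refine Finset.sum_congr rfl fun a _ => ?_
  rw [curv_sum_right]
  refine Finset.sum_congr rfl fun b _ => ?_
  rw [curv_smul_left, curv_smul_right, smul_smul]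

theorem curv_congr {E T : Type*} [NormedAddCommGroup E] [NormedSpace ℝ E] [NormedRing T]
    [NormedAlgebra ℝ T] {s U : Set E} (h : IsChartDomain s U) {A A' : E → E →L[ℝ] T}
    (hA : EqOn A A' U) {z : E} (hz : z ∈ U) (u v : E) : curv s A z u v = curv s A' z u v := by
  rw [curv, curv, h.fderivWithin_congr hA hz, hA hz]

theorem chartTractorDeriv_eq {d : ℕ} (s : Set (Euc d)) (G : Euc d → Matrix (Fin d) (Fin d) ℝ)
    (a : Fin d) (t : Euc d → TractorCoords d) :
    chartTractorDeriv s G a t = cderiv s (tractorConn s G (schoutenMatrix s G)) (basisVec a) t := by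
  funext z
  rw [chartTractorDeriv, cderiv, tractorConn_apply_eq_tractorForm]
  rfl

theorem IsSmoothMetric.chartTractorCurv_eq {d : ℕ} {s U : Set (Euc d)}
    {G : Euc d → Matrix (Fin d) (Fin d) ℝ} (hG : IsSmoothMetric s U G) {z : Euc d} (hz : z ∈ U)
    (a b : Fin d) (t : TractorCoords d) : chartTractorCurv s G a b t z =
      curv s (tractorConn s G (schoutenMatrix s G)) z (basisVec a) (basisVec b) t := by
  simp only [chartTractorCurv, chartTractorDeriv_eq]
  exact cderiv_cderiv_sub hG.dom (hG.contDiffOn_tractorConn hG.isSmoothSymm_schoutenMatrix)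
    contDiffOn_const hz _ _

/-- The components of the tractor curvature. -/
theorem tractorCoords_tractorCurv {d : ℕ} {H : Type*} [TopologicalSpace H]
    {I : ModelWithCorners ℝ (Euc d) H} {M : Type*} [TopologicalSpace M] [ChartedSpace H M]
    [IsManifold I ∞ M] {g : MetricField I M} {x : M} {U : Set (Euc d)}
    (hG : IsSmoothMetric (range I) U (metricCoords I g x)) (hx : extChartAt I x x ∈ U)
    (u v : TangentSpace I x) (τ : Tractor I x) :
    tractorCoords I x x (tractorCurv I g x u v τ) =
      curv (range I) (tractorConn (range I) (metricCoords I g x)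
        (schoutenMatrix (range I) (metricCoords I g x))) (extChartAt I x x) (vecCoords I x x u)
        (vecCoords I x x v) (tractorCoords I x x τ) := by
  rw [tractorCurv, tractorCoords_tractorOfCoords, curv_eq_sum]
  simp only [hG.chartTractorCurv_eq hx, _root_.sum_apply, _root_.smul_apply]

section Hypersurface

variable {n : ℕ} {H : Type*} [TopologicalSpace H] {I : ModelWithCorners ℝ (Euc (n + 1)) H}
  {M : Type*} [TopologicalSpace M] [ChartedSpace H M] [IsManifold I ∞ M]
  {H' : Type*} [TopologicalSpace H'] {J : ModelWithCorners ℝ (Euc n) H'}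
  {S : Type*} [TopologicalSpace S] [ChartedSpace H' S] [IsManifold J ∞ S]
  {g : ContMDiffRiemannianMetric I ∞ (Euc (n + 1)) (TangentSpace I : M → Type _)}
  {t : ∀ x : M, Tractor I x} {ι : S → M} {ν : ∀ x : S, TangentSpace I (ι x) →L[ℝ] ℝ}

namespace IsEinsteinHypersurface

/-- The projection onto the complement of the normal tractor in components. -/
theorem chartSigmaProj_eq (h : IsEinsteinHypersurface J g t ι ν) (hn : n ≠ 0) {x : S} {z : Euc n}
    (hz : ι ((extChartAt J x).symm z) ∈ (extChartAt I (ι x)).source)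
    (hc : conormalFactor g t ι ν ((extChartAt J x).symm z) = conormalFactor g t ι ν x)
    (τ : TractorCoords (n + 1)) : chartSigmaProj I J g.inner ι ν x z τ =
      normalProj (metricCoords I g.inner (ι x)) (localTractor t (ι x)) (localMap I J ι x)
        (conormalFactor g t ι ν x)⁻¹ z τ := by
  have h1 : tractorCoords I (ι x) (ι ((extChartAt J x).symm z))
      (normalTractor I J g.inner ι ν ((extChartAt J x).symm z)) =
      (conormalFactor g t ι ν x)⁻¹ • localTractor t (ι x) (localMap I J ι x z) := by
    rw [h.normalTractor_eq hn, hc, tractorCoords_smul]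
    exact congrArg _ (localTractor_source hz).symm
  simp only [chartSigmaProj]
  rw [h1, ← tractorBil_eq, map_smul, smul_smul, smul_eq_mul, normalProj]
  congr 2
  change _ * tractorBil (metricCoords I g.inner (ι x) (localMap I J ι x z)) _ _ * _ = _
  ring

theorem tractorCoords_sigmaProj (h : IsEinsteinHypersurface J g t ι ν) (hn : n ≠ 0) (x : S)
    (τ : Tractor I (ι x)) : tractorCoords I (ι x) (ι x) (sigmaProj I J g.inner ι ν x τ) =
      normalProj (metricCoords I g.inner (ι x)) (localTractor t (ι x)) (localMap I J ι x)
        (conormalFactor g t ι ν x)⁻¹ (extChartAt J x x) (tractorCoords I (ι x) (ι x) τ) := by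
  rw [sigmaProj, h.normalTractor_eq hn, tractorMetric_smul_right, tractorCoords_sub,
    tractorCoords_smul, tractorCoords_smul, smul_smul, normalProj,
    tractorMetric_eq g (mem_extChartAt_source _), localMap_source (mem_extChartAt_source _),
    localTractor_source (mem_extChartAt_source _)]
  congr 2
  ring

/-- The curvature of the projected connection in components. -/
theorem tractorCoords_projectedCurv (h : IsEinsteinHypersurface J g t ι ν) (hn : n ≠ 0) (x : S)
    (u v : TangentSpace J x) (τ : Tractor I (ι x)) :
    tractorCoords I (ι x) (ι x) (projectedCurv I J g.inner ι ν x u v τ) =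
      curv (range I) (tractorConn (range I) (metricCoords I g.inner (ι x))
        (schoutenMatrix (range I) (metricCoords I g.inner (ι x))))
        (localMap I J ι x (extChartAt J x x))
        (fderivWithin ℝ (localMap I J ι x) (range J) (extChartAt J x x) (vecCoords J x x u))
        (fderivWithin ℝ (localMap I J ι x) (range J) (extChartAt J x x) (vecCoords J x x v))
        (normalProj (metricCoords I g.inner (ι x)) (localTractor t (ι x)) (localMap I J ι x)
          (conormalFactor g t ι ν x)⁻¹ (extChartAt J x x) (tractorCoords I (ι x) (ι x) τ)) := by
  obtain ⟨U, U', hc, hG', hxU, hU'⟩ := h.exists_isHypersurfaceChart x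
  set c := (conormalFactor g t ι ν x)⁻¹ with hcdef
  set G := metricCoords I g.inner (ι x)
  set F := localMap I J ι x
  set Q := normalProj G (localTractor t (ι x)) F c with hQdef
  set A := IsHypersurfaceChart.alongConn (range I) G (range J) F
  have hproj : ∀ z ∈ U', ∀ τ, chartSigmaProj I J g.inner ι ν x z τ = Q z τ := fun z hz τ =>
    h.chartSigmaProj_eq hn (hU' z hz).2.1 (hU' z hz).2.2 τ
  have hderiv : ∀ i : Fin n, ∀ W W' : Euc n → TractorCoords (n + 1), EqOn W W' U' →
      ContDiffOn ℝ 1 W' U' →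
      (∀ y ∈ U', tractorBil (G (F y)) (W' y) (localTractor t (ι x) (F y)) = 0) →
      EqOn (chartSigmaDeriv I J g.inner ι ν x i W) (cderiv (range J) A (basisVec i) W') U' := by
    intro i W W' hWW hW hW0 z hz
    have h1 : chartSigmaDeriv I J g.inner ι ν x i W z =
        Q z (cderiv (range J) A (basisVec i) W z) := by
      rw [cderiv, IsHypersurfaceChart.alongConn_apply, tractorConn_apply_eq_tractorForm]
      exact hproj z hz _
    rw [h1, hc.dom.cderiv_congr hWW hz]
    exact IsHypersurfaceChart.normalProj_of_orthogonal (hc.tractorBil_cderiv hz hW hW0 _)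
  let W : Euc n → TractorCoords (n + 1) := fun z => Q z (tractorCoords I (ι x) (ι x) τ)
  have hW : ContDiffOn ℝ 2 W U' := hc.contDiffOn_normalProj two_le_infty contDiffOn_const
  have hW0 : ∀ y ∈ U', tractorBil (G (F y)) (W y) (localTractor t (ι x) (F y)) = 0 :=
    fun y hy => hc.tractorBil_normalProj hy _
  have hdd : ∀ i j : Fin n, chartSigmaDeriv I J g.inner ι ν x i (chartSigmaDeriv I J g.inner ι ν x j
      fun z => chartSigmaProj I J g.inner ι ν x z (tractorCoords I (ι x) (ι x) τ))
        (extChartAt J x x) = cderiv (range J) A (basisVec i) (cderiv (range J) A (basisVec j) W)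
          (extChartAt J x x) := fun i j =>
    hderiv i _ _ (hderiv j _ W (fun z hz => hproj z hz _) (hW.of_le one_le_two) hW0)
      (contDiffOn_cderiv hc.dom hc.contDiffOn_alongConn hW (by norm_num) (by simp) _)
      (fun y hy => hc.tractorBil_cderiv hy (hW.of_le one_le_two) hW0 _) hxU
  simp only [projectedCurv]
  rw [tractorCoords_tractorOfCoords]
  simp only [hdd, A, hc.cderiv_cderiv_alongConn hxU hW]
  rw [clm_eq_sum (fderivWithin ℝ F (range J) (extChartAt J x x)) (vecCoords J x x u),
    clm_eq_sum (fderivWithin ℝ F (range J) (extChartAt J x x)) (vecCoords J x x v), curv_sum_left,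
    _root_.sum_apply]
  refine Finset.sum_congr rfl fun i _ => ?_
  rw [curv_sum_right, _root_.sum_apply]
  refine Finset.sum_congr rfl fun j _ => ?_
  rw [curv_smul_left, curv_smul_right, smul_smul]
  rfl

/-- The tractor curvature in tangential directions is the curvature of the intrinsic connection. -/
theorem tractorCurv_eq_sigmaCurv (h : IsEinsteinHypersurface J g t ι ν) (hn : 2 ≤ n) (x : S)
    (u v : TangentSpace J x) (τ : Tractor I (ι x)) :
    tractorCurv I g.inner (ι x) (mfderiv J I ι x u) (mfderiv J I ι x v) τ =
      sigmaCurv I J g.inner ι ν x u v (sigmaProj I J g.inner ι ν x τ) := by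
  have hn0 : n ≠ 0 := by omega
  obtain ⟨U, U', hc, hG', hxU, hU'⟩ := h.exists_isHypersurfaceChart x
  set c := (conormalFactor g t ι ν x)⁻¹ with hcdef
  have hz : localMap I J ι x (extChartAt J x x) = extChartAt I (ι x) (ι x) :=
    localMap_source (mem_extChartAt_source _)
  have h1 := tractorCoords_tractorCurv (isSmoothMetric_metricCoords g (ι x))
    (mem_extChartAt_target (ι x)) (mfderiv J I ι x u) (mfderiv J I ι x v) τ
  rw [h.mfderiv_eq, h.mfderiv_eq, ← hz] at h1
  have h2 : tractorBil (metricCoords I g.inner (ι x) (localMap I J ι x (extChartAt J x x)))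
      (tractorCoords I (ι x) (ι x) (sigmaProj I J g.inner ι ν x τ))
      (localTractor t (ι x) (localMap I J ι x (extChartAt J x x))) = 0 := by
    rw [h.tractorCoords_sigmaProj hn0]
    exact hc.tractorBil_normalProj hxU _
  unfold sigmaCurv
  split_ifs with hn2
  · refine tractorCoords_injective (ι x) ?_
    rw [h.tractorCoords_projectedCurv hn0, IsHypersurfaceChart.normalProj_of_orthogonal h2, h1,
      h.tractorCoords_sigmaProj hn0, hc.curv_normalProj hxU]
  have hn3 : 3 ≤ n := by omega
  have hmem : InSigmaBundle I J g.inner ι ν x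
      (tractorCurv I g.inner (ι x) (mfderiv J I ι x u) (mfderiv J I ι x v) τ) := by
    rw [h.inSigmaBundle_iff hn0, tractorMetric_eq g (mem_extChartAt_source _), h1,
      ← localTractor_source (t := t) (mem_extChartAt_source _), ← hz]
    exact hc.tractorBil_curv hxU _ _ _
  have h3 : tractorCurv J (inducedMetric I J g.inner ι) x u v
      (toIntrinsic I J g.inner ι ν x (sigmaProj I J g.inner ι ν x τ)) =
      toIntrinsic I J g.inner ι ν x
        (tractorCurv I g.inner (ι x) (mfderiv J I ι x u) (mfderiv J I ι x v) τ) := by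
    refine tractorCoords_injective x ?_
    rw [tractorCoords_tractorCurv (hc.isSmoothMetric hG') hxU,
      h.tractorCoords_toIntrinsic hn0 (mem_extChartAt_source _) (mem_extChartAt_source _) rfl,
      h.tractorCoords_toIntrinsic hn0 (mem_extChartAt_source _) (mem_extChartAt_source _) rfl, h1,
      ← hc.curv_normalProj hxU, ← h.tractorCoords_sigmaProj hn0,
      ← curv_congr hc.dom (fun y hy => tractorConn_congr (hc.gaussSchouten_eq hG' hn3 hy)) hxU]
    exact hc.curv_toIntrinsicMap hG' hxU h2 _ _
  rw [h3, h.ofIntrinsic_toIntrinsic x hmem]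

/-- In dimensions other than four the tractor curvature is the trivial extension of the curvature
of the intrinsic connection. -/
theorem tractorCurv_eq_sigmaCurvExt (h : IsEinsteinHypersurface J g t ι ν) (hn : 2 ≤ n)
    (hn4 : n + 1 ≠ 4) (x : S) (u v : TangentSpace I (ι x)) (τ : Tractor I (ι x)) :
    tractorCurv I g.inner (ι x) u v τ = sigmaCurvExt I J g.inner ι ν x u v τ := by
  obtain ⟨U, U', hc, hG', hxU, hU'⟩ := h.exists_isHypersurfaceChart x
  have hz : localMap I J ι x (extChartAt J x x) = extChartAt I (ι x) (ι x) :=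
    localMap_source (mem_extChartAt_source _)
  rw [sigmaCurvExt, ← h.tractorCurv_eq_sigmaCurv hn]
  refine tractorCoords_injective (ι x) ?_
  rw [tractorCoords_tractorCurv (isSmoothMetric_metricCoords g (ι x)) (mem_extChartAt_target (ι x)),
    tractorCoords_tractorCurv (isSmoothMetric_metricCoords g (ι x)) (mem_extChartAt_target (ι x)),
    h.mfderiv_eq, h.mfderiv_eq, ← hz]
  exact congrArg (fun L : TractorCoords (n + 1) →L[ℝ] TractorCoords (n + 1) => L _)
    (hc.curv_eq_tangential hn hn4 hG' hxU (h.metricBil_tangentProj x u)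
      (h.metricBil_tangentProj x v))

end IsEinsteinHypersurface

end Hypersurface

/-- The zero set of a function with negative `S(g, σ)` is a regular level set. -/
theorem mfderiv_ne_zero_of_scalarQuantity_neg {d : ℕ} {H : Type*} [TopologicalSpace H]
    {I : ModelWithCorners ℝ (Euc d) H} {M : Type*} [TopologicalSpace M] [ChartedSpace H M]
    [IsManifold I ∞ M] {g : MetricField I M} {σ : M → ℝ} {x : M}
    (hσ : MDifferentiableAt I 𝓘(ℝ, ℝ) σ x) (h0 : σ x = 0) (hS : scalarQuantity I g σ x < 0) :
    mfderiv I 𝓘(ℝ, ℝ) σ x ≠ 0 := by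
  intro h1
  rw [hσ.mfderiv] at h1
  have h2 : ∀ a, pd (range I) a (fun y => σ ((extChartAt I x).symm y)) (extChartAt I x x) = 0 :=
    fun a => congrArg (fun L : Euc d →L[ℝ] ℝ => L (EuclideanSpace.single a 1)) h1
  simp only [scalarQuantity, h2, (extChartAt I x).left_inv (mem_extChartAt_source x), h0, mul_zero,
    zero_mul, Finset.sum_const_zero, sub_zero, lt_self_iff_false] at hS

section Manifold

variable {d : ℕ} {H : Type*} [TopologicalSpace H] {I : ModelWithCorners ℝ (Euc d) H}
  {M : Type*} [TopologicalSpace M] [ChartedSpace H M] [IsManifold I ∞ M]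
  (g : ContMDiffRiemannianMetric I ∞ (Euc d) (TangentSpace I : M → Type _))
  {t : ∀ x : M, Tractor I x}

theorem mdifferentiableAt_scale (ht : SmoothTractorAlong I I id t univ)
    (hpar : IsParallelTractor I g.inner t) (x : M) :
    MDifferentiableAt I 𝓘(ℝ, ℝ) (fun y => (t y).1) x := by
  rw [← mdifferentiableWithinAt_univ]
  exact (mderiv_scale g ht hpar (f := id) (mem_univ x) (uniqueMDiffWithinAt_univ I)
    mdifferentiableWithinAt_id).1

theorem mfderiv_scale (ht : SmoothTractorAlong I I id t univ)
    (hpar : IsParallelTractor I g.inner t) (x : M) (w : TangentSpace I x) :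
    mfderiv I 𝓘(ℝ, ℝ) (fun y => (t y).1) x w = (t x).2.1 w := by
  have h1 := (mderiv_scale g ht hpar (f := id) (mem_univ x) (uniqueMDiffWithinAt_univ I)
    mdifferentiableWithinAt_id).2 w
  rw [mfderivWithin_univ, mfderiv_id] at h1
  rw [← mfderivWithin_univ]
  exact h1

end Manifold

section Hypersurface

variable {n : ℕ} {H : Type*} [TopologicalSpace H] {I : ModelWithCorners ℝ (Euc (n + 1)) H}
  {M : Type*} [TopologicalSpace M] [ChartedSpace H M] [IsManifold I ∞ M]
  {H' : Type*} [TopologicalSpace H'] {J : ModelWithCorners ℝ (Euc n) H'}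
  {S : Type*} [TopologicalSpace S] [ChartedSpace H' S] [IsManifold J ∞ S]
  {g : ContMDiffRiemannianMetric I ∞ (Euc (n + 1)) (TangentSpace I : M → Type _)}
  {t : ∀ x : M, Tractor I x} {ι : S → M} {ν : ∀ x : S, TangentSpace I (ι x) →L[ℝ] ℝ}

namespace IsEinsteinHypersurface

/-- Parallel transport preserves the complement of the normal tractor. -/
theorem inSigmaBundle_of_parallel (h : IsEinsteinHypersurface J g t ι ν) (hn : n ≠ 0) {γ : ℝ → S}
    {a b : ℝ} (hab : a < b) (hγ : ContMDiffOn 𝓘(ℝ, ℝ) J ∞ γ (Icc a b))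
    {V : ∀ r, Tractor I (ι (γ r))}
    (hV : SmoothTractorAlong I 𝓘(ℝ, ℝ) (fun r => ι (γ r)) V (Icc a b))
    (hp : ∀ r ∈ Icc a b, ∀ w,
      tractorDeriv I 𝓘(ℝ, ℝ) g.inner (fun r => ι (γ r)) V (Icc a b) r w = 0)
    (h0 : InSigmaBundle I J g.inner ι ν (γ a) (V a)) {r : ℝ} (hr : r ∈ Icc a b) :
    InSigmaBundle I J g.inner ι ν (γ r) (V r) := by
  let β : ℝ → ℝ := fun r => tractorMetric I g.inner (ι (γ r)) (V r) (t (ι (γ r)))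
  have h1 : ∀ r ∈ Icc a b, MDifferentiableWithinAt 𝓘(ℝ, ℝ) 𝓘(ℝ, ℝ) β (Icc a b) r ∧
      ∀ w, mderiv 𝓘(ℝ, ℝ) β (Icc a b) r w = 0 := by
    intro r hr
    have h2 := mderiv_tractorMetric g h.smooth_tractor h.parallel hr
      (uniqueDiffOn_Icc hab r hr).uniqueMDiffWithinAt
      ((h.mdifferentiableAt (γ r)).comp_mdifferentiableWithinAt r
        ((hγ r hr).mdifferentiableWithinAt (by simp)))
      ((hV r hr).mdifferentiableWithinAt (by simp))
    refine ⟨h2.1, fun w => (h2.2 w).trans ?_⟩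
    have h3 : tractorDeriv I 𝓘(ℝ, ℝ) g.inner (ι ∘ γ) V (Icc a b) r w = 0 := hp r hr w
    rw [h3, tractorMetric_zero_left]
  have h4 : β r = β a := by
    refine (convex_Icc a b).is_const_of_fderivWithin_eq_zero (𝕜 := ℝ)
      (fun r hr => (h1 r hr).1.differentiableWithinAt) (fun r hr => ?_) hr (left_mem_Icc.2 hab.le)
    rw [← mfderivWithin_eq_fderivWithin]
    exact ContinuousLinearMap.ext fun w => (h1 r hr).2 w
  rw [h.inSigmaBundle_iff hn] at h0 ⊢
  exact h4.trans h0

/-- The parallel transport of the intrinsic connection is the restriction of the ambient one. -/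
theorem isTransport_iff (h : IsEinsteinHypersurface J g t ι ν) (hn : 2 ≤ n) {γ : ℝ → S}
    {a b : ℝ} (hab : a < b) (hγ : ContMDiffOn 𝓘(ℝ, ℝ) J ∞ γ (Icc a b))
    {t₀ : Tractor I (ι (γ a))} {t₁ : Tractor I (ι (γ b))}
    (h0 : InSigmaBundle I J g.inner ι ν (γ a) t₀) :
    IsTransport I g.inner (fun r => ι (γ r)) a b t₀ t₁ ↔
      IsSigmaTransport I J g.inner ι ν γ a b t₀ t₁ := by
  have key : ∀ V : ∀ r, Tractor I (ι (γ r)),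
      SmoothTractorAlong I 𝓘(ℝ, ℝ) (fun r => ι (γ r)) V (Icc a b) →
      (∀ r ∈ Icc a b, InSigmaBundle I J g.inner ι ν (γ r) (V r)) → ∀ r ∈ Icc a b, ∀ w,
      sigmaDeriv I J g.inner ι ν 𝓘(ℝ, ℝ) γ V (Icc a b) r w =
        tractorDeriv I 𝓘(ℝ, ℝ) g.inner (fun r => ι (γ r)) V (Icc a b) r w :=
    fun V hV hV0 r hr w => h.sigmaDeriv_eq_tractorDeriv hn hr
      (uniqueDiffOn_Icc hab r hr).uniqueMDiffWithinAt
      ((hγ r hr).mdifferentiableWithinAt (by simp)) ((hV r hr).mdifferentiableWithinAt (by simp))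
      hV0 w
  constructor
  · rintro ⟨V, hV, hp, rfl, rfl⟩
    have hV0 : ∀ r ∈ Icc a b, InSigmaBundle I J g.inner ι ν (γ r) (V r) := fun r hr =>
      h.inSigmaBundle_of_parallel (by omega) hab hγ hV hp h0 hr
    exact ⟨V, hV, hV0, fun r hr w => (key V hV hV0 r hr w).trans (hp r hr w), rfl, rfl⟩
  · rintro ⟨V, hV, hV0, hp, rfl, rfl⟩
    exact ⟨V, hV, fun r hr w => (key V hV hV0 r hr w).symm.trans (hp r hr w), rfl, rfl⟩

end IsEinsteinHypersurface

end Hypersurface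

end ConformalTractor

end

theorem mainTheorem5 {n : ℕ} (hn : 2 ≤ n)
    -- a smooth manifold `M` of dimension `d = n + 1`, with a representative of its conformal structure
    {H : Type*} [TopologicalSpace H]
    (I : ModelWithCorners ℝ (EuclideanSpace ℝ (Fin (n + 1))) H)
    {M : Type*} [TopologicalSpace M] [T2Space M] [SecondCountableTopology M]
    [ChartedSpace H M] [IsManifold I ∞ M]
    (g : ContMDiffRiemannianMetric I ∞ (EuclideanSpace ℝ (Fin (n + 1)))
      (TangentSpace I : M → Type _))
    -- a scalar negative almost Einstein structure, with parallel tractor `t = (σ, μ, ρ)`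
    (t : ∀ x : M, ConformalTractor.Tractor I x)
    (ht : ConformalTractor.SmoothTractorAlong I I id t univ)
    (hpar : ConformalTractor.IsParallelTractor I g.inner t)
    (hneg : ∀ x, ConformalTractor.scalarQuantity I g.inner (fun y => (t y).1) x < 0)
    -- an immersed hypersurface `ι : S → M` in the zero set of `σ`, with a unit conormal field `ν`
    {H' : Type*} [TopologicalSpace H']
    (J : ModelWithCorners ℝ (EuclideanSpace ℝ (Fin n)) H')
    {S : Type*} [TopologicalSpace S] [ChartedSpace H' S] [IsManifold J ∞ S]
    (ι : S → M) (hι : ContMDiff J I ∞ ι)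
    (himm : ∀ x, Function.Injective (mfderiv J I ι x))
    (hzero : ∀ x, (t (ι x)).1 = 0)
    (ν : ∀ x : S, TangentSpace I (ι x) →L[ℝ] ℝ)
    (hν : ConformalTractor.IsUnitConormal I J g.inner ι ν) :
    -- the zero set of `σ` is a regular level set
    (∀ x, (t x).1 = 0 → mfderiv I 𝓘(ℝ, ℝ) (fun y => (t y).1) x ≠ 0) ∧
    -- the ambient tractor connection preserves `𝒯_Σ` and restricts to the intrinsic connection
    (∀ V : ∀ x : S, ConformalTractor.Tractor I (ι x),
      ConformalTractor.SmoothTractorAlong I J ι V univ →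
      (∀ x, ConformalTractor.InSigmaBundle I J g.inner ι ν x (V x)) →
      ∀ (x : S) (w : TangentSpace J x),
        ConformalTractor.InSigmaBundle I J g.inner ι ν x
          (ConformalTractor.tractorDeriv I J g.inner ι V univ x w) ∧
        ConformalTractor.sigmaDeriv I J g.inner ι ν J id V univ x w =
          ConformalTractor.tractorDeriv I J g.inner ι V univ x w) ∧
    -- the intrinsic parallel transport is the restriction of the ambient one
    (∀ (γ : ℝ → S) (a b : ℝ), a < b → ContMDiffOn 𝓘(ℝ, ℝ) J ∞ γ (Icc a b) →
      ∀ (t₀ : ConformalTractor.Tractor I (ι (γ a))) (t₁ : ConformalTractor.Tractor I (ι (γ b))),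
        ConformalTractor.InSigmaBundle I J g.inner ι ν (γ a) t₀ →
        (ConformalTractor.IsTransport I g.inner (fun r => ι (γ r)) a b t₀ t₁ ↔
          ConformalTractor.IsSigmaTransport I J g.inner ι ν γ a b t₀ t₁)) ∧
    -- `Ω(u, v) = Ω^Σ(u, v)` for `u`, `v` tangent to the hypersurface
    (∀ (x : S) (u v : TangentSpace J x) (τ : ConformalTractor.Tractor I (ι x)),
      ConformalTractor.tractorCurv I g.inner (ι x) (mfderiv J I ι x u) (mfderiv J I ι x v) τ =
        ConformalTractor.sigmaCurv I J g.inner ι ν x u v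
          (ConformalTractor.sigmaProj I J g.inner ι ν x τ)) ∧
    -- `Ω = Ω^Σ` if `d ≠ 4`
    (n + 1 ≠ 4 → ∀ (x : S) (u v : TangentSpace I (ι x)) (τ : ConformalTractor.Tractor I (ι x)),
      ConformalTractor.tractorCurv I g.inner (ι x) u v τ =
        ConformalTractor.sigmaCurvExt I J g.inner ι ν x u v τ) := by
  have hne : ∀ x, (t x).1 = 0 → mfderiv I 𝓘(ℝ, ℝ) (fun y => (t y).1) x ≠ 0 := fun x hx =>
    ConformalTractor.mfderiv_ne_zero_of_scalarQuantity_neg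
      (ConformalTractor.mdifferentiableAt_scale g ht hpar x) hx (hneg x)
  have h : ConformalTractor.IsEinsteinHypersurface J g t ι ν :=
    { smooth_tractor := ht
      parallel := hpar
      smooth := hι
      immersion := himm
      zero := hzero
      ne_zero := fun x hx => hne (ι x) (hzero x) (ContinuousLinearMap.ext fun w =>
        (ConformalTractor.mfderiv_scale g ht hpar (ι x) w).trans (by rw [hx]; rfl))
      conormal := hν.1
      conormal_norm := fun x => (hν.2 x).1
      conormal_tangent := fun x => (hν.2 x).2 }
  refine ⟨hne, fun V hV hV0 x w => ?_, fun γ a b hab hγ t₀ t₁ h0 => h.isTransport_iff hn hab hγ h0,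
    h.tractorCurv_eq_sigmaCurv hn, h.tractorCurv_eq_sigmaCurvExt hn⟩
  have hx := (hV x (mem_univ x)).mdifferentiableWithinAt (by simp)
  exact ⟨h.inSigmaBundle_tractorDeriv (f := id) (by omega) (mem_univ x)
      (uniqueMDiffWithinAt_univ J) mdifferentiableWithinAt_id hx (fun y _ => hV0 y) w,
    h.sigmaDeriv_eq_tractorDeriv (f := id) hn (mem_univ x) (uniqueMDiffWithinAt_univ J)
      mdifferentiableWithinAt_id hx (fun y _ => hV0 y) w⟩
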